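/- Let $l,a,k\ge 0$ be integers, let $\nu=(\nu_1,\dots,\nu_k)$ be a composition with parts $\nu_i\ge 0$, let $W\subseteq[k]=\{1,\dots,k\}$, and put $|\nu|=\sum_i\nu_i$, $m=|\nu|+a$. **Multisets.** Let $\mathcal M_W(\nu;a)$ be the set of finite multisets $M$ of points of $[k]\times[k]$ such that: $M$ is symmetric under $(i,j)\mapsto(j,i)$; $(i,j)$ has multiplicity at most $1$ whenever exactly one of $i,j$ lies in $W$; each $i$ occurs exactly $\nu_i$ times as a first coordinate; and $M$ has exactly $a$ fixed points, where the number of fixed points at $i$ is the multiplicity of $(i,i)$ if $i\in W$, and is $1$ or $0$ according to whether that multiplicity is odd or even if $i\notin W$. A sequence of points $(x_r,y_r)$ is $(W,W)$-increasing if $x_r\le x_{r+1}$, $y_r\le y_{r+1}$, with $x_r=x_{r+1}$ only if $x_r\in W$ and $y_r=y_{r+1}$ only if $y_r\in W$. Let $\ell_{WW}(M)$ be the length of the longest $(W,W)$-increasing sequence in which each point is used at most as often as it occurs in $M$. **Invariants.** Let $V=\mathbb C^l$ with standard basis $e_1,\dots,e_l$. Let $F_m(O(l))\subseteq V^{\otimes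 m}$ be the space of tensors fixed by $U^{\otimes m}$ for every $U$ in the real orthogonal group $O(l)$. For $\pi\in S_m$ let $T_l(\pi)(v_1\otimes\cdots\otimes v_m)=v_{\pi(1)}\otimes\cdots\otimes v_{\pi(m)}$. For $S\subseteq\{1,\dots,m\}$ let $E_S=\sum_\pi \operatorname{sgn}(\pi)\,T_l(\pi)$ and $H_S=\sum_\pi T_l(\pi)$, the sums being over the $\pi\in S_m$ fixing every element outside $S$. Divide the positions $1,\dots,m$ into consecutive blocks $S_1,\dots,S_k,S_\infty$ of sizes $\nu_1,\dots,\nu_k,a$, and set $$\Pi(\nu;a)=\prod_{i\in W}E_{S_i}\prod_{i\notin W}H_{S_i}\cdot E_{S_\infty}.$$ For a fixed-point-free involution $\tau\in S_m$ let $$T_l(\tau)=\sum_{w} e_{w_1}\otimes\cdots\otimes e_{w_m},$$ the sum being over the words $w\in\{1,\dots,l\}^m$ with $w_{\tau(p)}=w_p$ for all $p$. For $M\in\mathcal M_W(\nu;a)$, let $M^\infty$ be obtained by replacing each fixed point $(i,i)$ of $M$ by the two points $(i,\infty)$ and $(\infty,i)$. (If $i\notin W$ and $(i,i)$ has odd multiplicity,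 just one copy of $(i,i)$ is replaced.) A fixed-point-free involution $\tau\in S_m$ corresponds to $M$ if, for all $u,v\in[k]\cup\{\infty\}$, the number of $p\in S_u$ with $\tau(p)\in S_v$ is the multiplicity of $(u,v)$ in $M^\infty$. Put $T_l(M)=\Pi(\nu;a)\,T_l(\tau)$ for any such $\tau$. **Theorem.** For each $M\in\mathcal M_W(\nu;a)$ a corresponding fixed-point-free involution exists, and $T_l(M)$ is independent of its choice up to sign. For any choice of these signs, the elements $$T_l(M),\qquad M\in\mathcal M_W(\nu;a),\quad \ell_{WW}(M)\le l,$$ are linearly independent and span $\Pi(\nu;a)\,F_m(O(l))$; that is, they form a basis of this space. The case $a=0$ is the special case without fixed points. -/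

import Mathlib

open scoped TensorProduct

noncomputable section

namespace OrthInv

/-! ### Multisets of points and increasing subsequences -/

section Multisets

variable {Ω₁ Ω₂ : Type*} [LinearOrder Ω₁] [LinearOrder Ω₂]

/-- `q` may follow `p` in a `(W₁, W₂)`-increasing sequence: both coordinates weakly increase, and a
coordinate may stay equal only at a value in `W₁` (resp. `W₂`). -/
def Step (W₁ : Finset Ω₁) (W₂ : Finset Ω₂) (p q : Ω₁ × Ω₂) : Prop :=
  p.1 ≤ q.1 ∧ p.2 ≤ q.2 ∧ (p.1 = q.1 → p.1 ∈ W₁) ∧ (p.2 = q.2 → p.2 ∈ W₂)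

/-- `L` is a `(W₁, W₂)`-increasing subsequence of the multiset `M`; an element appears in `L` at
most as many times as it appears in `M`. -/
def IsIncSubseq (W₁ : Finset Ω₁) (W₂ : Finset Ω₂) (M : Multiset (Ω₁ × Ω₂))
    (L : List (Ω₁ × Ω₂)) : Prop :=
  List.IsChain (Step W₁ W₂) L ∧ (L : Multiset (Ω₁ × Ω₂)) ≤ M

/-- The length of the longest `(W₁, W₂)`-increasing subsequence of `M`. -/
def incLength (W₁ : Finset Ω₁) (W₂ : Finset Ω₂) (M : Multiset (Ω₁ × Ω₂)) : ℕ :=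
  sSup {r | ∃ L, IsIncSubseq W₁ W₂ M L ∧ L.length = r}

/-- The supremum defining `incLength` is that of a nonempty bounded set of lengths. -/
theorem incLength_le_iff (W₁ : Finset Ω₁) (W₂ : Finset Ω₂) (M : Multiset (Ω₁ × Ω₂)) (l : ℕ) :
    incLength W₁ W₂ M ≤ l ↔ ∀ L, IsIncSubseq W₁ W₂ M L → L.length ≤ l := by
  have hb : BddAbove {r | ∃ L, IsIncSubseq W₁ W₂ M L ∧ L.length = r} := by
    refine ⟨Multiset.card M, ?_⟩
    rintro r ⟨L, hL, rfl⟩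
    simpa using Multiset.card_le_card hL.2
  constructor
  · intro h L hL
    exact (le_csSup hb ⟨L, hL, rfl⟩).trans h
  · intro h
    refine csSup_le ⟨0, [], ⟨List.isChain_nil, ?_⟩, rfl⟩ ?_
    · simp
    · rintro r ⟨L, hL, rfl⟩
      exact h L hL

/-- `M` is `(W₁, W₂)`-compatible: `(i, j)` occurs at most once whenever exactly one of `i ∈ W₁`,
`j ∈ W₂` holds. -/
def IsCompatible (W₁ : Finset Ω₁) (W₂ : Finset Ω₂) (M : Multiset (Ω₁ × Ω₂)) : Prop :=
  ∀ i j, ¬(i ∈ W₁ ↔ j ∈ W₂) → M.count (i, j) ≤ 1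

end Multisets

section Symmetric

variable {k : ℕ}

/-- The number of fixed points of `M` at `i`: the multiplicity of `(i, i)` if `i ∈ W`; otherwise
`1` or `0` according to whether that multiplicity is odd or even. -/
def fixedAt (W : Finset (Fin k)) (M : Multiset (Fin k × Fin k)) (i : Fin k) : ℕ :=
  if i ∈ W then M.count (i, i) else M.count (i, i) % 2

/-- The symmetric `(W, W)`-compatible multisets with content `ν` and with `a` fixed points. -/
def symMultisets (W : Finset (Fin k)) (ν : Fin k → ℕ) (a : ℕ) : Set (Multiset (Fin k × Fin k)) :=
  {M | M.map Prod.swap = M ∧ IsCompatible W W M ∧ (∀ i, (M.map Prod.fst).count i = ν i) ∧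
    ∑ i, fixedAt W M i = a}

/-- The multiset of all `i`, each repeated as often as `M` has fixed points at `i`. -/
def fixedPart (W : Finset (Fin k)) (M : Multiset (Fin k × Fin k)) : Multiset (Fin k) :=
  ∑ i, Multiset.replicate (fixedAt W M i) i

/-- Adjoin a largest symbol `∞ = ⊤` and replace each fixed point `(i, i)` of `M` by the two
elements `(i, ∞)` and `(∞, i)`. -/
def unfix (W : Finset (Fin k)) (M : Multiset (Fin k × Fin k)) :
    Multiset (WithTop (Fin k) × WithTop (Fin k)) :=
  (M - (fixedPart W M).map (fun i => (i, i))).map (fun p => ((p.1 : WithTop (Fin k)), (p.2 : WithTop (Fin k)))) +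
    (fixedPart W M).map (fun i => ((i : WithTop (Fin k)), (⊤ : WithTop (Fin k)))) +
    (fixedPart W M).map (fun i => ((⊤ : WithTop (Fin k)), (i : WithTop (Fin k))))

/-- The consecutive blocks of positions: the block of `i` has `ν i` elements, and the block of `∞`
consists of the last `a` positions. -/
def block (ν : Fin k → ℕ) (a : ℕ) : WithTop (Fin k) → Finset (Fin ((∑ i, ν i) + a))
  | (i : Fin k) => {p | ∑ j with j < i, ν j ≤ (p : ℕ) ∧ (p : ℕ) < ∑ j with j ≤ i, ν j}
  | ⊤ => {p | ∑ j, ν j ≤ (p : ℕ)}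

end Symmetric

/-! ### Tensor powers, invariants and (anti)symmetrizers -/

/-- The tensor power `(ℂ^l)^{⊗ m}`. -/
abbrev TensorPow (l m : ℕ) : Type := ⨂[ℂ] _ : Fin m, (Fin l → ℂ)

/-- The operator `U^{⊗ m}` for a real matrix `U` acting on `ℂ^l`. -/
def tensorAct (l m : ℕ) (U : Matrix (Fin l) (Fin l) ℝ) : Module.End ℂ (TensorPow l m) :=
  PiTensorProduct.map (fun _ => Matrix.toLin' (U.map (fun x : ℝ => (x : ℂ))))

/-- The space of tensors fixed by `U^{⊗ m}` for all `U` in the orthogonal group `O(l)`. -/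
def orthInvariants (l m : ℕ) : Submodule ℂ (TensorPow l m) :=
  ⨅ U ∈ Matrix.orthogonalGroup (Fin l) ℝ, LinearMap.eqLocus (tensorAct l m U) LinearMap.id

/-- The operator `v_1 ⊗ ⋯ ⊗ v_m ↦ v_{π(1)} ⊗ ⋯ ⊗ v_{π(m)}`. -/
def permAct (l : ℕ) {m : ℕ} (π : Equiv.Perm (Fin m)) : Module.End ℂ (TensorPow l m) :=
  (PiTensorProduct.reindex ℂ (fun _ : Fin m => (Fin l → ℂ)) π.symm).toLinearMap

theorem permAct_tprod (l : ℕ) {m : ℕ} (π : Equiv.Perm (Fin m)) (v : Fin m → Fin l → ℂ) :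
    permAct l π (PiTensorProduct.tprod ℂ v) = PiTensorProduct.tprod ℂ (fun p => v (π p)) := by
  simp [permAct]

/-- The antisymmetrizer `E_S`, acting on the tensor power. -/
def antisymmetrizer (l : ℕ) {m : ℕ} (S : Finset (Fin m)) : Module.End ℂ (TensorPow l m) :=
  ∑ π : Equiv.Perm (Fin m) with ∀ x, x ∉ S → π x = x, ((Equiv.Perm.sign π : ℤ) : ℂ) • permAct l π

/-- The symmetrizer `H_S`, acting on the tensor power. -/
def symmetrizer (l : ℕ) {m : ℕ} (S : Finset (Fin m)) : Module.End ℂ (TensorPow l m) :=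
  ∑ π : Equiv.Perm (Fin m) with ∀ x, x ∉ S → π x = x, permAct l π

/-- The operator `Π(ν; a)`: antisymmetrize over the block of each `i ∈ W` and over the block of
`∞`, symmetrize over the block of each `i ∉ W`. The factors act on disjoint sets of positions and
hence commute. -/
def blockOp (l : ℕ) {k : ℕ} (W : Finset (Fin k)) (ν : Fin k → ℕ) (a : ℕ) :
    Module.End ℂ (TensorPow l ((∑ i, ν i) + a)) :=
  (List.ofFn fun i : Fin k =>
    if i ∈ W then antisymmetrizer l (block ν a i) else symmetrizer l (block ν a i)).prod *
  antisymmetrizer l (block ν a ⊤)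

/-- `τ` is a fixed-point-free involution. -/
def IsFPFInvolution {m : ℕ} (τ : Equiv.Perm (Fin m)) : Prop :=
  (∀ p, τ (τ p) = p) ∧ ∀ p, τ p ≠ p

/-- The basic invariant of a fixed-point-free involution `τ`: the sum of `e_{w 1} ⊗ ⋯ ⊗ e_{w m}`
over all words `w` constant on the orbits of `τ`. Equivalently, it is the product over the orbits
`{p, q}` of `τ` of the invariant tensors `∑ c, e_c ⊗ e_c` in positions `p` and `q`. -/
def involutionInvariant (l : ℕ) {m : ℕ} (τ : Equiv.Perm (Fin m)) : TensorPow l m :=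
  ∑ w : Fin m → Fin l with ∀ p, w (τ p) = w p,
    PiTensorProduct.tprod ℂ (fun p => (Pi.single (w p) 1 : Fin l → ℂ))

/-- `τ` corresponds to `M`: for all symbols `u`, `v` (including `∞`), the number of positions `p` in
the block of `u` with `τ p` in the block of `v` is the multiplicity of `(u, v)` in the multiset
obtained from `M` by replacing its fixed points. -/
def Corresponds {k : ℕ} (W : Finset (Fin k)) (ν : Fin k → ℕ) (a : ℕ)
    (τ : Equiv.Perm (Fin ((∑ i, ν i) + a))) (M : Multiset (Fin k × Fin k)) : Prop :=
  ∀ u v : WithTop (Fin k),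
    (unfix W M).count (u, v) = ((block ν a u).filter fun p => τ p ∈ block ν a v).card

/-- `t` is a basic invariant `T_l(M)` of the multiset `M`: it is `Π(ν; a) T_l(τ)` for some
fixed-point-free involution `τ` corresponding to `M`. -/
def IsBasicInvariant (l : ℕ) {k : ℕ} (W : Finset (Fin k)) (ν : Fin k → ℕ) (a : ℕ)
    (M : Multiset (Fin k × Fin k)) (t : TensorPow l ((∑ i, ν i) + a)) : Prop :=
  ∃ τ : Equiv.Perm (Fin ((∑ i, ν i) + a)),
    IsFPFInvolution τ ∧ Corresponds W ν a τ M ∧ t = blockOp l W ν a (involutionInvariant l τ)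

end OrthInv

end

/-! Tensors are replaced by their coordinates, functions on words w : P → Fin l on the set P of
positions. The invariant of a pairing τ becomes `pairFun`, the indicator of the words constant on
the pairs of τ, and Π(ν; a) becomes `labOp`, the signed sum over all permutations that preserve the
block labels. Conjugating τ by such a permutation changes its image only by a sign, and pairings
with equal numbers of pairs between any two blocks are conjugate in this way
(`exists_conj_of_typeCount_eq`). A pairing is killed by an odd symmetry if it joins two positions of
an antisymmetrized block, or joins such a block twice to the same symmetrized block. The types of
the remaining, reduced pairings are exactly the multisets M.

Pairings span the invariants (`orthInvariantFun_eq_span`). An invariant orthogonal to all pairings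
has, by induction, vanishing contractions. Let E_ab be the matrix units acting as derivations.
Differentiating rotations gives E_ab X = E_ba X, and for traceless X this yields ∑ ‖E_ab X‖² = |P|
‖X‖². The diagonal terms alone are at least this large, so X is supported on words without repeated
letters and is killed by all off-diagonal E_ab; then X = 0.

Spanning (`labOp_pairFun_mem`). If M has an increasing sequence longer than l, antisymmetrizing over
one end of each of l + 1 of its pairs gives zero. Under a suitable weight an increasing chain is the
heaviest matching of its rows and columns (`IsChainData.sum_le`). Hence every term of the relation
is either lighter or equal to the original image with coefficient +1, and induction on the weight
straightens τ.

Independence (`linearIndependent_labOp_pairFun`). If no increasing sequence of M is longer than l,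
colouring positions by their height in the order of increasing sequences gives a word w whose colour
classes are decreasing. At this w the image of τ is a sum of terms +1
(`labSign_eq_one_of_invariant`). Decreasing arrangements minimize every corner count for given
marginals, so the image of another type is nonzero at w only if its total corner count is strictly
larger. The evaluation matrix is therefore triangular. -/

set_option linter.unusedSectionVars false
noncomputable section
namespace OrthInv

/-! ### Coordinates on the tensor power -/

/-- The standard basis of the tensor power, indexed by words. -/
def wordBasis (l m : ℕ) : Module.Basis (Fin m → Fin l) ℂ (TensorPow l m) :=
  Basis.piTensorProduct (fun _ => Pi.basisFun ℂ (Fin l))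

/-- The coordinates of a tensor, as a function on words. -/
def coords (l m : ℕ) : TensorPow l m ≃ₗ[ℂ] ((Fin m → Fin l) → ℂ) :=
  (wordBasis l m).equivFun

theorem coords_tprod (l m : ℕ) (v : Fin m → Fin l → ℂ) (w : Fin m → Fin l) :
    coords l m (PiTensorProduct.tprod ℂ v) w = ∏ p, v p (w p) := by
  simp [coords, wordBasis, Basis.piTensorProduct_repr_tprod_apply]

/-- The coordinate function of the basic invariant of `τ`. -/
def pairFun (l : ℕ) {P : Type*} [Fintype P] (τ : Equiv.Perm P) : (P → Fin l) → ℂ :=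
  fun w => if ∀ p, w (τ p) = w p then 1 else 0

theorem tensor_ext {l m : ℕ} {N : Type*} [AddCommMonoid N] [Module ℂ N]
    {f g : TensorPow l m →ₗ[ℂ] N}
    (h : ∀ v, f (PiTensorProduct.tprod ℂ v) = g (PiTensorProduct.tprod ℂ v)) : f = g :=
  PiTensorProduct.ext (MultilinearMap.ext h)

/-- Positions are permuted from the right, which reverses products. -/
theorem permAct_mul (l : ℕ) {m : ℕ} (π ρ : Equiv.Perm (Fin m)) :
    permAct l π * permAct l ρ = permAct l (ρ * π) := by
  refine tensor_ext fun v => ?_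
  simp [Module.End.mul_apply, permAct_tprod]

theorem coords_permAct (l : ℕ) {m : ℕ} (π : Equiv.Perm (Fin m)) (x : TensorPow l m)
    (w : Fin m → Fin l) :
    coords l m (permAct l π x) w = coords l m x (fun p => w (π⁻¹ p)) := by
  have : (LinearMap.proj w ∘ₗ (coords l m).toLinearMap) ∘ₗ permAct l π =
      LinearMap.proj (fun p => w (π⁻¹ p)) ∘ₗ (coords l m).toLinearMap := by
    refine tensor_ext fun v => ?_
    simp only [LinearMap.comp_apply, permAct_tprod, LinearEquiv.coe_coe, LinearMap.proj_apply,
      coords_tprod]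
    rw [← Equiv.prod_comp π (fun p => v p (w (π⁻¹ p)))]
    simp
  exact LinearMap.congr_fun this x

theorem coords_involutionInvariant (l : ℕ) {m : ℕ} (τ : Equiv.Perm (Fin m)) :
    coords l m (involutionInvariant l τ) = pairFun l τ := by
  classical
  funext w
  have : ∀ u : Fin m → Fin l, (∏ p, (Pi.single (u p) 1 : Fin l → ℂ) (w p)) =
      if u = w then 1 else 0 := by
    intro u
    split_ifs with h
    · subst h; simp
    · obtain ⟨p, hp⟩ := Function.ne_iff.mp h
      exact Finset.prod_eq_zero (Finset.mem_univ p) (Pi.single_eq_of_ne (Ne.symm hp) _)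
  simp only [involutionInvariant, map_sum, Finset.sum_apply, coords_tprod, this, pairFun]
  simp [Finset.sum_ite_eq']

theorem coords_tensorAct (l : ℕ) {m : ℕ} (U : Matrix (Fin l) (Fin l) ℝ) (x : TensorPow l m)
    (w : Fin m → Fin l) :
    coords l m (tensorAct l m U x) w =
      ∑ u : Fin m → Fin l, (∏ p, (U (w p) (u p) : ℂ)) * coords l m x u := by
  have : (LinearMap.proj w ∘ₗ (coords l m).toLinearMap) ∘ₗ tensorAct l m U =
      ∑ u : Fin m → Fin l, (∏ p, (U (w p) (u p) : ℂ)) •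
        (LinearMap.proj u ∘ₗ (coords l m).toLinearMap) := by
    refine tensor_ext fun v => ?_
    simp only [LinearMap.comp_apply, LinearEquiv.coe_coe, LinearMap.proj_apply, tensorAct,
      PiTensorProduct.map_tprod, coords_tprod, LinearMap.sum_apply, LinearMap.smul_apply,
      smul_eq_mul, Matrix.toLin'_apply, Matrix.mulVec, dotProduct, Matrix.map_apply,
      ← Finset.prod_mul_distrib]
    rw [Finset.prod_univ_sum]
    simp
  have h := LinearMap.congr_fun this x
  simpa [LinearMap.sum_apply] using h

theorem mem_orthInvariants {l m : ℕ} {x : TensorPow l m} :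
    x ∈ orthInvariants l m ↔ ∀ U ∈ Matrix.orthogonalGroup (Fin l) ℝ, ∀ w : Fin m → Fin l,
      ∑ u : Fin m → Fin l, (∏ p, (U (w p) (u p) : ℂ)) * coords l m x u = coords l m x w := by
  simp only [orthInvariants, Submodule.mem_iInf, LinearMap.mem_eqLocus, LinearMap.id_apply,
    ← coords_tensorAct]
  refine forall₂_congr fun U _ => ?_
  rw [← (coords l m).injective.eq_iff, funext_iff]

/-! ### The first fundamental theorem for the orthogonal group -/

section FFT

variable {l : ℕ} {P : Type*} [Fintype P] [DecidableEq P]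

/-- Invariance under the orthogonal group, in coordinates. -/
def IsOrthInvariant (X : (P → Fin l) → ℂ) : Prop :=
  ∀ U ∈ Matrix.orthogonalGroup (Fin l) ℝ, ∀ w : P → Fin l,
    ∑ u : P → Fin l, (∏ p, (U (w p) (u p) : ℂ)) * X u = X w

theorem orthogonal_sum_rows {U : Matrix (Fin l) (Fin l) ℝ}
    (hU : U ∈ Matrix.orthogonalGroup (Fin l) ℝ) (a b : Fin l) :
    ∑ c, (U a c : ℂ) * (U b c : ℂ) = if a = b then 1 else 0 := by
  have h : U * U.transpose = 1 := (Matrix.mem_orthogonalGroup_iff _ _).mp hU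
  have h' := congrFun (congrFun h a) b
  rw [Matrix.mul_apply, Matrix.one_apply] at h'
  simp only [Matrix.transpose_apply] at h'
  have h2 : ((∑ c, U a c * U b c : ℝ) : ℂ) = ((if a = b then 1 else 0 : ℝ) : ℂ) := congrArg _ h'
  rw [Complex.ofReal_sum, apply_ite Complex.ofReal] at h2
  simpa using h2

theorem orthogonal_sum_cols {U : Matrix (Fin l) (Fin l) ℝ}
    (hU : U ∈ Matrix.orthogonalGroup (Fin l) ℝ) (a b : Fin l) :
    ∑ c, (U c a : ℂ) * (U c b : ℂ) = if a = b then 1 else 0 := by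
  have h : U.transpose * U = 1 := (Matrix.mem_orthogonalGroup_iff' _ _).mp hU
  have h' := congrFun (congrFun h a) b
  rw [Matrix.mul_apply, Matrix.one_apply] at h'
  simp only [Matrix.transpose_apply] at h'
  have h2 : ((∑ c, U c a * U c b : ℝ) : ℂ) = ((if a = b then 1 else 0 : ℝ) : ℂ) := congrArg _ h'
  rw [Complex.ofReal_sum, apply_ite Complex.ofReal] at h2
  simpa using h2

/-- A word extended from the complement of `{i, j}` by a common letter at `i` and `j`. -/
def extendWord (i j : P) (v : {p : P // p ≠ i ∧ p ≠ j} → Fin l) (c : Fin l) : P → Fin l :=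
  fun p => if h : p ≠ i ∧ p ≠ j then v ⟨p, h⟩ else c

@[simp] theorem extendWord_left (i j : P) (v : {p : P // p ≠ i ∧ p ≠ j} → Fin l) (c : Fin l) :
    extendWord i j v c i = c := by simp [extendWord]

@[simp] theorem extendWord_right (i j : P) (v : {p : P // p ≠ i ∧ p ≠ j} → Fin l) (c : Fin l) :
    extendWord i j v c j = c := by simp [extendWord]

@[simp] theorem extendWord_coe (i j : P) (v : {p : P // p ≠ i ∧ p ≠ j} → Fin l) (c : Fin l)
    (q : {p : P // p ≠ i ∧ p ≠ j}) : extendWord i j v c q = v q := by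
  simp [extendWord, q.2]

theorem sum_extendWord (i j : P) (F : (P → Fin l) → ℂ) :
    ∑ u : P → Fin l, (if u i = u j then F u else 0) =
      ∑ v : {p : P // p ≠ i ∧ p ≠ j} → Fin l, ∑ c, F (extendWord i j v c) := by
  rw [← Finset.sum_product', ← Finset.sum_filter]
  refine Finset.sum_bij' (fun u _ => ((fun q : {p : P // p ≠ i ∧ p ≠ j} => u q), u i))
    (fun x _ => extendWord i j x.1 x.2) ?_ ?_ ?_ ?_ ?_
  · simp
  · simp
  · intro u hu
    simp only [Finset.mem_filter] at hu
    funext p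
    by_cases h : p ≠ i ∧ p ≠ j
    · simp [extendWord, h]
    · simp only [extendWord, h, dite_false]
      rcases not_and_or.mp h with h | h
      · rw [not_not.mp h]
      · rw [not_not.mp h, hu.2]
  · intro x _
    ext <;> simp
  · intro u hu
    simp only [Finset.mem_filter] at hu
    congr 1
    funext p
    by_cases h : p ≠ i ∧ p ≠ j
    · simp [extendWord, h]
    · simp only [extendWord, h, dite_false]
      rcases not_and_or.mp h with h | h
      · rw [not_not.mp h]
      · rw [not_not.mp h, hu.2]

theorem prod_eq_prod_compl_pair {i j : P} (hij : i ≠ j) (f : P → ℂ) :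
    ∏ p, f p = (∏ q : {p : P // p ≠ i ∧ p ≠ j}, f q) * (f i * f j) := by
  rw [← Finset.mul_prod_erase Finset.univ f (Finset.mem_univ i),
    ← Finset.mul_prod_erase (Finset.univ.erase i) f
      (Finset.mem_erase.mpr ⟨hij.symm, Finset.mem_univ j⟩),
    Finset.prod_subtype (p := fun p => p ≠ i ∧ p ≠ j) _ (by intro x; simp [and_comm])]
  ring

/-- The contraction of a tensor at two positions. -/
def contract (i j : P) (X : (P → Fin l) → ℂ) : ({p : P // p ≠ i ∧ p ≠ j} → Fin l) → ℂ :=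
  fun v => ∑ c, X (extendWord i j v c)

/-- Expanding X by invariance, the letters at i and j meet in ∑_c U_{c,a} U_{c,b}, which is δ_{ab}
as the columns of U are orthonormal. -/
theorem IsOrthInvariant.contract {X : (P → Fin l) → ℂ} (hX : IsOrthInvariant X) {i j : P}
    (hij : i ≠ j) : IsOrthInvariant (contract i j X) := by
  intro U hU v
  have h1 : ∀ c, X (extendWord i j v c) = ∑ u : P → Fin l,
      (∏ q : {p : P // p ≠ i ∧ p ≠ j}, (U (v q) (u q) : ℂ)) * X u *
        ((U c (u i) : ℂ) * (U c (u j) : ℂ)) := by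
    intro c
    rw [← hX U hU]
    refine Finset.sum_congr rfl fun u _ => ?_
    rw [prod_eq_prod_compl_pair hij]
    simp only [extendWord_left, extendWord_right, extendWord_coe]
    ring
  have h2 : OrthInv.contract i j X v = ∑ u : P → Fin l, if u i = u j then
      (∏ q : {p : P // p ≠ i ∧ p ≠ j}, (U (v q) (u q) : ℂ)) * X u else 0 := by
    simp only [OrthInv.contract, h1]
    rw [Finset.sum_comm]
    refine Finset.sum_congr rfl fun u _ => ?_
    rw [← Finset.mul_sum, orthogonal_sum_cols hU]
    simp
  rw [h2, sum_extendWord]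
  refine Finset.sum_congr rfl fun v' _ => ?_
  simp [OrthInv.contract, Finset.mul_sum]

/-- The involution of `P` that extends one of the complement of `{i, j}` by the pair `{i, j}`. -/
def extendInvolution (i j : P) (τ : Equiv.Perm {p : P // p ≠ i ∧ p ≠ j}) : Equiv.Perm P :=
  Equiv.Perm.ofSubtype τ * Equiv.swap i j

theorem extendInvolution_left {i j : P} (τ : Equiv.Perm {p : P // p ≠ i ∧ p ≠ j}) :
    extendInvolution i j τ i = j := by
  simp [extendInvolution, Equiv.Perm.ofSubtype_apply_of_not_mem]

theorem extendInvolution_right {i j : P} (τ : Equiv.Perm {p : P // p ≠ i ∧ p ≠ j}) :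
    extendInvolution i j τ j = i := by
  simp [extendInvolution, Equiv.Perm.ofSubtype_apply_of_not_mem]

theorem extendInvolution_coe {i j : P} (τ : Equiv.Perm {p : P // p ≠ i ∧ p ≠ j})
    (q : {p : P // p ≠ i ∧ p ≠ j}) : extendInvolution i j τ q = τ q := by
  simp [extendInvolution, Equiv.swap_apply_of_ne_of_ne q.2.1 q.2.2]

theorem pairFun_extendWord {i j : P} (τ : Equiv.Perm {p : P // p ≠ i ∧ p ≠ j})
    (v : {p : P // p ≠ i ∧ p ≠ j} → Fin l) (c : Fin l) :
    pairFun l (extendInvolution i j τ) (extendWord i j v c) = pairFun l τ v := by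
  unfold pairFun
  congr 1
  refine propext ⟨fun h q => ?_, fun h p => ?_⟩
  · have := h q
    rwa [extendInvolution_coe, extendWord_coe, extendWord_coe] at this
  · by_cases hp : p ≠ i ∧ p ≠ j
    · have := h ⟨p, hp⟩
      have h' := extendInvolution_coe τ ⟨p, hp⟩
      simp only at h'
      rw [h', extendWord_coe, this, ← extendWord_coe i j v c]
    · rcases not_and_or.mp hp with h | h
      · rw [not_not.mp h, extendInvolution_left]; simp
      · rw [not_not.mp h, extendInvolution_right]; simp

/-- `τ` is a fixed-point-free involution of an arbitrary set. -/
def IsPairing {P : Type*} (τ : Equiv.Perm P) : Prop := (∀ p, τ (τ p) = p) ∧ ∀ p, τ p ≠ p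

theorem IsPairing.extend {i j : P} (hij : i ≠ j) {τ : Equiv.Perm {p : P // p ≠ i ∧ p ≠ j}}
    (hτ : IsPairing τ) : IsPairing (extendInvolution i j τ) := by
  constructor <;> intro p <;> by_cases hp : p ≠ i ∧ p ≠ j
  · have h' := extendInvolution_coe τ ⟨p, hp⟩
    simp only at h'
    rw [h', extendInvolution_coe, hτ.1]
  · rcases not_and_or.mp hp with h | h
    · rw [not_not.mp h, extendInvolution_left, extendInvolution_right]
    · rw [not_not.mp h, extendInvolution_right, extendInvolution_left]
  · have h' := extendInvolution_coe τ ⟨p, hp⟩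
    simp only at h'
    rw [h']
    intro h
    exact hτ.2 ⟨p, hp⟩ (Subtype.ext h)
  · rcases not_and_or.mp hp with h | h
    · rw [not_not.mp h, extendInvolution_left]; exact hij.symm
    · rw [not_not.mp h, extendInvolution_right]; exact hij

/-- Contraction is adjoint to adjoining the pair {i, j}, so orthogonality to all pairings is
inherited by contractions. -/
theorem sum_pairFun_contract {i j : P} {X : (P → Fin l) → ℂ}
    (τ : Equiv.Perm {p : P // p ≠ i ∧ p ≠ j}) :
    ∑ v, pairFun l τ v * contract i j X v = ∑ w, pairFun l (extendInvolution i j τ) w * X w := by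
  have : ∀ w, pairFun l (extendInvolution i j τ) w * X w =
      if w i = w j then pairFun l (extendInvolution i j τ) w * X w else 0 := by
    intro w
    split_ifs with h
    · rfl
    · have : pairFun l (extendInvolution i j τ) w = 0 := by
        refine if_neg fun h' => h ?_
        rw [← h' i, extendInvolution_left]
      simp [this]
  rw [Finset.sum_congr rfl fun w _ => this w, sum_extendWord]
  simp only [contract, Finset.mul_sum, pairFun_extendWord]

end FFT

/-! ### Infinitesimal rotations -/

section FFT
variable {l : ℕ} {P : Type*} [Fintype P] [DecidableEq P]

open Matrix in
/-- The rotation by the angle `t` in the coordinate plane of `a` and `b`. -/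
def planeRotation (a b : Fin l) (t : ℝ) : Matrix (Fin l) (Fin l) ℝ :=
  1 + (Real.cos t - 1) • (single a a 1 + single b b 1) + Real.sin t • (single b a 1 - single a b 1)

-- With D the projection to the plane and J its quarter turn, DJ = JD = J and J² = -D, so the claim
-- reduces to sin² + cos² = 1.
open Matrix in
theorem planeRotation_mem {a b : Fin l} (hab : a ≠ b) (t : ℝ) :
    planeRotation a b t ∈ Matrix.orthogonalGroup (Fin l) ℝ := by
  rw [Matrix.mem_orthogonalGroup_iff]
  set D : Matrix (Fin l) (Fin l) ℝ := single a a 1 + single b b 1 with hD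
  set J : Matrix (Fin l) (Fin l) ℝ := single b a 1 - single a b 1 with hJ
  have hne : ∀ i j i' j' : Fin l, j ≠ i' →
      (single i j 1 * single i' j' 1 : Matrix (Fin l) (Fin l) ℝ) = 0 := fun i j i' j' h => by
    simp [single_mul_single_of_ne, h]
  have hDD : D * D = D := by
    simp [hD, mul_add, add_mul, single_mul_single_of_ne, hab, hab.symm]
  have hDJ : D * J = J := by
    simp only [hD, hJ, mul_sub, add_mul, single_mul_single_same,
      hne _ _ _ _ hab, hne _ _ _ _ hab.symm, mul_one]
    abel
  have hJD : J * D = J := by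
    simp only [hD, hJ, mul_add, sub_mul, single_mul_single_same,
      hne _ _ _ _ hab, hne _ _ _ _ hab.symm, mul_one]
    abel
  have hJJ : J * J = -D := by
    simp only [hD, hJ, mul_sub, sub_mul, single_mul_single_same,
      hne _ _ _ _ hab, hne _ _ _ _ hab.symm, mul_one]
    abel
  have hDt : Dᵀ = D := by
    simp [hD]
  have hJt : Jᵀ = -J := by
    simp [hJ]
  have hst : (planeRotation a b t)ᵀ = 1 + (Real.cos t - 1) • D - Real.sin t • J := by
    simp only [planeRotation, ← hD, ← hJ, transpose_add, transpose_one, transpose_smul, hDt, hJt]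
    rw [smul_neg, ← sub_eq_add_neg]
  change _ * (planeRotation a b t)ᵀ = 1
  rw [hst]
  simp only [planeRotation, ← hD, ← hJ]
  have hcs : (Real.cos t - 1) + (Real.cos t - 1) + (Real.cos t - 1) * (Real.cos t - 1) +
      Real.sin t * Real.sin t = 0 := by
    nlinarith [Real.sin_sq_add_cos_sq t]
  simp only [mul_sub, mul_add, add_mul, one_mul, mul_one, smul_mul_smul_comm, hDD, hDJ, hJD, hJJ]
  have : (1 : Matrix (Fin l) (Fin l) ℝ) = 1 + ((Real.cos t - 1) + (Real.cos t - 1) +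
      (Real.cos t - 1) * (Real.cos t - 1) + Real.sin t * Real.sin t) • D := by
    rw [hcs]; simp
  conv_rhs => rw [this]
  module

/-- The action of a matrix unit as a derivation: each letter `b` of the word is replaced by `a`,
on one position at a time. -/
def derive (a b : Fin l) (X : (P → Fin l) → ℂ) : (P → Fin l) → ℂ :=
  fun w => ∑ p, if w p = a then X (Function.update w p b) else 0

/-- This evaluates one summand of the product rule at the identity matrix: only words that agree
with w outside p survive. -/
theorem sum_prod_erase_eq (w : P → Fin l) (p : P) (F : (P → Fin l) → ℂ) :
    ∑ u : P → Fin l, (∏ q ∈ Finset.univ.erase p, (if w q = u q then (1 : ℂ) else 0)) * F u =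
      ∑ c, F (Function.update w p c) := by
  symm
  refine Fintype.sum_of_injective (fun c => Function.update w p c)
    (Function.update_injective w p) _ _ ?_ ?_
  · intro u hu
    have : ∃ q ∈ Finset.univ.erase p, w q ≠ u q := by
      by_contra! h
      refine hu ⟨u p, ?_⟩
      funext q
      by_cases hq : q = p
      · subst hq; simp
      · simp [Function.update_of_ne hq, h q (by simp [hq])]
    obtain ⟨q, hq, hne⟩ := this
    rw [Finset.prod_eq_zero hq (by simp [hne]), zero_mul]
  · intro c
    rw [Finset.prod_eq_one, one_mul]
    intro q hq
    simp [Function.update_of_ne (Finset.ne_of_mem_erase hq)]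

/-- Invariance under the rotations of the plane of a and b makes a function of the angle constant.
Its derivative at 0 is the action of J = E_ba - E_ab. -/
theorem IsOrthInvariant.derive_eq {X : (P → Fin l) → ℂ} (hX : IsOrthInvariant X) (a b : Fin l) :
    derive a b X = derive b a X := by
  rcases eq_or_ne a b with rfl | hab
  · rfl
  funext w
  set J : Matrix (Fin l) (Fin l) ℝ := Matrix.single b a 1 - Matrix.single a b 1 with hJ
  have hent : ∀ i j : Fin l, HasDerivAt (fun t : ℝ => ((planeRotation a b t i j : ℝ) : ℂ))
      ((J i j : ℝ) : ℂ) 0 := by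
    intro i j
    refine HasDerivAt.ofReal_comp ?_
    have h1 := ((Real.hasDerivAt_cos 0).sub_const 1).mul_const
      ((Matrix.single a a 1 + Matrix.single b b 1 : Matrix (Fin l) (Fin l) ℝ) i j)
    have h2 := (Real.hasDerivAt_sin 0).mul_const (J i j)
    have h3 := (h1.add h2).const_add ((1 : Matrix (Fin l) (Fin l) ℝ) i j)
    simp only [Real.sin_zero, neg_zero, zero_mul, Real.cos_zero, one_mul, zero_add] at h3
    refine h3.congr_of_eventuallyEq (Filter.Eventually.of_forall fun t => ?_)
    simp only [planeRotation, ← hJ, Matrix.add_apply, Matrix.smul_apply, smul_eq_mul, Pi.add_apply]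
    ring
  have h0 : ∀ i j : Fin l, ((planeRotation a b 0 i j : ℝ) : ℂ) = if i = j then 1 else 0 := by
    intro i j
    simp [planeRotation, Matrix.one_apply, apply_ite Complex.ofReal]
  have hprod : ∀ u : P → Fin l, HasDerivAt
      (fun t : ℝ => ∏ p, ((planeRotation a b t (w p) (u p) : ℝ) : ℂ))
      (∑ p, (∏ q ∈ Finset.univ.erase p, (if w q = u q then (1 : ℂ) else 0)) •
        ((J (w p) (u p) : ℝ) : ℂ)) 0 := by
    intro u
    have := HasDerivAt.fun_finsetProd (u := Finset.univ) (x := (0 : ℝ))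
      (fun p _ => hent (w p) (u p))
    simpa only [h0] using this
  have hsum := HasDerivAt.fun_sum (u := Finset.univ) fun u _ => (hprod u).mul_const (X u)
  have hconst : (fun t : ℝ => ∑ u : P → Fin l,
      (∏ p, ((planeRotation a b t (w p) (u p) : ℝ) : ℂ)) * X u) = fun _ => X w := by
    funext t
    exact hX _ (planeRotation_mem hab t) w
  rw [hconst] at hsum
  have hz := hsum.unique (hasDerivAt_const (0 : ℝ) (X w))
  simp only [Finset.sum_mul] at hz
  rw [Finset.sum_comm] at hz
  have hterm : ∀ p : P, ∑ u : P → Fin l,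
      ((∏ q ∈ Finset.univ.erase p, (if w q = u q then (1 : ℂ) else 0)) •
        ((J (w p) (u p) : ℝ) : ℂ)) * X u =
      (if w p = b then X (Function.update w p a) else 0) -
        (if w p = a then X (Function.update w p b) else 0) := by
    intro p
    simp only [smul_eq_mul, mul_assoc]
    rw [sum_prod_erase_eq w p (fun u => ((J (w p) (u p) : ℝ) : ℂ) * X u)]
    simp only [Function.update_self, hJ, Matrix.sub_apply, Matrix.single_apply, Complex.ofReal_sub,
      sub_mul, Finset.sum_sub_distrib]
    congr 1
    · by_cases h : w p = b
      · simp [h, apply_ite Complex.ofReal]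
      · simp [h, Ne.symm h]
    · by_cases h : w p = a
      · simp [h, apply_ite Complex.ofReal]
      · simp [h, Ne.symm h]
  simp only [hterm, Finset.sum_sub_distrib] at hz
  exact (sub_eq_zero.mp hz).symm

end FFT

/-! ### Traceless invariants and the first fundamental theorem -/

section FFT
variable {l : ℕ} {P : Type*} [Fintype P] [DecidableEq P]

open ComplexConjugate in
-- The derivations of E_ab and E_ba are adjoint: replacing b by a at p inverts replacing a by b
-- there.
theorem sum_conj_derive_mul (a b : Fin l) (X G : (P → Fin l) → ℂ) :
    ∑ w, conj (derive a b X w) * G w =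
      ∑ u, conj (X u) * ∑ p, if u p = b then G (Function.update u p a) else 0 := by
  simp only [derive, map_sum, Finset.sum_mul, Finset.mul_sum]
  rw [Finset.sum_comm, Finset.sum_comm (s := Finset.univ (α := P → Fin l))]
  refine Finset.sum_congr rfl fun p _ => ?_
  have h1 : ∀ w : P → Fin l, conj (if w p = a then X (Function.update w p b) else 0) * G w =
      if w p = a then conj (X (Function.update w p b)) * G w else 0 := by
    intro w; split_ifs <;> simp
  have h2 : ∀ u : P → Fin l, conj (X u) * (if u p = b then G (Function.update u p a) else 0) =
      if u p = b then conj (X u) * G (Function.update u p a) else 0 := by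
    intro u; split_ifs <;> simp
  rw [Finset.sum_congr rfl fun w _ => h1 w, Finset.sum_congr rfl fun w _ => h2 w,
    ← Finset.sum_filter, ← Finset.sum_filter]
  refine Finset.sum_bij' (fun w _ => Function.update w p b) (fun u _ => Function.update u p a)
    ?_ ?_ ?_ ?_ ?_
  · simp
  · simp
  · intro w hw
    simp only [Finset.mem_filter] at hw
    simp [← hw.2]
  · intro w hw
    simp only [Finset.mem_filter] at hw
    simp [← hw.2]
  · intro w hw
    simp only [Finset.mem_filter] at hw
    simp [← hw.2]

theorem sum_update_update_eq_contract {i j : P} (hij : i ≠ j) (X : (P → Fin l) → ℂ)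
    (u : P → Fin l) :
    ∑ a, X (Function.update (Function.update u i a) j a) = contract i j X (fun q => u q) := by
  refine Finset.sum_congr rfl fun a _ => congrArg X ?_
  funext p
  by_cases hj : p = j
  · subst hj; simp
  · by_cases hi : p = i
    · subst hi; simp [hij]
    · simp [extendWord, hi, hj]

/-- By adjointness the left side pairs X with the sum of E_ba E_ab X. Rewriting E_ab X as E_ba X
turns the cross terms into contractions, which vanish, and leaves one copy of X for each position.
-/
theorem sum_normSq_derive {X : (P → Fin l) → ℂ} (hX : IsOrthInvariant X)
    (hc : ∀ i j : P, i ≠ j → contract i j X = 0) :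
    ∑ a, ∑ b, ∑ w, Complex.normSq (derive a b X w) =
      Fintype.card P * ∑ w, Complex.normSq (X w) := by
  have key : ∀ u : P → Fin l, ∑ a, ∑ b, ∑ p,
      (if u p = b then derive a b X (Function.update u p a) else 0) = Fintype.card P * X u := by
    intro u
    have h1 : ∀ a, ∑ b, ∑ p, (if u p = b then derive a b X (Function.update u p a) else 0) =
        ∑ p, derive (u p) a X (Function.update u p a) := by
      intro a
      rw [Finset.sum_comm]
      refine Finset.sum_congr rfl fun p _ => ?_
      simp [hX.derive_eq a (u p)]
    simp only [h1]
    rw [Finset.sum_comm]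
    -- The position p itself contributes X u, from a = u p; a position q ≠ p contributes either
    -- nothing or the contraction at p and q.
    have h2 : ∀ p, ∑ a, derive (u p) a X (Function.update u p a) = X u := by
      intro p
      simp only [derive]
      rw [Finset.sum_comm, ← Finset.add_sum_erase _ _ (Finset.mem_univ p)]
      rw [Finset.sum_eq_zero (s := Finset.univ.erase p)]
      · simp
      · intro q hq
        have hqp : q ≠ p := Finset.ne_of_mem_erase hq
        simp only [Function.update_of_ne hqp]
        split_ifs with h
        · rw [sum_update_update_eq_contract hqp.symm, hc _ _ hqp.symm, Pi.zero_apply]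
        · simp
    simp [h2]
  have h := calc
    ∑ a, ∑ b, ∑ w, (starRingEnd ℂ) (derive a b X w) * derive a b X w
      = ∑ a, ∑ b, ∑ u, (starRingEnd ℂ) (X u) *
          ∑ p, if u p = b then derive a b X (Function.update u p a) else 0 := by
        refine Finset.sum_congr rfl fun a _ => Finset.sum_congr rfl fun b _ => ?_
        rw [sum_conj_derive_mul]
    _ = ∑ u, (starRingEnd ℂ) (X u) * (Fintype.card P * X u) := by
        simp only [← key, Finset.mul_sum]
        rw [Finset.sum_congr rfl fun a _ => Finset.sum_comm, Finset.sum_comm]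
  have e : ∀ z : ℂ, (starRingEnd ℂ) z * z = (Complex.normSq z : ℂ) := fun z => by
    rw [mul_comm, Complex.mul_conj]
  have e' : ∀ z : ℂ, (starRingEnd ℂ) z * (Fintype.card P * z) =
      Fintype.card P * (Complex.normSq z : ℂ) := fun z => by
    rw [← e]; ring
  simp only [e, e', ← Finset.mul_sum] at h
  exact_mod_cast h

theorem derive_self (a : Fin l) (X : (P → Fin l) → ℂ) (w : P → Fin l) :
    derive a a X w = (Finset.univ.filter fun p => w p = a).card * X w := by
  have : ∀ p, (if w p = a then X (Function.update w p a) else 0) =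
      if w p = a then X w else 0 := by
    intro p
    split_ifs with h
    · rw [← h, Function.update_eq_self]
    · rfl
  simp only [derive, this]
  rw [← Finset.sum_filter, Finset.sum_const, nsmul_eq_mul]

theorem sum_card_letter (w : P → Fin l) :
    ∑ a, (Finset.univ.filter fun p => w p = a).card = Fintype.card P := by
  rw [← Finset.card_univ, Finset.card_eq_sum_card_fiberwise (f := w) (t := Finset.univ) (by simp)]

/-- A traceless invariant is killed by the off-diagonal matrix units and supported on words
without repeated letters. -/
theorem traceless_derive {X : (P → Fin l) → ℂ} (hX : IsOrthInvariant X)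
    (hc : ∀ i j : P, i ≠ j → contract i j X = 0) :
    (∀ a b, a ≠ b → derive a b X = 0) ∧ ∀ w, X w ≠ 0 → Function.Injective w := by
  have h := sum_normSq_derive hX hc
  set N : (P → Fin l) → Fin l → ℕ := fun w a => (Finset.univ.filter fun p => w p = a).card with hN
  have hdiag : ∀ a, ∑ w, Complex.normSq (derive a a X w) =
      ∑ w, (N w a : ℝ) ^ 2 * Complex.normSq (X w) := by
    intro a
    refine Finset.sum_congr rfl fun w _ => ?_
    rw [derive_self, Complex.normSq_mul, Complex.normSq_natCast, sq]
  have hsplit : ∑ a, ∑ b, ∑ w, Complex.normSq (derive a b X w) =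
      ∑ a, ∑ w, (N w a : ℝ) ^ 2 * Complex.normSq (X w) +
      ∑ a, ∑ b ∈ Finset.univ.erase a, ∑ w, Complex.normSq (derive a b X w) := by
    rw [← Finset.sum_add_distrib]
    refine Finset.sum_congr rfl fun a _ => ?_
    rw [← hdiag, Finset.add_sum_erase _ (fun b => ∑ w, Complex.normSq (derive a b X w))
      (Finset.mem_univ a)]
  have hcard : ∀ w, (Fintype.card P : ℝ) = ∑ a, (N w a : ℝ) := fun w => by
    exact_mod_cast (sum_card_letter w).symm
  have hrhs : (Fintype.card P : ℝ) * ∑ w, Complex.normSq (X w) =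
      ∑ a, ∑ w, (N w a : ℝ) * Complex.normSq (X w) := by
    rw [Finset.sum_comm, Finset.mul_sum]
    refine Finset.sum_congr rfl fun w _ => ?_
    rw [hcard w, Finset.sum_mul]
  -- Both sums are nonnegative because n ≤ n² for natural n. So each vanishes, and letter counts on
  -- the support of X are 0 or 1.
  have hzero : ∑ a, ∑ w, ((N w a : ℝ) ^ 2 - N w a) * Complex.normSq (X w) +
      ∑ a, ∑ b ∈ Finset.univ.erase a, ∑ w, Complex.normSq (derive a b X w) = 0 := by
    simp only [sub_mul, Finset.sum_sub_distrib]
    linarith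
  have hsq : ∀ n : ℕ, (0 : ℝ) ≤ (n : ℝ) ^ 2 - n := by
    intro n
    have : (n : ℝ) ≤ (n : ℝ) ^ 2 := by exact_mod_cast Nat.le_self_pow two_ne_zero n
    linarith
  have hn1 : ∀ a, 0 ≤ ∑ w, ((N w a : ℝ) ^ 2 - N w a) * Complex.normSq (X w) := fun a =>
    Finset.sum_nonneg fun w _ => mul_nonneg (hsq _) (Complex.normSq_nonneg _)
  have hn2 : ∀ a b, 0 ≤ ∑ w, Complex.normSq (derive a b X w) := fun a b =>
    Finset.sum_nonneg fun w _ => Complex.normSq_nonneg _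
  have hn3 : ∀ a, 0 ≤ ∑ b ∈ Finset.univ.erase a, ∑ w, Complex.normSq (derive a b X w) :=
    fun a => Finset.sum_nonneg fun b _ => hn2 a b
  obtain ⟨hz1, hz2⟩ := (add_eq_zero_iff_of_nonneg (Finset.sum_nonneg fun a _ => hn1 a)
    (Finset.sum_nonneg fun a _ => hn3 a)).mp hzero
  rw [Finset.sum_eq_zero_iff_of_nonneg fun a _ => hn1 a] at hz1
  rw [Finset.sum_eq_zero_iff_of_nonneg fun a _ => hn3 a] at hz2
  refine ⟨fun a b hab => ?_, fun w hw p q hpq => ?_⟩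
  · have h1 := hz2 a (Finset.mem_univ a)
    rw [Finset.sum_eq_zero_iff_of_nonneg fun b _ => hn2 a b] at h1
    have h2 := h1 b (Finset.mem_erase.mpr ⟨hab.symm, Finset.mem_univ b⟩)
    rw [Finset.sum_eq_zero_iff_of_nonneg fun w _ => Complex.normSq_nonneg _] at h2
    funext w
    exact Complex.normSq_eq_zero.mp (h2 w (Finset.mem_univ w))
  · have h1 := hz1 (w p) (Finset.mem_univ _)
    rw [Finset.sum_eq_zero_iff_of_nonneg fun w _ =>
      mul_nonneg (hsq _) (Complex.normSq_nonneg _)] at h1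
    have h2 := (mul_eq_zero.mp (h1 w (Finset.mem_univ w))).resolve_right
      (fun h => hw (Complex.normSq_eq_zero.mp h))
    have h3 : (N w (w p)) ^ 2 = N w (w p) := by
      have : ((N w (w p) : ℝ)) ^ 2 = N w (w p) := by linarith
      exact_mod_cast this
    have h4 : N w (w p) ≤ 1 := by nlinarith
    exact Finset.card_le_one.mp h4 p (by simp) q (by simp [hpq])

theorem IsOrthInvariant.comp_swap {X : (P → Fin l) → ℂ} (hX : IsOrthInvariant X) (a b : Fin l)
    (w : P → Fin l) : X (fun p => Equiv.swap a b (w p)) = X w := by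
  set s := Equiv.swap a b with hs
  have hU : (Matrix.of fun i j => if s i = j then (1 : ℝ) else 0 : Matrix (Fin l) (Fin l) ℝ) ∈
      Matrix.orthogonalGroup (Fin l) ℝ := by
    rw [Matrix.mem_orthogonalGroup_iff]
    ext i j
    change ∑ c, (if s i = c then (1 : ℝ) else 0) * (if s j = c then (1 : ℝ) else 0) = _
    simp [Matrix.one_apply, eq_comm]
  have h := hX _ hU w
  rw [← h, Finset.sum_eq_single (fun p => s (w p))]
  · simp
  · intro u _ hu
    obtain ⟨p, hp⟩ := Function.ne_iff.mp hu
    rw [Finset.prod_eq_zero (Finset.mem_univ p), zero_mul]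
    simp [Ne.symm hp]
  · simp

theorem IsOrthInvariant.neg_one {X : (P → Fin l) → ℂ} (hX : IsOrthInvariant X) (w : P → Fin l) :
    (-1) ^ Fintype.card P * X w = X w := by
  have hU : (-1 : Matrix (Fin l) (Fin l) ℝ) ∈ Matrix.orthogonalGroup (Fin l) ℝ := by
    rw [Matrix.mem_orthogonalGroup_iff]
    simp
  have h := hX _ hU w
  conv_rhs => rw [← h]
  rw [Finset.sum_eq_single w]
  · simp
  · intro u _ hu
    obtain ⟨p, hp⟩ := Function.ne_iff.mp hu
    rw [Finset.prod_eq_zero (Finset.mem_univ p), zero_mul]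
    simp [Ne.symm hp]
  · simp

/-- If X w ≠ 0 and some letter a differs from w p, put a at p and evaluate there the vanishing
derivation that turns a back into w p. The result is X w, or 2 X w if a already occurs in w, since
exchanging two letters preserves X. If no such a exists, P is a single position and the matrix -1
gives X = -X. -/
theorem eq_zero_of_traceless [Nonempty P] {X : (P → Fin l) → ℂ} (hX : IsOrthInvariant X)
    (hc : ∀ i j : P, i ≠ j → contract i j X = 0) : X = 0 := by
  obtain ⟨hoff, hinj⟩ := traceless_derive hX hc
  funext w
  by_contra hw
  change ¬ X w = 0 at hw
  have hwi := hinj w hw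
  obtain ⟨p⟩ := ‹Nonempty P›
  by_cases hl : ∃ a, a ≠ w p
  · obtain ⟨a, ha⟩ := hl
    have h := congrFun (hoff a (w p) ha) (Function.update w p a)
    rw [derive, ← Finset.add_sum_erase _ _ (Finset.mem_univ p)] at h
    simp only [Function.update_self, if_true, Function.update_idem, Function.update_eq_self,
      Pi.zero_apply] at h
    by_cases hr : ∃ q, w q = a
    · obtain ⟨q, rfl⟩ := hr
      have hqp : q ≠ p := fun h => ha (by rw [h])
      rw [Finset.sum_eq_single q] at h
      · rw [Function.update_of_ne hqp, if_pos rfl] at h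
        have hsw : Function.update (Function.update w p (w q)) q (w p) =
            fun r => Equiv.swap (w p) (w q) (w r) := by
          funext r
          by_cases h1 : r = q
          · subst h1; simp
          · by_cases h2 : r = p
            · subst h2; simp [h1]
            · simp [h1, h2, Equiv.swap_apply_of_ne_of_ne (hwi.ne h2) (hwi.ne h1)]
        rw [hsw, hX.comp_swap] at h
        exact hw (by linear_combination h / 2)
      · intro r hr hrq
        rw [Function.update_of_ne (Finset.ne_of_mem_erase hr), if_neg (hwi.ne hrq)]
      · intro hq
        exact absurd (Finset.mem_erase.mpr ⟨hqp, Finset.mem_univ q⟩) hq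
    · rw [Finset.sum_eq_zero, add_zero] at h
      · exact hw h
      · intro q hq
        rw [Function.update_of_ne (Finset.ne_of_mem_erase hq), if_neg fun h => hr ⟨q, h⟩]
  · push Not at hl
    have hsub : Subsingleton P := ⟨fun q r => hwi ((hl _).trans (hl _).symm)⟩
    have h := hX.neg_one w
    rw [Fintype.card_eq_one_iff_nonempty_unique.mpr ⟨⟨⟨p⟩, fun q => Subsingleton.elim _ _⟩⟩] at h
    exact hw (by linear_combination -h / 2)

/-- Contractions are invariant and orthogonal to the pairings of fewer positions, so by induction X
is traceless. Without positions, orthogonality to the empty pairing already says X = 0. -/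
theorem eq_zero_of_forall_sum_pairFun (n : ℕ) : ∀ {P : Type _} [Fintype P] [DecidableEq P],
    Fintype.card P = n → ∀ {X : (P → Fin l) → ℂ}, IsOrthInvariant X →
    (∀ τ : Equiv.Perm P, IsPairing τ → ∑ w, pairFun l τ w * X w = 0) → X = 0 := by
  induction n using Nat.strong_induction_on with
  | _ n ih =>
    intro P _ _ hn X hX hτ
    rcases isEmpty_or_nonempty P with hP | hP
    · funext w
      have h := hτ 1 ⟨fun p => isEmptyElim p, fun p => isEmptyElim p⟩
      simpa [pairFun, Subsingleton.elim _ w] using h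
    · refine eq_zero_of_traceless hX fun i j hij => ?_
      refine ih _ ?_ rfl (hX.contract hij) fun τ h => ?_
      · rw [← hn]
        exact Fintype.card_subtype_lt (x := i) (by simp)
      · rw [sum_pairFun_contract]
        exact hτ _ (h.extend hij)

/-- H contains one end of each pair. A word constant on pairs is a word on H, so the sum factors
over H into inner products of rows of U. -/
theorem isOrthInvariant_pairFun {τ : Equiv.Perm P} (hτ : IsPairing τ) (H : Finset P)
    (hH : ∀ p, τ p ∈ H ↔ p ∉ H) : IsOrthInvariant (pairFun l τ) := by
  intro U hU w
  have hsplit : ∀ f : P → ℂ, ∏ p, f p = ∏ h : {p // p ∈ H}, f h * f (τ h) := by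
    intro f
    rw [← Finset.prod_mul_prod_compl H f, Finset.prod_mul_distrib, Finset.prod_coe_sort H f,
      Finset.prod_coe_sort H (fun h => f (τ h))]
    congr 1
    refine Finset.prod_bij' (fun p _ => τ p) (fun p _ => τ p) ?_ ?_ ?_ ?_ ?_
    · intro p hp; exact (hH p).mpr (Finset.mem_compl.mp hp)
    · intro p hp; exact Finset.mem_compl.mpr fun h => (hH p).mp h hp
    · intro p _; exact hτ.1 p
    · intro p _; exact hτ.1 p
    · intro p _; rw [hτ.1]
  have hre : ∑ u : P → Fin l, (∏ p, (U (w p) (u p) : ℂ)) * pairFun l τ u =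
      ∑ v : {p // p ∈ H} → Fin l,
        ∏ h : {p // p ∈ H}, ((U (w h) (v h) : ℂ) * (U (w (τ h)) (v h) : ℂ)) := by
    simp only [pairFun, mul_ite, mul_one, mul_zero]
    rw [← Finset.sum_filter]
    refine Finset.sum_bij' (fun u _ h => u h)
      (fun v _ p => if h : p ∈ H then v ⟨p, h⟩ else v ⟨τ p, (hH p).mpr h⟩) ?_ ?_ ?_ ?_ ?_
    · simp
    · intro v _
      simp only [Finset.mem_filter, Finset.mem_univ, true_and]
      intro p
      by_cases hp : p ∈ H
      · have : τ p ∉ H := fun h => (hH p).mp h hp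
        simp [hp, this, hτ.1]
      · have : τ p ∈ H := (hH p).mpr hp
        simp [hp, this]
    · intro u hu
      simp only [Finset.mem_filter, Finset.mem_univ, true_and] at hu
      funext p
      by_cases hp : p ∈ H <;> simp [hp, hu]
    · intro v _
      funext h
      simp
    · intro u hu
      simp only [Finset.mem_filter, Finset.mem_univ, true_and] at hu
      rw [hsplit]
      simp [hu]
  rw [hre]
  have := (Finset.prod_univ_sum (fun _ : {p // p ∈ H} => (Finset.univ : Finset (Fin l)))
    (fun h c => (U (w h) c : ℂ) * (U (w (τ h)) c : ℂ)))
  rw [Fintype.piFinset_univ] at this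
  rw [← this]
  simp only [orthogonal_sum_rows hU, pairFun]
  split_ifs with h
  · exact Finset.prod_eq_one fun h' _ => if_pos (h h').symm
  · push Not at h
    obtain ⟨p, hp⟩ := h
    by_cases hpH : p ∈ H
    · exact Finset.prod_eq_zero (Finset.mem_univ ⟨p, hpH⟩) (if_neg hp.symm)
    · refine Finset.prod_eq_zero (Finset.mem_univ ⟨τ p, (hH p).mpr hpH⟩) (if_neg ?_)
      rwa [hτ.1]

/-- The space of functions on words that are invariant under the orthogonal group. -/
def orthInvariantFun (l : ℕ) (P : Type*) [Fintype P] [DecidableEq P] :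
    Submodule ℂ ((P → Fin l) → ℂ) where
  carrier := {X | IsOrthInvariant X}
  add_mem' := by
    intro X Y hX hY U hU w
    simp only [Pi.add_apply, mul_add, Finset.sum_add_distrib]
    rw [hX U hU, hY U hU]
  zero_mem' := by
    intro U _ w
    simp
  smul_mem' := by
    intro c X hX U hU w
    simp only [Pi.smul_apply, smul_eq_mul, mul_left_comm _ c, ← Finset.mul_sum]
    rw [hX U hU]

/-- The first fundamental theorem for the orthogonal group. -/
theorem orthInvariantFun_eq_span (l m : ℕ) :
    orthInvariantFun l (Fin m) =
      Submodule.span ℂ (pairFun l '' {τ : Equiv.Perm (Fin m) | IsPairing τ}) := by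
  have hle : Submodule.span ℂ (pairFun l '' {τ : Equiv.Perm (Fin m) | IsPairing τ}) ≤
      orthInvariantFun l (Fin m) := by
    rw [Submodule.span_le]
    rintro _ ⟨τ, hτ, rfl⟩
    refine isOrthInvariant_pairFun hτ (Finset.univ.filter fun p => p < τ p) fun p => ?_
    have := hτ.2 p
    simp only [Finset.mem_filter, Finset.mem_univ, true_and, hτ.1, not_lt]
    exact ⟨le_of_lt, fun h => lt_of_le_of_ne h this⟩
  refine le_antisymm (fun X hX => ?_) hle
  set S := Submodule.span ℂ (pairFun l '' {τ : Equiv.Perm (Fin m) | IsPairing τ}) with hS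
  set e := WithLp.linearEquiv 2 ℂ ((Fin m → Fin l) → ℂ) with he
  -- The component of X orthogonal to the span of the pairings is again invariant, hence zero.
  obtain ⟨y, hy, z, hz, hyz⟩ :=
    Submodule.exists_add_mem_mem_orthogonal (K := S.comap e.toLinearMap) (e.symm X)
  have hX' : X = e y + e z := by
    rw [← map_add, ← hyz]; simp
  have hzinv : IsOrthInvariant (e z) := by
    have : e z = X - e y := by rw [hX']; abel
    rw [this]
    exact (orthInvariantFun l (Fin m)).sub_mem hX (hle hy)
  have hz0 : e z = 0 := by
    refine eq_zero_of_forall_sum_pairFun _ rfl hzinv fun τ hτ => ?_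
    have h1 := (Submodule.mem_orthogonal _ _).mp hz (e.symm (pairFun l τ)) (by
      change e (e.symm _) ∈ S
      rw [LinearEquiv.apply_symm_apply]
      exact Submodule.subset_span ⟨τ, hτ, rfl⟩)
    rw [PiLp.inner_apply] at h1
    rw [← h1]
    refine Finset.sum_congr rfl fun w _ => ?_
    change _ = _ * (starRingEnd ℂ) (pairFun l τ w)
    have : (starRingEnd ℂ) (pairFun l τ w) = pairFun l τ w := by
      unfold pairFun; split_ifs <;> simp
    rw [this, mul_comm]
    rfl
  rw [hX', hz0, add_zero]
  exact hy

end FFT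

/-! ### Label-preserving permutations and the block operator -/

section Labels

variable {l : ℕ} {P L : Type*} [Fintype P] [DecidableEq P] [DecidableEq L]
  (lab : P → L) (anti : L → Prop) [DecidablePred anti]

/-- The permutation preserves the labels. -/
def Preserves (g : Equiv.Perm P) : Prop := ∀ p, lab (g p) = lab p

instance : DecidablePred (Preserves lab) := fun g =>
  inferInstanceAs (Decidable (∀ p, lab (g p) = lab p))

/-- The sign of a label-preserving permutation on the antisymmetric positions, and `0` for other
permutations. -/
def labSign (g : Equiv.Perm P) : ℤ :=
  if h : Preserves lab g then
    (Equiv.Perm.sign (g.subtypePerm (p := fun p => anti (lab p)) (fun p => by rw [h p])) : ℤ)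
  else 0

/-- The product of the symmetrizers and antisymmetrizers of the classes of positions with equal
labels, on functions of words. -/
def labOp (l : ℕ) : ((P → Fin l) → ℂ) →ₗ[ℂ] ((P → Fin l) → ℂ) where
  toFun X w := ∑ g : Equiv.Perm P, (labSign lab anti g : ℂ) * X (fun p => w (g p))
  map_add' X Y := by
    funext w; simp [mul_add, Finset.sum_add_distrib]
  map_smul' c X := by
    funext w; simp [mul_left_comm _ c, ← Finset.mul_sum]

variable {lab}

theorem Preserves.mul {g h : Equiv.Perm P} (hg : Preserves lab g) (hh : Preserves lab h) :
    Preserves lab (g * h) := fun p => by rw [Equiv.Perm.mul_apply, hg, hh]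

theorem Preserves.inv {g : Equiv.Perm P} (hg : Preserves lab g) : Preserves lab g⁻¹ := fun p => by
  rw [← hg (g⁻¹ p)]; simp

theorem Preserves.swap {p q : P} (h : lab p = lab q) : Preserves lab (Equiv.swap p q) := fun r => by
  rw [Equiv.swap_apply_def]; split_ifs with h1 h2
  · rw [h1, h]
  · rw [h2, h]
  · rfl

theorem labSign_mul {g h : Equiv.Perm P} (hg : Preserves lab g) (hh : Preserves lab h) :
    labSign lab anti (g * h) = labSign lab anti g * labSign lab anti h := by
  rw [labSign, labSign, labSign, dif_pos hg, dif_pos hh, dif_pos (hg.mul hh)]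
  rw [← Units.val_mul, ← Equiv.Perm.sign_mul, Equiv.Perm.subtypePerm_mul]

theorem labSign_eq_zero {g : Equiv.Perm P} (hg : ¬ Preserves lab g) : labSign lab anti g = 0 :=
  dif_neg hg

theorem labSign_eq_sign {g : Equiv.Perm P} (hg : Preserves lab g)
    (h : ∀ p, g p ≠ p → anti (lab p)) : labSign lab anti g = Equiv.Perm.sign g := by
  rw [labSign, dif_pos hg, Equiv.Perm.sign_subtypePerm _ _ h]

theorem labSign_eq_one {g : Equiv.Perm P} (hg : Preserves lab g)
    (h : ∀ p, anti (lab p) → g p = p) : labSign lab anti g = 1 := by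
  rw [labSign, dif_pos hg]
  have : g.subtypePerm (p := fun p => anti (lab p)) (fun p => by rw [hg p]) = 1 := by
    ext p
    simpa using h p p.2
  rw [this]; simp

theorem labSign_one : labSign lab anti 1 = 1 := labSign_eq_one anti (fun _ => rfl) fun _ _ => rfl

theorem labSign_sq {g : Equiv.Perm P} (hg : Preserves lab g) :
    labSign lab anti g * labSign lab anti g = 1 := by
  rw [labSign, dif_pos hg, ← Units.val_mul, Int.units_mul_self]; rfl

theorem labSign_inv (g : Equiv.Perm P) : labSign lab anti g⁻¹ = labSign lab anti g := by
  by_cases hg : Preserves lab g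
  · have h1 : labSign lab anti g⁻¹ * labSign lab anti g = 1 := by
      rw [← labSign_mul anti hg.inv hg, inv_mul_cancel, labSign_one]
    have h2 := labSign_sq anti hg
    calc labSign lab anti g⁻¹ = labSign lab anti g⁻¹ * (labSign lab anti g * labSign lab anti g) := by
          rw [h2, mul_one]
      _ = labSign lab anti g := by rw [← mul_assoc, h1, one_mul]
  · rw [labSign_eq_zero anti hg, labSign_eq_zero anti fun h => hg (by simpa using h.inv)]

/-- Substitute h g for h in the sum; signs are multiplicative and equal to their inverses. -/
theorem labOp_comp {g : Equiv.Perm P} (hg : Preserves lab g) (X : (P → Fin l) → ℂ) :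
    labOp lab anti l (fun w => X (fun p => w (g p))) =
      (labSign lab anti g : ℂ) • labOp lab anti l X := by
  funext w
  simp only [labOp, LinearMap.coe_mk, AddHom.coe_mk, Pi.smul_apply, smul_eq_mul, Finset.mul_sum]
  refine Fintype.sum_equiv (Equiv.mulRight g) _ _ fun h => ?_
  simp only [Equiv.coe_mulRight, Equiv.Perm.mul_apply, ← mul_assoc]
  congr 1
  by_cases hh : Preserves lab h
  · rw [labSign_mul anti hh hg]
    have := labSign_sq anti hg
    have h' : labSign lab anti h = labSign lab anti g * (labSign lab anti h * labSign lab anti g) := by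
      rw [mul_left_comm, this, mul_one]
    exact_mod_cast h'
  · rw [labSign_eq_zero anti hh, labSign_eq_zero anti (g := h * g) fun h' => hh (by
      have := h'.mul hg.inv; rwa [mul_inv_cancel_right] at this)]
    simp

theorem pairFun_conj (g τ : Equiv.Perm P) :
    pairFun l (g * τ * g⁻¹) = fun w => pairFun l τ (fun p => w (g p)) := by
  funext w
  unfold pairFun
  congr 1
  refine propext ⟨fun h p => ?_, fun h p => ?_⟩
  · simpa using h (g p)
  · simpa using h (g⁻¹ p)

theorem labOp_pairFun_conj {g : Equiv.Perm P} (hg : Preserves lab g) (τ : Equiv.Perm P) :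
    labOp lab anti l (pairFun l (g * τ * g⁻¹)) =
      (labSign lab anti g : ℂ) • labOp lab anti l (pairFun l τ) := by
  rw [pairFun_conj, labOp_comp anti hg]

/-- A label-preserving permutation of sign `-1` that commutes with `τ` annihilates `τ`. -/
theorem labOp_pairFun_eq_zero {g τ : Equiv.Perm P} (hg : Preserves lab g)
    (hs : labSign lab anti g = -1) (hc : g * τ = τ * g) :
    labOp lab anti l (pairFun l τ) = 0 := by
  have h := labOp_pairFun_conj (l := l) anti hg τ
  rw [hc, mul_inv_cancel_right, hs] at h
  push_cast at h
  rw [neg_one_smul] at h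
  exact self_eq_neg.mp h

end Labels

/-! ### The product of block symmetrizers as one signed sum -/

section BlockOp

variable {l m : ℕ} {L : Type*} [DecidableEq L] (lab : Fin m → L) (anti : L → Prop)
  [DecidablePred anti]

/-- The partial product of symmetrizers and antisymmetrizers over the labels in `J`. -/
def partialOp (l : ℕ) (J : Finset L) : Module.End ℂ (TensorPow l m) :=
  ∑ g : Equiv.Perm (Fin m) with Preserves lab g ∧ ∀ p, lab p ∉ J → g p = p,
    (labSign lab anti g : ℂ) • permAct l g

theorem partialOp_empty : partialOp lab anti l ∅ = 1 := by
  have : (Finset.univ.filter fun g : Equiv.Perm (Fin m) =>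
      Preserves lab g ∧ ∀ p, lab p ∉ (∅ : Finset L) → g p = p) = {1} := by
    ext g
    simp only [Finset.mem_filter, Finset.mem_univ, true_and, Finset.notMem_empty,
      not_false_eq_true, true_imp_iff, Finset.mem_singleton]
    refine ⟨fun h => Equiv.ext h.2, ?_⟩
    rintro rfl
    exact ⟨fun _ => rfl, fun _ => rfl⟩
  rw [partialOp, this, Finset.sum_singleton, labSign_one]
  refine tensor_ext fun v => ?_
  simp [permAct_tprod]

theorem preserves_of_fixes {u : L} {g : Equiv.Perm (Fin m)} (h : ∀ p, lab p ≠ u → g p = p) :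
    Preserves lab g := by
  intro p
  by_cases hp : lab p = u
  · by_contra hne
    have h1 : lab (g p) ≠ u := by rwa [← hp]
    exact hne (by rw [g.injective (h _ h1)])
  · rw [h p hp]

theorem partialOp_singleton (u : L) {S : Finset (Fin m)} (hS : ∀ p, p ∈ S ↔ lab p = u) :
    partialOp lab anti l {u} = if anti u then antisymmetrizer l S else symmetrizer l S := by
  have hf : (Finset.univ.filter fun g : Equiv.Perm (Fin m) =>
      Preserves lab g ∧ ∀ p, lab p ∉ ({u} : Finset L) → g p = p) =
      Finset.univ.filter fun g => ∀ x, x ∉ S → g x = x := by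
    ext g
    simp only [Finset.mem_filter, Finset.mem_univ, true_and, Finset.mem_singleton, hS]
    exact ⟨fun h => h.2, fun h => ⟨preserves_of_fixes lab h, h⟩⟩
  rw [partialOp, hf]
  split_ifs with hu
  · refine Finset.sum_congr rfl fun g hg => ?_
    simp only [Finset.mem_filter, Finset.mem_univ, true_and, hS] at hg
    rw [labSign_eq_sign anti (preserves_of_fixes lab hg)]
    intro p hp
    by_cases h : lab p = u
    · rwa [h]
    · exact absurd (hg p h) hp
  · refine Finset.sum_congr rfl fun g hg => ?_
    simp only [Finset.mem_filter, Finset.mem_univ, true_and, hS] at hg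
    rw [labSign_eq_one anti (preserves_of_fixes lab hg)]
    · simp
    · intro p hp
      exact hg p fun h => hu (h ▸ hp)

theorem partialOp_mul {u : L} {J : Finset L} (hu : u ∉ J) :
    partialOp lab anti l {u} * partialOp lab anti l J = partialOp lab anti l (insert u J) := by
  simp only [partialOp, Finset.sum_mul_sum, smul_mul_smul_comm, permAct_mul]
  rw [← Finset.sum_product']
  -- The order is reversed because `permAct` reverses products. Bijectivity is the unique
  -- factorization of a label-preserving permutation into its restriction to the block of u and the
  -- rest.
  refine Finset.sum_bij (fun x _ => x.2 * x.1) ?_ ?_ ?_ ?_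
  · rintro ⟨π, ρ⟩ h
    simp only [Finset.mem_product, Finset.mem_filter, Finset.mem_univ, true_and,
      Finset.mem_singleton, Finset.mem_insert, not_or] at h ⊢
    refine ⟨h.2.1.mul h.1.1, fun p hp => ?_⟩
    rw [Equiv.Perm.mul_apply, h.1.2 p hp.1, h.2.2 p hp.2]
  · rintro ⟨π, ρ⟩ h ⟨π', ρ'⟩ h' heq
    simp only [Finset.mem_product, Finset.mem_filter, Finset.mem_univ, true_and,
      Finset.mem_singleton] at h h'
    have hρ : ∀ p, lab p = u → ρ p = p := fun p hp => h.2.2 p (hp ▸ hu)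
    have hρ' : ∀ p, lab p = u → ρ' p = p := fun p hp => h'.2.2 p (hp ▸ hu)
    have hπ : π = π' := by
      refine Equiv.ext fun p => ?_
      by_cases hp : lab p = u
      · have := congrArg (fun g : Equiv.Perm (Fin m) => g p) heq
        simp only [Equiv.Perm.mul_apply] at this
        rwa [hρ _ ((h.1.1 p).trans hp), hρ' _ ((h'.1.1 p).trans hp)] at this
      · rw [h.1.2 p hp, h'.1.2 p hp]
    subst hπ
    simp only [mul_left_inj] at heq
    rw [heq]
  · intro g hg
    simp only [Finset.mem_filter, Finset.mem_univ, true_and, Finset.mem_insert, not_or] at hg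
    have hs : ∀ p, lab (g p) = u ↔ lab p = u := fun p => by rw [hg.1 p]
    set π : Equiv.Perm (Fin m) := Equiv.Perm.ofSubtype (g.subtypePerm (p := fun p => lab p = u) hs)
      with hπ
    have h1 : ∀ p, lab p = u → π p = g p := fun p hp =>
      Equiv.Perm.ofSubtype_subtypePerm_of_mem hs hp
    have h2 : ∀ p, lab p ≠ u → π p = p := fun p hp =>
      Equiv.Perm.ofSubtype_subtypePerm_of_not_mem hs hp
    have hπp := preserves_of_fixes lab h2
    have h3 : ∀ p, lab p = u → π⁻¹ p = g⁻¹ p := fun p hp => by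
      rw [Equiv.Perm.inv_eq_iff_eq, h1 _ ((hg.1.inv p).trans hp)]; simp
    have h4 : ∀ p, lab p ≠ u → π⁻¹ p = p := fun p hp => by
      rw [Equiv.Perm.inv_eq_iff_eq, h2 p hp]
    refine ⟨(π, g * π⁻¹), ?_, by simp⟩
    simp only [Finset.mem_product, Finset.mem_filter, Finset.mem_univ, true_and,
      Finset.mem_singleton]
    refine ⟨⟨hπp, h2⟩, hg.1.mul hπp.inv, fun p hp => ?_⟩
    by_cases hpu : lab p = u
    · rw [Equiv.Perm.mul_apply, h3 p hpu]; simp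
    · rw [Equiv.Perm.mul_apply, h4 p hpu, hg.2 p ⟨hpu, hp⟩]
  · rintro ⟨π, ρ⟩ h
    simp only [Finset.mem_product, Finset.mem_filter, Finset.mem_univ, true_and] at h
    rw [labSign_mul anti h.2.1 h.1.1]
    push_cast
    rw [mul_comm]

theorem list_prod_partialOp (us : List L) (hus : us.Nodup) :
    (us.map fun u => partialOp lab anti l {u}).prod = partialOp lab anti l us.toFinset := by
  induction us with
  | nil => simp [partialOp_empty]
  | cons u us ih =>
    rw [List.nodup_cons] at hus
    rw [List.map_cons, List.prod_cons, ih hus.2, partialOp_mul lab anti (by simpa using hus.1),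
      List.toFinset_cons]

theorem coords_partialOp_univ [Fintype L] (x : TensorPow l m) :
    coords l m (partialOp lab anti l Finset.univ x) = labOp lab anti l (coords l m x) := by
  funext w
  simp only [partialOp, Finset.mem_univ, not_true_eq_false, false_imp_iff, implies_true, and_true,
    LinearMap.sum_apply, LinearMap.smul_apply, map_sum, map_smul, Finset.sum_apply, Pi.smul_apply,
    coords_permAct, smul_eq_mul, labOp, LinearMap.coe_mk, AddHom.coe_mk]
  rw [Finset.sum_filter]
  -- `permAct` acts on coordinates through the inverse permutation, which has the same sign.
  refine Fintype.sum_equiv (Equiv.inv _) _ _ fun g => ?_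
  rw [Equiv.inv_apply, labSign_inv]
  split_ifs with h
  · rfl
  · rw [labSign_eq_zero anti h]; simp

end BlockOp

/-! ### Consecutive blocks as fibres of a label function -/

section Blocks

variable {k : ℕ} (ν : Fin k → ℕ) (a : ℕ)

theorem mem_block_coe (i : Fin k) (p : Fin ((∑ i, ν i) + a)) :
    p ∈ block ν a i ↔ ∑ j with j < i, ν j ≤ (p : ℕ) ∧ (p : ℕ) < ∑ j with j ≤ i, ν j := by
  simp only [block, Finset.mem_filter, Finset.mem_univ, true_and]

theorem mem_block_top (p : Fin ((∑ i, ν i) + a)) :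
    p ∈ block ν a ⊤ ↔ ∑ j, ν j ≤ (p : ℕ) := by
  simp only [block, Finset.mem_filter, Finset.mem_univ, true_and]

theorem sum_filter_le_eq (i : Fin k) :
    ∑ j with j ≤ i, ν j = ∑ j with j < i, ν j + ν i := by
  have : (Finset.univ.filter fun j => j ≤ i) = insert i (Finset.univ.filter fun j => j < i) := by
    ext j; simp [le_iff_eq_or_lt]
  rw [this, Finset.sum_insert (by simp), add_comm]

theorem exists_mem_block (p : Fin ((∑ i, ν i) + a)) : ∃ u, p ∈ block ν a u := by
  by_cases hp : ∑ j, ν j ≤ (p : ℕ)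
  · exact ⟨⊤, (mem_block_top ν a p).mpr hp⟩
  have hk : ∃ n, ∃ h : n < k, (p : ℕ) < ∑ j with j ≤ (⟨n, h⟩ : Fin k), ν j := by
    rcases k with _ | k
    · simp at hp
    · refine ⟨k, Nat.lt_succ_self k, ?_⟩
      have : (Finset.univ.filter fun j => j ≤ (⟨k, Nat.lt_succ_self k⟩ : Fin (k + 1))) =
          Finset.univ := Finset.filter_true_of_mem fun j _ => Fin.le_last j
      rw [this]
      omega
  classical
  -- The block of p is the first one whose partial sum exceeds p.
  obtain ⟨n, ⟨hn, hlt⟩, hmin⟩ : ∃ n, (∃ h : n < k, (p : ℕ) < ∑ j with j ≤ (⟨n, h⟩ : Fin k), ν j) ∧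
      ∀ n' < n, ¬ ∃ h : n' < k, (p : ℕ) < ∑ j with j ≤ (⟨n', h⟩ : Fin k), ν j :=
    ⟨Nat.find hk, Nat.find_spec hk, fun _ h => Nat.find_min hk h⟩
  refine ⟨((⟨n, hn⟩ : Fin k) : WithTop (Fin k)), (mem_block_coe ν a _ p).mpr ⟨?_, hlt⟩⟩
  rcases n with _ | n
  · rw [Finset.filter_false_of_mem]
    · simp
    · intro j _ h
      simp [Fin.lt_def] at h
  · have hmin := hmin n (by omega)
    push Not at hmin
    refine le_trans (le_of_eq ?_) (hmin (by omega))
    refine Finset.sum_congr (Finset.filter_congr fun j _ => ?_) fun _ _ => rfl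
    rw [Fin.lt_def, Fin.le_def]
    exact Nat.lt_succ_iff

/-- The label of the block that contains the position `p`. -/
def posLabel (p : Fin ((∑ i, ν i) + a)) : WithTop (Fin k) := (exists_mem_block ν a p).choose

theorem block_unique_aux {p : Fin ((∑ i, ν i) + a)} {i : Fin k} {v : WithTop (Fin k)}
    (hi : p ∈ block ν a i) (hv : p ∈ block ν a v) (h : (i : WithTop (Fin k)) < v) : False := by
  rw [mem_block_coe] at hi
  induction v using WithTop.recTopCoe with
  | top =>
    rw [mem_block_top] at hv
    have : ∑ j with j ≤ i, ν j ≤ ∑ j, ν j :=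
      Finset.sum_le_sum_of_subset (Finset.filter_subset _ _)
    omega
  | coe i' =>
    rw [mem_block_coe] at hv
    have h' : i < i' := WithTop.coe_lt_coe.mp h
    have : ∑ j with j ≤ i, ν j ≤ ∑ j with j < i', ν j :=
      Finset.sum_le_sum_of_subset fun j hj => by
        simp only [Finset.mem_filter, Finset.mem_univ, true_and] at hj ⊢
        exact lt_of_le_of_lt hj h'
    omega

theorem mem_block_iff (p : Fin ((∑ i, ν i) + a)) (u : WithTop (Fin k)) :
    p ∈ block ν a u ↔ posLabel ν a p = u := by
  have hs : p ∈ block ν a (posLabel ν a p) := (exists_mem_block ν a p).choose_spec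
  refine ⟨fun h => ?_, fun h => h ▸ hs⟩
  by_contra hne
  rcases lt_or_gt_of_ne hne with h1 | h1
  · generalize posLabel ν a p = v at hs h1
    induction v using WithTop.recTopCoe with
    | top => exact absurd h1 (by simp)
    | coe i => exact block_unique_aux ν a hs h h1
  · induction u using WithTop.recTopCoe with
    | top => exact absurd h1 (by simp)
    | coe i => exact block_unique_aux ν a h hs h1

theorem card_fin_filter_Ico {m lo hi : ℕ} (h : hi ≤ m) :
    (Finset.univ.filter fun p : Fin m => lo ≤ (p : ℕ) ∧ (p : ℕ) < hi).card = hi - lo := by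
  rw [← Nat.card_Ico, ← Finset.card_map Fin.valEmbedding]
  congr 1
  ext x
  simp only [Finset.mem_map, Finset.mem_filter, Finset.mem_univ, true_and, Fin.valEmbedding_apply,
    Finset.mem_Ico]
  exact ⟨by rintro ⟨p, hp, rfl⟩; exact hp, fun hx => ⟨⟨x, by omega⟩, hx, rfl⟩⟩

theorem card_block_coe (i : Fin k) : (block ν a i).card = ν i := by
  have h : block ν a i = Finset.univ.filter fun p : Fin ((∑ i, ν i) + a) =>
      ∑ j with j < i, ν j ≤ (p : ℕ) ∧ (p : ℕ) < ∑ j with j ≤ i, ν j := by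
    ext p; rw [mem_block_coe]; simp
  have : ∑ j with j ≤ i, ν j ≤ ∑ j, ν j :=
    Finset.sum_le_sum_of_subset (Finset.filter_subset _ _)
  rw [h, card_fin_filter_Ico (by omega), sum_filter_le_eq]
  omega

theorem card_block_top : (block ν a ⊤).card = a := by
  have h : block ν a ⊤ = Finset.univ.filter fun p : Fin ((∑ i, ν i) + a) =>
      ∑ j, ν j ≤ (p : ℕ) ∧ (p : ℕ) < (∑ i, ν i) + a := by
    ext p; rw [mem_block_top]; simp
  rw [h, card_fin_filter_Ico le_rfl]
  omega

/-- The symbols whose blocks are antisymmetrized: those in `W`, and `∞`. -/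
def IsAnti (W : Finset (Fin k)) (u : WithTop (Fin k)) : Prop := ∀ i : Fin k, u = i → i ∈ W

@[simp] theorem isAnti_coe (W : Finset (Fin k)) (i : Fin k) :
    IsAnti W (i : WithTop (Fin k)) ↔ i ∈ W := by
  simp only [IsAnti, WithTop.coe_eq_coe]
  exact ⟨fun h => h i rfl, by rintro h _ rfl; exact h⟩

@[simp] theorem isAnti_top (W : Finset (Fin k)) : IsAnti W (⊤ : WithTop (Fin k)) := by
  intro i h; simp at h

instance (W : Finset (Fin k)) : DecidablePred (IsAnti W) := Classical.decPred _

theorem coords_blockOp (l : ℕ) (W : Finset (Fin k)) (x : TensorPow l ((∑ i, ν i) + a)) :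
    coords l _ (blockOp l W ν a x) = labOp (posLabel ν a) (IsAnti W) l (coords l _ x) := by
  have huniv : ((List.finRange k).map (fun i : Fin k => (i : WithTop (Fin k))) ++ [⊤]).toFinset =
      Finset.univ := by
    ext u
    induction u using WithTop.recTopCoe <;> simp
  have hnd : ((List.finRange k).map (fun i : Fin k => (i : WithTop (Fin k))) ++ [⊤]).Nodup := by
    rw [List.nodup_append]
    refine ⟨(List.nodup_finRange k).map WithTop.coe_injective, by simp, ?_⟩
    simp
  have h := list_prod_partialOp (l := l) (posLabel ν a) (IsAnti W) _ hnd
  rw [huniv] at h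
  rw [← coords_partialOp_univ, ← h]
  congr 2
  rw [blockOp, List.map_append, List.prod_append, List.map_map, List.ofFn_eq_map]
  congr 1
  · congr 1
    refine List.map_congr_left fun i _ => ?_
    rw [Function.comp_apply, partialOp_singleton _ _ _ (fun p => mem_block_iff ν a p i)]
    simp
  · rw [List.map_singleton, List.prod_singleton,
      partialOp_singleton _ _ _ (fun p => mem_block_iff ν a p ⊤)]
    simp

end Blocks

/-! ### Pairings of labelled positions -/

theorem exists_equiv_of_card_fiber {α β γ : Type*} [Fintype α] [Fintype β] [DecidableEq γ]
    (f : α → γ) (g : β → γ)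
    (h : ∀ c, (Finset.univ.filter fun a => f a = c).card =
      (Finset.univ.filter fun b => g b = c).card) :
    ∃ e : α ≃ β, ∀ a, g (e a) = f a := by
  have h' : ∀ c, Nonempty ({a // f a = c} ≃ {b // g b = c}) := fun c =>
    ⟨Fintype.equivOfCardEq (by rw [Fintype.card_subtype, Fintype.card_subtype, h])⟩
  exact ⟨Equiv.ofFiberEquiv fun c => (h' c).some, fun a => Equiv.ofFiberEquiv_map _ a⟩

section Pairings

variable {P L : Type*} [Fintype P] [LinearOrder P] [LinearOrder L] (lab : P → L)

/-- The number of positions with label `u` whose partner under `τ` has label `v`. -/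
def typeCount (τ : Equiv.Perm P) (u v : L) : ℕ :=
  (Finset.univ.filter fun p => lab p = u ∧ lab (τ p) = v).card

/-- One position of each pair of `τ`, namely that with the smaller label. -/
def half (τ : Equiv.Perm P) : Finset P :=
  Finset.univ.filter fun p => lab p < lab (τ p) ∨ (lab p = lab (τ p) ∧ p < τ p)

variable {lab} {τ τ' : Equiv.Perm P}

theorem IsPairing.apply_mem_half (hτ : IsPairing τ) (p : P) :
    τ p ∈ half lab τ ↔ p ∉ half lab τ := by
  simp only [half, Finset.mem_filter, Finset.mem_univ, true_and, hτ.1, not_or, not_and, not_lt]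
  constructor
  · rintro (h | ⟨h, h'⟩)
    · exact ⟨h.le, fun h'' => absurd h'' h.ne'⟩
    · exact ⟨h.le, fun _ => h'.le⟩
  · rintro ⟨h, h'⟩
    rcases h.lt_or_eq with h1 | h1
    · exact Or.inl h1
    · exact Or.inr ⟨h1, lt_of_le_of_ne (h' h1.symm) (hτ.2 p)⟩

theorem typeCount_symm (hτ : IsPairing τ) (u v : L) :
    typeCount lab τ u v = typeCount lab τ v u := by
  refine Finset.card_bij' (fun p _ => τ p) (fun p _ => τ p) ?_ ?_ ?_ ?_
  · intro p hp; simpa [hτ.1, and_comm] using hp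
  · intro p hp; simpa [hτ.1, and_comm] using hp
  · intro p _; exact hτ.1 p
  · intro p _; exact hτ.1 p

theorem card_half_filter_of_lt {u v : L} (h : u < v) :
    ((half lab τ).filter fun p => lab p = u ∧ lab (τ p) = v).card = typeCount lab τ u v := by
  rw [half, Finset.filter_filter, typeCount]
  congr 1
  refine Finset.filter_congr fun p _ => ⟨fun h => h.2, fun h' => ⟨Or.inl ?_, h'⟩⟩
  rwa [h'.1, h'.2]

theorem card_half_filter_of_gt {u v : L} (h : v < u) :
    ((half lab τ).filter fun p => lab p = u ∧ lab (τ p) = v).card = 0 := by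
  rw [Finset.card_eq_zero, Finset.filter_eq_empty_iff]
  rintro p hp ⟨rfl, rfl⟩
  simp only [half, Finset.mem_filter, Finset.mem_univ, true_and] at hp
  rcases hp with h' | h'
  · exact absurd h' h.asymm
  · exact absurd h'.1 h.ne'

theorem two_mul_card_half_filter (hτ : IsPairing τ) (u : L) :
    2 * ((half lab τ).filter fun p => lab p = u ∧ lab (τ p) = u).card = typeCount lab τ u u := by
  rw [typeCount, ← Finset.card_filter_add_card_filter_not (s := Finset.univ.filter fun p =>
    lab p = u ∧ lab (τ p) = u) (fun p => p ∈ half lab τ), two_mul, Finset.filter_filter,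
    Finset.filter_filter]
  have h1 : (half lab τ).filter (fun p => lab p = u ∧ lab (τ p) = u) =
      Finset.univ.filter fun p => (lab p = u ∧ lab (τ p) = u) ∧ p ∈ half lab τ := by
    ext p; simp [and_comm]
  rw [h1]
  congr 1
  refine Finset.card_bij' (fun p _ => τ p) (fun p _ => τ p) ?_ ?_ ?_ ?_
  · intro p hp
    simp only [Finset.mem_filter, Finset.mem_univ, true_and, hτ.apply_mem_half, hτ.1] at hp ⊢
    exact ⟨hp.1.symm, not_not.mpr hp.2⟩
  · intro p hp
    simp only [Finset.mem_filter, Finset.mem_univ, true_and, hτ.apply_mem_half, hτ.1] at hp ⊢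
    exact ⟨hp.1.symm, hp.2⟩
  · intro p _; exact hτ.1 p
  · intro p _; exact hτ.1 p

theorem even_typeCount_self (hτ : IsPairing τ) (u : L) : Even (typeCount lab τ u u) :=
  ⟨_, by rw [← two_mul_card_half_filter hτ, two_mul]⟩

theorem sum_typeCount [Fintype L] (u : L) :
    ∑ v, typeCount lab τ u v = (Finset.univ.filter fun p => lab p = u).card := by
  rw [Finset.card_eq_sum_card_fiberwise (f := fun p => lab (τ p)) (t := Finset.univ) (by simp)]
  refine Finset.sum_congr rfl fun v _ => ?_
  rw [typeCount, Finset.filter_filter]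

/-- Pairings with the same type are conjugate under label-preserving permutations. -/
theorem exists_conj_of_typeCount_eq (hτ : IsPairing τ) (hτ' : IsPairing τ')
    (h : ∀ u v, typeCount lab τ u v = typeCount lab τ' u v) :
    ∃ g : Equiv.Perm P, Preserves lab g ∧ τ' = g * τ * g⁻¹ := by
  have hcard : ∀ c : L × L, ((half lab τ).filter fun p => lab p = c.1 ∧ lab (τ p) = c.2).card =
      ((half lab τ').filter fun p => lab p = c.1 ∧ lab (τ' p) = c.2).card := by
    rintro ⟨u, v⟩
    rcases lt_trichotomy u v with huv | rfl | huv
    · rw [card_half_filter_of_lt huv, card_half_filter_of_lt huv, h]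
    · have h1 := two_mul_card_half_filter (lab := lab) hτ u
      have h2 := two_mul_card_half_filter (lab := lab) hτ' u
      rw [h] at h1
      simp only
      omega
    · rw [card_half_filter_of_gt huv, card_half_filter_of_gt huv]
  have hsub : ∀ (σ : Equiv.Perm P) (c : L × L),
      (Finset.univ.filter fun x : {p // p ∈ half lab σ} => (lab x, lab (σ x)) = c).card =
        ((half lab σ).filter fun p => lab p = c.1 ∧ lab (σ p) = c.2).card := by
    intro σ c
    rw [← Finset.card_map (Function.Embedding.subtype _)]
    congr 1
    ext p
    simp [Prod.ext_iff]; tauto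
  obtain ⟨e, he⟩ := exists_equiv_of_card_fiber
    (fun x : {p // p ∈ half lab τ} => (lab x, lab (τ x)))
    (fun x : {p // p ∈ half lab τ'} => (lab x, lab (τ' x)))
    (fun c => by rw [hsub, hsub, hcard])
  simp only [Prod.mk.injEq] at he
  -- The matching of chosen ends is extended to their partners by requiring G τ = τ' G.
  set G : P → P := fun p => if hp : p ∈ half lab τ then e ⟨p, hp⟩ else
    τ' (e ⟨τ p, (hτ.apply_mem_half p).mpr hp⟩) with hG
  have G1 : ∀ p (hp : p ∈ half lab τ), G p = e ⟨p, hp⟩ := fun p hp => dif_pos hp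
  have G2 : ∀ p (hp : p ∉ half lab τ), G p = τ' (e ⟨τ p, (hτ.apply_mem_half p).mpr hp⟩) :=
    fun p hp => dif_neg hp
  have hmem : ∀ p, G p ∈ half lab τ' ↔ p ∈ half lab τ := by
    intro p
    by_cases hp : p ∈ half lab τ
    · simp [G1 p hp, hp]
    · simp [G2 p hp, hp, hτ'.apply_mem_half]
  have hinj : Function.Injective G := by
    intro p q hpq
    have hiff : p ∈ half lab τ ↔ q ∈ half lab τ := by rw [← hmem, ← hmem, hpq]
    by_cases hp : p ∈ half lab τ
    · have hq := hiff.mp hp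
      rw [G1 p hp, G1 q hq] at hpq
      simpa using e.injective (Subtype.ext hpq)
    · have hq := fun h => hp (hiff.mpr h)
      rw [G2 p hp, G2 q hq] at hpq
      simpa using e.injective (Subtype.ext (τ'.injective hpq))
  have hcomm : ∀ p, G (τ p) = τ' (G p) := by
    intro p
    by_cases hp : p ∈ half lab τ
    · have hp' : τ p ∉ half lab τ := fun h => (hτ.apply_mem_half p).mp h hp
      rw [G1 p hp, G2 _ hp']
      simp only [hτ.1]
    · rw [G1 _ ((hτ.apply_mem_half p).mpr hp), G2 p hp, hτ'.1]
  have hlab : ∀ p, lab (G p) = lab p := by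
    intro p
    by_cases hp : p ∈ half lab τ
    · rw [G1 p hp, (he ⟨p, hp⟩).1]
    · rw [G2 p hp, (he ⟨τ p, _⟩).2, hτ.1]
  refine ⟨Equiv.ofBijective G (Finite.injective_iff_bijective.mp hinj), hlab, ?_⟩
  rw [eq_mul_inv_iff_mul_eq]
  exact Equiv.ext fun p => (hcomm p).symm

/-- Every symmetric table of multiplicities with even diagonal is the type of a pairing. -/
theorem exists_pairing_of_table [Fintype L] (N : L → L → ℕ) (hsymm : ∀ u v, N u v = N v u)
    (heven : ∀ u, Even (N u u))
    (hsum : ∀ u, ∑ v, N u v = (Finset.univ.filter fun p => lab p = u).card) :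
    ∃ τ : Equiv.Perm P, IsPairing τ ∧ ∀ u v, typeCount lab τ u v = N u v := by
  -- n counts unordered pairs: each type is listed once, and the diagonal is halved because a pair
  -- inside a block is seen from both ends. The two copies of H below are the two ends of these
  -- pairs.
  set n : L × L → ℕ := fun c => if c.1 < c.2 then N c.1 c.2 else if c.1 = c.2 then N c.1 c.2 / 2
    else 0 with hn
  have hnN : ∀ u v, n (u, v) + n (v, u) = N u v := by
    intro u v
    rcases lt_trichotomy u v with h | rfl | h
    · simp [hn, h, h.asymm, h.ne']
    · obtain ⟨c, hc⟩ := heven u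
      simp only [hn, lt_irrefl, if_false, if_true]
      omega
    · simp [hn, h, h.asymm, h.ne', hsymm u v]
  let H := Σ c : L × L, Fin (n c)
  have hH : ∀ (Q : L × L → Prop) [DecidablePred Q],
      (∑ x : H, if Q x.1 then 1 else 0) = ∑ c, if Q c then n c else 0 := by
    intro Q _
    rw [Fintype.sum_sigma]
    refine Finset.sum_congr rfl fun c _ => ?_
    split_ifs <;> simp
  let dlab : H ⊕ H → L := Sum.elim (fun x => x.1.1) (fun x => x.1.2)
  have hcount : ∀ u v, (Finset.univ.filter fun d : H ⊕ H => dlab d = u ∧ dlab d.swap = v).card =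
      N u v := by
    intro u v
    rw [Finset.card_filter, Fintype.sum_sum_type]
    change (∑ x : H, if x.1.1 = u ∧ x.1.2 = v then 1 else 0) +
      (∑ x : H, if x.1.2 = u ∧ x.1.1 = v then 1 else 0) = _
    rw [hH (fun c => c.1 = u ∧ c.2 = v), hH (fun c => c.2 = u ∧ c.1 = v), ← hnN]
    congr 1
    · rw [Finset.sum_eq_single (u, v)]
      · simp
      · intro c _ hc
        exact if_neg fun h => hc (Prod.ext h.1 h.2)
      · simp
    · rw [Finset.sum_eq_single (v, u)]
      · simp
      · intro c _ hc
        exact if_neg fun h => hc (Prod.ext h.2 h.1)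
      · simp
  obtain ⟨e, he⟩ := exists_equiv_of_card_fiber dlab lab (fun u => by
    rw [← hsum, Finset.card_eq_sum_card_fiberwise (f := fun d : H ⊕ H => dlab d.swap)
      (t := Finset.univ) (by simp)]
    refine Finset.sum_congr rfl fun v _ => ?_
    rw [Finset.filter_filter, hcount])
  refine ⟨(e.symm.trans (Equiv.sumComm H H)).trans e, ⟨fun p => ?_, fun p h => ?_⟩, fun u v => ?_⟩
  · simp
  · have h' : (e.symm p).swap = e.symm p := by
      simpa using congrArg e.symm h
    rcases hd : e.symm p with x | x <;> simp [hd] at h'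
  · rw [← hcount, typeCount, ← Finset.card_map e.symm.toEmbedding]
    congr 1
    ext d
    simp only [Finset.mem_map, Finset.mem_filter, Finset.mem_univ, true_and]
    constructor
    · rintro ⟨p, ⟨h1, h2⟩, rfl⟩
      simp only [Equiv.trans_apply, he] at h2
      refine ⟨?_, h2⟩
      rw [← h1, ← he]; simp
    · rintro ⟨h1, h2⟩
      exact ⟨e d, by simpa [he] using ⟨h1, h2⟩, by simp⟩

end Pairings

/-! ### Pairings annihilated by an odd symmetry -/

section Good

variable {P L : Type*} [Fintype P] [DecidableEq P] [DecidableEq L] (lab : P → L) (anti : L → Prop)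
  [DecidablePred anti]

/-- `τ` is not annihilated for an obvious reason: it neither joins two positions of one
antisymmetrized block, nor joins an antisymmetrized block to a symmetrized one more than once. -/
def IsReduced (τ : Equiv.Perm P) : Prop :=
  (∀ p, lab p = lab (τ p) → ¬ anti (lab p)) ∧
  ∀ p q, lab p = lab q → lab (τ p) = lab (τ q) → anti (lab p) → ¬ anti (lab (τ p)) → p = q

variable {lab}

/-- The symmetry is the transposition of a pair inside an antisymmetrized block, or the simultaneous
exchange of both ends of two parallel pairs. In the second case only the antisymmetrized ends count
for the sign, which is again -1. -/
theorem labOp_pairFun_of_not_isReduced (l : ℕ) {τ : Equiv.Perm P} (hτ : IsPairing τ)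
    (h : ¬ IsReduced lab anti τ) : labOp lab anti l (pairFun l τ) = 0 := by
  rw [IsReduced, not_and_or] at h
  rcases h with h | h
  · push Not at h
    obtain ⟨p, hp, ha⟩ := h
    refine labOp_pairFun_eq_zero anti (g := Equiv.swap p (τ p)) (Preserves.swap hp) ?_ ?_
    · rw [labSign_eq_sign anti (Preserves.swap hp), Equiv.Perm.sign_swap (hτ.2 p).symm]
      · rfl
      · intro q hq
        rcases eq_or_ne q p with rfl | h1
        · exact ha
        rcases eq_or_ne q (τ p) with rfl | h2
        · rwa [← hp]
        exact absurd (Equiv.swap_apply_of_ne_of_ne h1 h2) hq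
    · rw [Equiv.mul_swap_eq_swap_mul, hτ.1, Equiv.swap_comm]
  · push Not at h
    obtain ⟨p, q, h1, h2, ha, hna, hne⟩ := h
    have hne' : τ p ≠ τ q := fun h => hne (τ.injective h)
    have hx : ∀ r s, lab r = lab p → lab s = lab (τ p) → r ≠ s := by
      rintro r _ hr hs rfl
      exact hna (by rwa [← hs, hr])
    refine labOp_pairFun_eq_zero anti (g := Equiv.swap p q * Equiv.swap (τ p) (τ q))
      ((Preserves.swap h1).mul (Preserves.swap h2)) ?_ ?_
    · rw [labSign_mul anti (Preserves.swap h1) (Preserves.swap h2),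
        labSign_eq_sign anti (Preserves.swap h1), labSign_eq_one anti (Preserves.swap h2),
        Equiv.Perm.sign_swap hne]
      · rfl
      · intro r hr
        refine Equiv.swap_apply_of_ne_of_ne ?_ ?_ <;> rintro rfl
        · exact hna hr
        · exact hna (by rwa [h2])
      · intro r hr
        rcases eq_or_ne r p with rfl | h3
        · exact ha
        rcases eq_or_ne r q with rfl | h4
        · rwa [← h1]
        exact absurd (Equiv.swap_apply_of_ne_of_ne h3 h4) hr
    · have hd : Equiv.swap p q * Equiv.swap (τ p) (τ q) =
          Equiv.swap (τ p) (τ q) * Equiv.swap p q := by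
        rw [Equiv.mul_swap_eq_swap_mul, Equiv.swap_apply_of_ne_of_ne (hx p _ rfl rfl).symm
          (hx q _ h1.symm rfl).symm, Equiv.swap_apply_of_ne_of_ne (hx p _ rfl h2.symm).symm
          (hx q _ h1.symm h2.symm).symm]
      rw [← mul_assoc, Equiv.mul_swap_eq_swap_mul τ p q, mul_assoc _ τ,
        Equiv.mul_swap_eq_swap_mul τ, hτ.1, hτ.1, ← mul_assoc, hd]

end Good

/-! ### Symmetric multisets and types of pairings -/

section Unfix

variable {k : ℕ} (W : Finset (Fin k)) (M : Multiset (Fin k × Fin k))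

theorem count_fixedPart (i : Fin k) : (fixedPart W M).count i = fixedAt W M i := by
  rw [fixedPart, Multiset.count_sum']
  simp [Multiset.count_replicate]

theorem fixedAt_le (i : Fin k) : fixedAt W M i ≤ M.count (i, i) := by
  rw [fixedAt]
  split_ifs
  · exact le_rfl
  · exact Nat.mod_le _ _

theorem count_map_coe_coe (N : Multiset (Fin k × Fin k)) (i j : Fin k) :
    (N.map (fun p => ((p.1 : WithTop (Fin k)), (p.2 : WithTop (Fin k))))).count
      ((i : WithTop (Fin k)), (j : WithTop (Fin k))) = N.count (i, j) :=
  Multiset.count_map_eq_count' (fun p : Fin k × Fin k =>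
    ((p.1 : WithTop (Fin k)), (p.2 : WithTop (Fin k)))) N (by
      rintro ⟨i, j⟩ ⟨i', j'⟩ h
      simpa using h) (i, j)

theorem count_unfix_coe_coe (i j : Fin k) :
    (unfix W M).count ((i : WithTop (Fin k)), (j : WithTop (Fin k))) =
      M.count (i, j) - if i = j then fixedAt W M i else 0 := by
  have h1 : ((fixedPart W M).map (fun i => (i, i))).count (i, j) =
      if i = j then fixedAt W M i else 0 := by
    split_ifs with h
    · subst h
      rw [← count_fixedPart]
      exact Multiset.count_map_eq_count' (fun i : Fin k => (i, i)) _ (fun a b h => by simpa using h) i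
    · rw [Multiset.count_eq_zero]
      simp only [Multiset.mem_map, Prod.mk.injEq, not_exists, not_and]
      rintro x _ rfl h'
      exact h h'
  have h2 : ((fixedPart W M).map (fun i => ((i : WithTop (Fin k)), (⊤ : WithTop (Fin k))))).count
      ((i : WithTop (Fin k)), (j : WithTop (Fin k))) = 0 := by
    rw [Multiset.count_eq_zero]; simp
  have h3 : ((fixedPart W M).map (fun i => ((⊤ : WithTop (Fin k)), (i : WithTop (Fin k))))).count
      ((i : WithTop (Fin k)), (j : WithTop (Fin k))) = 0 := by
    rw [Multiset.count_eq_zero]; simp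
  rw [unfix, Multiset.count_add, Multiset.count_add, h2, h3, count_map_coe_coe, Multiset.count_sub,
    h1]
  rfl

theorem count_unfix_coe_top (i : Fin k) :
    (unfix W M).count ((i : WithTop (Fin k)), (⊤ : WithTop (Fin k))) = fixedAt W M i := by
  rw [unfix, Multiset.count_add, Multiset.count_add,
    Multiset.count_eq_zero.mpr (by simp : ((i : WithTop (Fin k)), (⊤ : WithTop (Fin k))) ∉
      (M - (fixedPart W M).map (fun i => (i, i))).map
        (fun p => ((p.1 : WithTop (Fin k)), (p.2 : WithTop (Fin k))))),
    Multiset.count_eq_zero.mpr (by simp : ((i : WithTop (Fin k)), (⊤ : WithTop (Fin k))) ∉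
      (fixedPart W M).map (fun i => ((⊤ : WithTop (Fin k)), (i : WithTop (Fin k))))),
    zero_add, add_zero, ← count_fixedPart]
  simp only [Multiset.bind_def, Multiset.pure_def, Multiset.bind_singleton, Multiset.map_map]
  exact Multiset.count_map_eq_count' (fun i : Fin k => ((i : WithTop (Fin k)), (⊤ : WithTop (Fin k))))
    _ (fun a b h => by simpa using h) i

theorem count_unfix_top_coe (i : Fin k) :
    (unfix W M).count ((⊤ : WithTop (Fin k)), (i : WithTop (Fin k))) = fixedAt W M i := by
  rw [unfix, Multiset.count_add, Multiset.count_add,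
    Multiset.count_eq_zero.mpr (by simp : ((⊤ : WithTop (Fin k)), (i : WithTop (Fin k))) ∉
      (M - (fixedPart W M).map (fun i => (i, i))).map
        (fun p => ((p.1 : WithTop (Fin k)), (p.2 : WithTop (Fin k))))),
    Multiset.count_eq_zero.mpr (by simp : ((⊤ : WithTop (Fin k)), (i : WithTop (Fin k))) ∉
      (fixedPart W M).map (fun i => ((i : WithTop (Fin k)), (⊤ : WithTop (Fin k))))),
    zero_add, zero_add, ← count_fixedPart]
  simp only [Multiset.bind_def, Multiset.pure_def, Multiset.bind_singleton, Multiset.map_map]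
  exact Multiset.count_map_eq_count' (fun i : Fin k => ((⊤ : WithTop (Fin k)), (i : WithTop (Fin k))))
    _ (fun a b h => by simpa using h) i

theorem count_unfix_top_top :
    (unfix W M).count ((⊤ : WithTop (Fin k)), (⊤ : WithTop (Fin k))) = 0 := by
  rw [Multiset.count_eq_zero, unfix]
  simp

theorem count_map_fst (i : Fin k) : (M.map Prod.fst).count i = ∑ j, M.count (i, j) := by
  induction M using Multiset.induction_on with
  | empty => simp
  | cons p M ih =>
    simp only [Multiset.map_cons, Multiset.count_cons, ih, Finset.sum_add_distrib]
    congr 1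
    rcases p with ⟨i', j'⟩
    by_cases h : i = i'
    · subst h; simp
    · simp [h]

theorem count_swap {M : Multiset (Fin k × Fin k)} (h : M.map Prod.swap = M) (i j : Fin k) :
    M.count (i, j) = M.count (j, i) := by
  conv_lhs => rw [← h]
  exact Multiset.count_map_eq_count' Prod.swap M Prod.swap_injective (j, i)

end Unfix

/-! ### Correspondence of reduced pairings and symmetric multisets -/

section Types

variable {k : ℕ} {W : Finset (Fin k)} {P : Type*} [Fintype P] [LinearOrder P]
  {lab : P → WithTop (Fin k)} {τ : Equiv.Perm P}

/-- The type of the pairing `τ` is the symmetric multiset `M`. -/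
def HasType (W : Finset (Fin k)) (lab : P → WithTop (Fin k)) (τ : Equiv.Perm P)
    (M : Multiset (Fin k × Fin k)) : Prop :=
  ∀ u v, typeCount lab τ u v = (unfix W M).count (u, v)

theorem sum_withTop (f : WithTop (Fin k) → ℕ) : ∑ u, f u = f ⊤ + ∑ i : Fin k, f i :=
  Fintype.sum_option f

/-- The diagonal of the table for M^∞ is even: removing fixed points leaves 0 at i ∈ W and drops the
parity bit at i ∉ W. The row sums are the block sizes because (i, ∞) restores what (i, i) lost. -/
theorem exists_hasType {ν : Fin k → ℕ} {a : ℕ}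
    (hν : ∀ i : Fin k, (Finset.univ.filter fun p => lab p = i).card = ν i)
    (ha : (Finset.univ.filter fun p => lab p = ⊤).card = a)
    {M : Multiset (Fin k × Fin k)} (hM : M ∈ symMultisets W ν a) :
    ∃ τ : Equiv.Perm P, IsPairing τ ∧ HasType W lab τ M := by
  obtain ⟨h1, h2, h3, h4⟩ := hM
  refine exists_pairing_of_table (fun u v => (unfix W M).count (u, v)) ?_ ?_ ?_
  · intro u v
    induction u using WithTop.recTopCoe with
    | top =>
      induction v using WithTop.recTopCoe with
      | top => rfl
      | coe j => simp only [count_unfix_top_coe, count_unfix_coe_top]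
    | coe i =>
      induction v using WithTop.recTopCoe with
      | top => simp only [count_unfix_top_coe, count_unfix_coe_top]
      | coe j =>
        simp only [count_unfix_coe_coe]
        rw [count_swap h1]
        by_cases h : i = j
        · subst h; rfl
        · simp [h, Ne.symm h]
  · intro u
    induction u using WithTop.recTopCoe with
    | top => simp [count_unfix_top_top]
    | coe i =>
      simp only [count_unfix_coe_coe, if_true, fixedAt]
      split_ifs
      · simp
      · rw [Nat.even_iff]; omega
  · intro u
    induction u using WithTop.recTopCoe with
    | top => simp only [sum_withTop, count_unfix_top_top, count_unfix_top_coe, h4, ha, zero_add]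
    | coe i =>
      simp only [sum_withTop, count_unfix_coe_coe, count_unfix_coe_top, hν]
      rw [← h3, count_map_fst, ← Finset.add_sum_erase _ _ (Finset.mem_univ i),
        ← Finset.add_sum_erase _ (fun j => M.count (i, j)) (Finset.mem_univ i)]
      have := fixedAt_le W M i
      have h5 : ∑ j ∈ Finset.univ.erase i, (M.count (i, j) - if i = j then fixedAt W M i else 0) =
          ∑ j ∈ Finset.univ.erase i, M.count (i, j) :=
        Finset.sum_congr rfl fun j hj => by simp [(Finset.ne_of_mem_erase hj).symm]
      rw [h5]
      simp only [if_true]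
      omega

theorem typeCount_ne_zero (p : P) : typeCount lab τ (lab p) (lab (τ p)) ≠ 0 := by
  rw [typeCount, Finset.card_ne_zero]
  exact ⟨p, by simp⟩

theorem HasType.isReduced {M : Multiset (Fin k × Fin k)} (h : HasType W lab τ M)
    (hM : IsCompatible W W M) : IsReduced lab (IsAnti W) τ := by
  refine ⟨fun p hp ha => ?_, fun p q h1 h2 ha hna => ?_⟩
  · have h0 := typeCount_ne_zero (lab := lab) (τ := τ) p
    rw [← hp, h] at h0
    generalize lab p = u at *
    induction u using WithTop.recTopCoe with
    | top => exact h0 (count_unfix_top_top W M)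
    | coe i =>
      refine h0 ?_
      rw [isAnti_coe] at ha
      rw [count_unfix_coe_coe, if_pos rfl, fixedAt, if_pos ha, Nat.sub_self]
  · have h3 : typeCount lab τ (lab p) (lab (τ p)) ≤ 1 := by
      rw [h]
      generalize lab p = u at *
      generalize lab (τ p) = v at *
      induction v using WithTop.recTopCoe with
      | top => simp at hna
      | coe j =>
        rw [isAnti_coe] at hna
        induction u using WithTop.recTopCoe with
        | top =>
          rw [count_unfix_top_coe, fixedAt, if_neg hna]
          omega
        | coe i =>
          rw [isAnti_coe] at ha
          rw [count_unfix_coe_coe]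
          exact (Nat.sub_le _ _).trans (hM i j fun h => hna (h.mp ha))
    exact Finset.card_le_one.mp h3 p (by simp) q (by simp [h1, h2])

/-- Every reduced pairing has the type of a symmetric multiset. -/
theorem IsReduced.exists_hasType {ν : Fin k → ℕ} {a : ℕ}
    (hν : ∀ i : Fin k, (Finset.univ.filter fun p => lab p = i).card = ν i)
    (ha : (Finset.univ.filter fun p => lab p = ⊤).card = a) (hτ : IsPairing τ)
    (h : IsReduced lab (IsAnti W) τ) : ∃ M ∈ symMultisets W ν a, HasType W lab τ M := by
  set N := typeCount lab τ with hN
  -- Each pair joining i to ∞ is turned back into a diagonal point (i, i).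
  set c : Fin k × Fin k → ℕ := fun x => N x.1 x.2 + if x.1 = x.2 then N x.1 ⊤ else 0 with hc
  set M : Multiset (Fin k × Fin k) := ∑ x, Multiset.replicate (c x) x with hM
  have hcount : ∀ i j : Fin k, M.count (i, j) = N i j + if i = j then N i ⊤ else 0 := by
    intro i j
    rw [hM, Multiset.count_sum']
    simp only [Multiset.count_replicate]
    rw [Finset.sum_ite_eq' Finset.univ (i, j) c]
    simp [hc]
  have hsymm : ∀ u v, N u v = N v u := typeCount_symm hτ
  have hanti : ∀ u, IsAnti W u → N u u = 0 := by
    intro u hu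
    rw [hN, typeCount, Finset.card_eq_zero, Finset.filter_eq_empty_iff]
    rintro p _ ⟨h1, h2⟩
    exact h.1 p (h1.trans h2.symm) (h1 ▸ hu)
  have hmix : ∀ u v, IsAnti W u → ¬ IsAnti W v → N u v ≤ 1 := by
    intro u v hu hv
    refine Finset.card_le_one.mpr fun p hp q hq => ?_
    simp only [Finset.mem_filter, Finset.mem_univ, true_and] at hp hq
    exact h.2 p q (hp.1.trans hq.1.symm) (hp.2.trans hq.2.symm) (hp.1 ▸ hu) (hp.2 ▸ hv)
  -- For i ∉ W, the pairs inside the block contribute an even number and at most one pair goes to ∞,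
  -- so the parity recovers the latter.
  have hfix : ∀ i, fixedAt W M i = N i ⊤ := by
    intro i
    rw [fixedAt, hcount, if_pos rfl]
    split_ifs with hi
    · rw [hanti i (by simpa using hi), zero_add]
    · obtain ⟨e, he⟩ := even_typeCount_self (lab := lab) hτ (i : WithTop (Fin k))
      have h1 := hmix ⊤ i (by simp) (by simpa using hi)
      rw [hsymm] at h1
      rw [hN] at h1 ⊢
      omega
  refine ⟨M, ⟨?_, ?_, ?_, ?_⟩, ?_⟩
  · ext ⟨i, j⟩
    have : (M.map Prod.swap).count (i, j) = M.count (j, i) :=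
      Multiset.count_map_eq_count' Prod.swap M Prod.swap_injective (j, i)
    rw [this, hcount, hcount, hsymm]
    by_cases hij : i = j
    · subst hij; rfl
    · simp [hij, Ne.symm hij]
  · intro i j hij
    rw [hcount, if_neg (fun h => hij (by rw [h])), add_zero]
    by_cases hi : i ∈ W
    · exact hmix i j (by simpa using hi) (by simpa using fun hj => hij (iff_of_true hi hj))
    · rw [hsymm]
      refine hmix j i ?_ (by simpa using hi)
      by_contra hj
      exact hij (iff_of_false hi (by simpa using hj))
  · intro i
    rw [count_map_fst, ← hν, ← sum_typeCount (τ := τ), sum_withTop]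
    simp only [hcount, Finset.sum_add_distrib]
    rw [add_comm]
    simp [hN]
  · simp only [hfix]
    rw [← ha, ← sum_typeCount (τ := τ), sum_withTop, ← hN, hanti ⊤ (by simp), zero_add]
    exact Finset.sum_congr rfl fun i _ => hsymm _ _
  · intro u v
    induction u using WithTop.recTopCoe with
    | top =>
      induction v using WithTop.recTopCoe with
      | top => rw [count_unfix_top_top]; exact hanti ⊤ (by simp)
      | coe j => rw [count_unfix_top_coe, hfix]; exact hsymm _ _
    | coe i =>
      induction v using WithTop.recTopCoe with
      | top => rw [count_unfix_coe_top, hfix]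
      | coe j =>
        rw [count_unfix_coe_coe, hcount, hfix]
        split_ifs
        · rw [Nat.add_sub_cancel]
        · rfl

/-- The involution obtained from `τ` by fixing the partners of the positions of `∞`. -/
def fold (lab : P → WithTop (Fin k)) (τ : Equiv.Perm P) (p : P) : P :=
  if lab p = ⊤ ∨ lab (τ p) = ⊤ then p else τ p

theorem fold_fold (hτ : IsPairing τ) (p : P) : fold lab τ (fold lab τ p) = p := by
  by_cases h : lab p = ⊤ ∨ lab (τ p) = ⊤
  · have : fold lab τ p = p := if_pos h
    rw [this, this]
  · have : fold lab τ p = τ p := if_neg h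
    rw [this, fold, hτ.1, if_neg fun h' => h h'.symm]

theorem fold_of_top {p : P} (h : lab (τ p) = ⊤) : fold lab τ p = p := if_pos (Or.inr h)

theorem fold_of_ne_top {p : P} (hp : lab p ≠ ⊤) (h : lab (τ p) ≠ ⊤) : fold lab τ p = τ p :=
  if_neg (by simp [hp, h])

theorem lab_fold_ne_top {p : P} (hp : lab p ≠ ⊤) : lab (fold lab τ p) ≠ ⊤ := by
  rw [fold]
  split_ifs with h
  · exact hp
  · exact fun h' => h (Or.inr h')

theorem card_fold_filter (i j : Fin k) :
    (Finset.univ.filter fun p => lab p = i ∧ lab (fold lab τ p) = j).card =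
      typeCount lab τ i j + if i = j then typeCount lab τ i ⊤ else 0 := by
  rw [← Finset.card_filter_add_card_filter_not (fun p => lab (τ p) = ⊤), add_comm,
    Finset.filter_filter, Finset.filter_filter]
  congr 1
  · refine congrArg Finset.card (Finset.filter_congr fun p _ => ⟨?_, ?_⟩)
    · rintro ⟨⟨h1, h2⟩, h3⟩
      rw [fold_of_ne_top (by simp [h1]) h3] at h2
      exact ⟨h1, h2⟩
    · rintro ⟨h1, h2⟩
      have h3 : lab (τ p) ≠ ⊤ := by simp [h2]
      rw [fold_of_ne_top (by simp [h1]) h3]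
      exact ⟨⟨h1, h2⟩, h3⟩
  · split_ifs with h
    · subst h
      refine congrArg Finset.card (Finset.filter_congr fun p _ => ⟨?_, ?_⟩)
      · rintro ⟨⟨h1, h2⟩, h3⟩
        exact ⟨h1, h3⟩
      · rintro ⟨h1, h2⟩
        rw [fold_of_top h2]
        exact ⟨⟨h1, h1⟩, h2⟩
    · rw [Finset.card_eq_zero, Finset.filter_eq_empty_iff]
      rintro p _ ⟨⟨h1, h2⟩, h3⟩
      rw [fold_of_top h3, h1] at h2
      exact h (WithTop.coe_injective h2)

/-- Every position p outside the block of ∞ represents one point (lab p, lab (fold p)) of M. This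
dictionary carries sequences of points to sequences of positions and back. -/
theorem HasType.count_eq {M : Multiset (Fin k × Fin k)} (h : HasType W lab τ M) (i j : Fin k) :
    M.count (i, j) = (Finset.univ.filter fun p => lab p = i ∧ lab (fold lab τ p) = j).card := by
  rw [card_fold_filter, h, h, count_unfix_coe_coe, count_unfix_coe_top]
  split_ifs with hij
  · subst hij
    rw [Nat.sub_add_cancel (fixedAt_le W M i)]
  · rfl

end Types

/-! ### Weights of pairings -/

section Weights

variable {k : ℕ}

/-- A rapidly decreasing weight function on symbols. -/
def symWeight (i : Fin k) : ℤ := 3 ^ (k - (i : ℕ))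

theorem symWeight_pos (i : Fin k) : 0 < symWeight i := by unfold symWeight; positivity

theorem three_mul_symWeight_le {i j : Fin k} (h : i < j) : 3 * symWeight j ≤ symWeight i := by
  have h1 : (i : ℕ) < j := h
  have h2 := j.isLt
  unfold symWeight
  rw [← pow_succ']
  exact pow_le_pow_right₀ (by norm_num) (by omega)

theorem symWeight_anti {i j : Fin k} (h : i ≤ j) : symWeight j ≤ symWeight i := by
  rcases h.lt_or_eq with h | rfl
  · have := three_mul_symWeight_le h
    have := symWeight_pos j
    linarith
  · exact le_rfl

/-- The weight of a pair of symbols. -/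
def pairWeight (W : Finset (Fin k)) : WithTop (Fin k) → WithTop (Fin k) → ℤ
  | (i : Fin k), (j : Fin k) => if i = j ∧ i ∈ W then 0 else 2 * symWeight i * symWeight j
  | (i : Fin k), ⊤ => symWeight i ^ 2
  | ⊤, (j : Fin k) => symWeight j ^ 2
  | ⊤, ⊤ => 0

variable (W : Finset (Fin k))

theorem pairWeight_coe_coe (i j : Fin k) : pairWeight W i j =
    if i = j ∧ i ∈ W then 0 else 2 * symWeight i * symWeight j := rfl

theorem pairWeight_coe_top (i : Fin k) : pairWeight W i ⊤ = symWeight i ^ 2 := rfl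

theorem pairWeight_comm (u v : WithTop (Fin k)) : pairWeight W u v = pairWeight W v u := by
  induction u using WithTop.recTopCoe with
  | top =>
    induction v using WithTop.recTopCoe <;> rfl
  | coe i =>
    induction v using WithTop.recTopCoe with
    | top => rfl
    | coe j =>
      rw [pairWeight_coe_coe, pairWeight_coe_coe]
      by_cases h : i = j
      · subst h; rfl
      · simp only [h, Ne.symm h, false_and, if_false]; ring

theorem pairWeight_coe_nonneg (i j : Fin k) : 0 ≤ pairWeight W i j := by
  rw [pairWeight_coe_coe]
  split_ifs
  · exact le_rfl
  · have := symWeight_pos i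
    have := symWeight_pos j
    positivity

theorem pairWeight_nonneg (u v : WithTop (Fin k)) : 0 ≤ pairWeight W u v := by
  induction u using WithTop.recTopCoe with
  | top =>
    induction v using WithTop.recTopCoe with
    | top => exact le_rfl
    | coe j => exact sq_nonneg _
  | coe i =>
    induction v using WithTop.recTopCoe with
    | top => exact sq_nonneg _
    | coe j => exact pairWeight_coe_nonneg W i j

theorem pairWeight_coe_le (i j : Fin k) : pairWeight W i j ≤ 2 * symWeight i * symWeight j := by
  rw [pairWeight_coe_coe]
  split_ifs
  · have := symWeight_pos i
    have := symWeight_pos j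
    positivity
  · exact le_rfl

/-- Rows `x r` matched with columns `c r` in an increasing chain: `y r` is the column, where `⊤`
is replaced by the row. -/
structure IsChainData {ι : Type*} [LinearOrder ι] (x y : ι → Fin k) (c : ι → WithTop (Fin k)) :
    Prop where
  col : ∀ r, (c r = ⊤ ∧ y r = x r) ∨ (c r = y r ∧ y r ≤ x r ∧ (y r = x r → y r ∉ W))
  row_le : ∀ r s, r < s → x r ≤ x s
  row_mem : ∀ r s, r < s → x r = x s → x r ∈ W
  col_le : ∀ r s, r < s → y r ≤ y s
  col_mem : ∀ r s, r < s → y r = y s → y r ∈ W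

variable {W} {ι : Type*} [LinearOrder ι] {x y : ι → Fin k} {c : ι → WithTop (Fin k)}

/-- Exchanging the columns of a chain pair and a later one loses weight, as for products of
decreasing functions. The ratio 3 covers the comparison with ∞: if x a < y u, the new pairs weigh at
most (1/9 + 2/3) s², where s² is the weight of (x a, ∞). If y u = x a, that symbol lies in W and its
diagonal weight is 0. -/
theorem IsChainData.swap_le (h : IsChainData W x y c) {a t u : ι} (hat : a < t) (hau : a < u) :
    pairWeight W (x t) (c a) + pairWeight W (x a) (c u) ≤
      pairWeight W (x a) (c a) + pairWeight W (x t) (c u) ∧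
    (pairWeight W (x t) (c a) + pairWeight W (x a) (c u) =
      pairWeight W (x a) (c a) + pairWeight W (x t) (c u) → x t = x a ∨ c u = c a) := by
  by_cases hx : x t = x a
  · rw [hx]
    exact ⟨le_of_eq (by ring), fun _ => Or.inl rfl⟩
  by_cases hc : c u = c a
  · rw [hc]
    exact ⟨le_of_eq (by ring), fun _ => Or.inr rfl⟩
  suffices hlt : pairWeight W (x t) (c a) + pairWeight W (x a) (c u) <
      pairWeight W (x a) (c a) + pairWeight W (x t) (c u) from
    ⟨hlt.le, fun he => absurd he hlt.ne⟩
  have hxlt : x a < x t := lt_of_le_of_ne (h.row_le a t hat) (Ne.symm hx)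
  have hg := three_mul_symWeight_le hxlt
  have hpa := symWeight_pos (x a)
  have hpt := symWeight_pos (x t)
  rcases h.col a with ⟨ha, hya⟩ | ⟨ha, hle, hne⟩
  · rcases h.col u with ⟨hu, hyu⟩ | ⟨hu, -, -⟩
    · exact absurd (hu.trans ha.symm) hc
    · rw [ha, hu, pairWeight_coe_top, pairWeight_coe_top]
      have hnn := pairWeight_coe_nonneg W (x t) (y u)
      rcases (h.col_le a u hau).lt_or_eq with hlt | heq
      · rw [hya] at hlt
        have h1 := pairWeight_coe_le W (x a) (y u)
        have h2 := three_mul_symWeight_le hlt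
        have h3 := symWeight_pos (y u)
        nlinarith
      · have hW := h.col_mem a u hau heq
        rw [hya] at heq hW
        rw [pairWeight_coe_coe W (x a), if_pos ⟨heq, hW⟩]
        nlinarith
  · have hpy := symWeight_pos (y a)
    have hay := symWeight_anti hle
    have hwa : pairWeight W (x a) (y a) = 2 * symWeight (x a) * symWeight (y a) := by
      rw [pairWeight_coe_coe, if_neg]
      rintro ⟨h1, h2⟩
      exact hne h1.symm (h1 ▸ h2)
    have h1 := pairWeight_coe_le W (x t) (y a)
    rcases h.col u with ⟨hu, hyu⟩ | ⟨hu, -, -⟩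
    · rw [ha, hu, pairWeight_coe_top, pairWeight_coe_top, hwa]
      nlinarith
    · rw [ha, hu, hwa]
      have hylt : y a < y u := by
        refine lt_of_le_of_ne (h.col_le a u hau) fun he => hc ?_
        rw [ha, hu, he]
      have h2 := pairWeight_coe_le W (x a) (y u)
      have h3 := three_mul_symWeight_le hylt
      have hpu := symWeight_pos (y u)
      rw [pairWeight_coe_coe W (x t) (y u)]
      split_ifs
      · nlinarith [mul_pos hpa hpy, mul_pos hpt hpu]
      · nlinarith [mul_pos (show 0 < symWeight (x a) - symWeight (x t) by linarith)
          (show 0 < symWeight (y a) - symWeight (y u) by linarith)]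

/-- The chain maximizes the total weight among all rematchings of its rows and columns, and the
other maximizers arise by permuting equal rows and equal columns. -/
theorem IsChainData.sum_le (h : IsChainData W x y c) (A : Finset ι) :
    ∀ σ : Equiv.Perm ι, (∀ r, r ∉ A → σ r = r) →
      ∑ r ∈ A, pairWeight W (x (σ r)) (c r) ≤ ∑ r ∈ A, pairWeight W (x r) (c r) ∧
      (∑ r ∈ A, pairWeight W (x (σ r)) (c r) = ∑ r ∈ A, pairWeight W (x r) (c r) →
        ∃ ρ : Equiv.Perm ι, (∀ r, x (σ r) = x (ρ r)) ∧ ∀ r, c (ρ r) = c r) := by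
  -- The least index a is split off, since the exchange inequality needs a below both σ a and σ⁻¹ a.
  induction A using Finset.induction_on_min with
  | empty =>
    intro σ hσ
    exact ⟨le_rfl, fun _ => ⟨1, fun r => by rw [hσ r (by simp)]; rfl, fun r => rfl⟩⟩
  | insert a A hA ih =>
    intro σ hσ
    have haA : a ∉ A := fun ha => lt_irrefl _ (hA a ha)
    rw [Finset.sum_insert haA, Finset.sum_insert haA]
    by_cases hfix : σ a = a
    · obtain ⟨h1, h2⟩ := ih σ fun r hr => by
        rcases eq_or_ne r a with rfl | hra
        · exact hfix
        · exact hσ r (by simp [hra, hr])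
      rw [hfix]
      exact ⟨by linarith, fun he => h2 (by linarith)⟩
    · set t := σ a with ht
      set u := σ⁻¹ a with hu
      have hσu : σ u = a := by simp [hu]
      have hmem : ∀ r, r ≠ a → σ r ≠ r → r ∈ A := by
        intro r hra hr
        by_contra hrA
        exact hr (hσ r (by simp [hra, hrA]))
      have hua : u ≠ a := fun e => hfix (by rw [ht, ← e, hσu, e])
      have huA : u ∈ A := hmem u hua (by rw [hσu]; exact hua.symm)
      have htA : t ∈ A := hmem t hfix fun e => hfix (σ.injective e)
      -- σ' fixes a and sends u to t; by the exchange inequality it weighs at least as much as σ.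
      set σ' : Equiv.Perm ι := Equiv.swap a t * σ with hσ'
      have hσ'a : σ' a = a := by simp [hσ', ← ht]
      have hσ'u : σ' u = t := by simp [hσ', hσu]
      have hσ'r : ∀ r, r ≠ a → r ≠ u → σ' r = σ r := by
        intro r hra hru
        rw [hσ', Equiv.Perm.mul_apply, Equiv.swap_apply_of_ne_of_ne]
        · exact fun e => hru (σ.injective (e.trans hσu.symm))
        · exact fun e => hra (σ.injective (e.trans ht))
      obtain ⟨h1, h2⟩ := ih σ' fun r hr => by
        rcases eq_or_ne r a with rfl | hra
        · exact hσ'a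
        · have hru : r ≠ u := fun e => hr (e ▸ huA)
          rw [hσ'r r hra hru]
          exact hσ r (by simp [hra, hr])
      have hs : ∑ r ∈ A, pairWeight W (x (σ' r)) (c r) + pairWeight W (x a) (c u) =
          ∑ r ∈ A, pairWeight W (x (σ r)) (c r) + pairWeight W (x t) (c u) := by
        rw [← Finset.add_sum_erase A _ huA,
          ← Finset.add_sum_erase A (fun r => pairWeight W (x (σ r)) (c r)) huA, hσ'u, hσu]
        have : ∑ r ∈ A.erase u, pairWeight W (x (σ' r)) (c r) =
            ∑ r ∈ A.erase u, pairWeight W (x (σ r)) (c r) := by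
          refine Finset.sum_congr rfl fun r hr => ?_
          rw [hσ'r r (fun e => haA (e ▸ Finset.mem_of_mem_erase hr)) (Finset.ne_of_mem_erase hr)]
        rw [this]
        ring
      obtain ⟨h3, h4⟩ := h.swap_le (hA t htA) (hA u huA)
      refine ⟨by linarith, fun he => ?_⟩
      obtain ⟨ρ, hρ1, hρ2⟩ := h2 (by linarith)
      -- In the equality case either the rows of a and t agree, so σ and σ' give the same rows and ρ
      -- still works, or the columns of a and u agree and their transposition is absorbed into ρ.
      rcases h4 (by linarith) with hx | hc
      · refine ⟨ρ, fun r => ?_, hρ2⟩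
        rw [← hρ1 r]
        rcases eq_or_ne r a with rfl | hra
        · rw [hσ'a, ← ht, hx]
        rcases eq_or_ne r u with e | hru
        · rw [e, hσ'u, hσu, hx]
        · rw [hσ'r r hra hru]
      · have hcs : ∀ r, c (Equiv.swap a u r) = c r := by
          intro r
          rw [Equiv.swap_apply_def]
          split_ifs with e1 e2
          · rw [e1, hc]
          · rw [e2, hc]
          · rfl
        refine ⟨ρ * Equiv.swap a u, fun r => ?_, fun r => ?_⟩
        · rw [Equiv.Perm.mul_apply, ← hρ1]
          rcases eq_or_ne r a with rfl | hra
          · rw [Equiv.swap_apply_left, hσ'u]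
          rcases eq_or_ne r u with e | hru
          · rw [e, Equiv.swap_apply_right, hσ'a, hσu]
          · rw [Equiv.swap_apply_of_ne_of_ne hra hru, hσ'r r hra hru]
        · rw [Equiv.Perm.mul_apply, hρ2, hcs]

end Weights

/-! ### Straightening -/

theorem exists_nodup_lift {α P : Type*} [DecidableEq α] [DecidableEq P] (f : P → α)
    (L : List α) : ∀ S : Finset P,
      (∀ x, (L : Multiset α).count x ≤ (S.filter fun p => f p = x).card) →
      ∃ L' : List P, L'.Nodup ∧ (∀ p ∈ L', p ∈ S) ∧ L'.map f = L := by
  simp only [Multiset.coe_count]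
  induction L with
  | nil => exact fun S _ => ⟨[], List.nodup_nil, by simp, rfl⟩
  | cons x L ih =>
    intro S h
    have hx : 0 < (S.filter fun p => f p = x).card := by
      have := h x
      rw [List.count_cons_self] at this
      omega
    obtain ⟨p, hp⟩ := Finset.card_pos.mp hx
    rw [Finset.mem_filter] at hp
    obtain ⟨L', h1, h2, h3⟩ := ih (S.erase p) fun z => by
      have hz := h z
      rw [Finset.filter_erase]
      by_cases hzx : z = x
      · subst hzx
        rw [List.count_cons_self] at hz
        rw [Finset.card_erase_of_mem (by simp [hp])]
        omega
      · rw [List.count_cons_of_ne (Ne.symm hzx)] at hz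
        rwa [Finset.erase_eq_of_notMem]
        simp only [Finset.mem_filter, not_and]
        rintro - rfl
        exact hzx hp.2
    refine ⟨p :: L', List.nodup_cons.mpr ⟨fun hmem => by simpa using h2 p hmem, h1⟩, ?_, ?_⟩
    · intro q hq
      rcases List.mem_cons.mp hq with rfl | hq
      · exact hp.1
      · exact Finset.mem_of_mem_erase (h2 q hq)
    · rw [List.map_cons, h3, hp.2]

/-! ### Vanishing of antisymmetrizers beyond the dimension -/

section Antisymmetrize

variable {P ι : Type*} [Fintype P] [DecidableEq P] [Fintype ι] [DecidableEq ι]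

theorem viaFintypeEmbedding_mul (σ ρ : Equiv.Perm ι) (f : ι ↪ P) :
    (σ * ρ).viaFintypeEmbedding f = σ.viaFintypeEmbedding f * ρ.viaFintypeEmbedding f := by
  rw [Equiv.Perm.viaFintypeEmbedding, Equiv.Perm.viaFintypeEmbedding,
    Equiv.Perm.viaFintypeEmbedding, Equiv.Perm.extendDomain_mul]

/-- Antisymmetrizing a tensor over more positions than the dimension gives zero. -/
theorem sum_sign_comp_eq_zero {l : ℕ} (hl : l < Fintype.card ι) (f : ι ↪ P)
    (X : (P → Fin l) → ℂ) (w : P → Fin l) :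
    ∑ σ : Equiv.Perm ι, ((Equiv.Perm.sign σ : ℤ) : ℂ) *
      X (fun p => w (σ.viaFintypeEmbedding f p)) = 0 := by
  -- Two of the positions carry the same letter. Multiplying σ by their transposition keeps the word
  -- and flips the sign, so terms cancel in pairs.
  obtain ⟨r, s, hrs, hw⟩ := Fintype.exists_ne_map_eq_of_card_lt (fun r => w (f r)) (by simpa)
  refine Finset.sum_involution (fun σ _ => Equiv.swap r s * σ) ?_ ?_ ?_ ?_
  · intro σ _
    have : (fun p => w ((Equiv.swap r s * σ).viaFintypeEmbedding f p)) =
        fun p => w (σ.viaFintypeEmbedding f p) := by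
      funext p
      rw [viaFintypeEmbedding_mul, Equiv.Perm.mul_apply]
      generalize σ.viaFintypeEmbedding f p = q
      by_cases hq : q ∈ Set.range f
      · obtain ⟨t, rfl⟩ := hq
        rw [Equiv.Perm.viaFintypeEmbedding_apply_image, Equiv.swap_apply_def]
        split_ifs with h1 h2
        · rw [h1]; exact hw.symm
        · rw [h2]; exact hw
        · rfl
      · rw [Equiv.Perm.viaFintypeEmbedding_apply_notMem_range _ _ hq]
    rw [this, Equiv.Perm.sign_mul, Equiv.Perm.sign_swap hrs]
    push_cast
    ring
  · intro σ _ _ h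
    have := congrArg (fun g => g (σ⁻¹ r)) h
    simp at this
    exact hrs this.symm
  · intro σ _; exact Finset.mem_univ _
  · intro σ _
    rw [← mul_assoc, Equiv.swap_mul_self, one_mul]

end Antisymmetrize

/-! ### The straightening relation of a long chain -/

section Straighten

variable {k : ℕ} {W : Finset (Fin k)} {P : Type*} [Fintype P] [LinearOrder P]
  {lab : P → WithTop (Fin k)} {τ : Equiv.Perm P}

/-- The total weight of a pairing. -/
def pairingWeight (W : Finset (Fin k)) (lab : P → WithTop (Fin k)) (τ : Equiv.Perm P) : ℤ :=
  ∑ q, pairWeight W (lab q) (lab (τ q))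

theorem pairingWeight_nonneg : 0 ≤ pairingWeight W lab τ :=
  Finset.sum_nonneg fun _ _ => pairWeight_nonneg W _ _

theorem IsPairing.conj (hτ : IsPairing τ) (g : Equiv.Perm P) : IsPairing (g * τ * g⁻¹) := by
  refine ⟨fun p => by simp [hτ.1], fun p h => hτ.2 (g⁻¹ p) (g.injective ?_)⟩
  simpa using h

/-- An increasing chain of pairs of `τ`, indexed by `ι`. -/
structure IsPairingChain (W : Finset (Fin k)) (lab : P → WithTop (Fin k)) (τ : Equiv.Perm P)
    {ι : Type*} [LinearOrder ι] (f : ι ↪ P) (x y : ι → Fin k) : Prop where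
  ne : ∀ r s, f r ≠ τ (f s)
  lab_eq : ∀ r, lab (f r) = x r
  chain : IsChainData W x y (fun r => lab (τ (f r)))

variable {ι : Type*} [Fintype ι] [LinearOrder ι] {f : ι ↪ P} {x y : ι → Fin k}

/-- Only pairs of the chain are affected, and each is counted from both of its ends, whence the
factor 2. -/
theorem pairingWeight_conj (hτ : IsPairing τ) (h : IsPairingChain W lab τ f x y)
    (σ : Equiv.Perm ι) :
    pairingWeight W lab (σ.viaFintypeEmbedding f * τ * (σ.viaFintypeEmbedding f)⁻¹) -
      pairingWeight W lab τ =
      2 * (∑ r, pairWeight W (x (σ r)) (lab (τ (f r))) - ∑ r, pairWeight W (x r) (lab (τ (f r)))) := by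
  set s := σ.viaFintypeEmbedding f with hs
  have hs1 : ∀ r, s (f r) = f (σ r) := fun r => Equiv.Perm.viaFintypeEmbedding_apply_image _ _ _
  have hs2 : ∀ p, (∀ r, f r ≠ p) → s p = p := fun p hp =>
    Equiv.Perm.viaFintypeEmbedding_apply_notMem_range _ _ fun ⟨r, hr⟩ => hp r hr
  have hs3 : ∀ r, s (τ (f r)) = τ (f r) := fun r => hs2 _ fun r' => h.ne r' r
  have h1 : pairingWeight W lab (s * τ * s⁻¹) =
      ∑ q, pairWeight W (lab (s q)) (lab (s (τ q))) := by
    rw [pairingWeight, ← Equiv.sum_comp s]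
    simp
  rw [h1, pairingWeight, ← Finset.sum_sub_distrib]
  set F : P → ℤ := fun q => pairWeight W (lab (s q)) (lab (s (τ q))) -
    pairWeight W (lab q) (lab (τ q)) with hF
  have hdisj : Disjoint (Finset.univ.map f) (Finset.univ.map (f.trans τ.toEmbedding)) := by
    rw [Finset.disjoint_left]
    intro q hq hq'
    simp only [Finset.mem_map, Finset.mem_univ, true_and] at hq hq'
    obtain ⟨r, rfl⟩ := hq
    obtain ⟨r', hr'⟩ := hq'
    exact h.ne r r' hr'.symm
  have hsub : ∑ q, F q = ∑ q ∈ Finset.univ.map f ∪ Finset.univ.map (f.trans τ.toEmbedding), F q := by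
    symm
    refine Finset.sum_subset (Finset.subset_univ _) fun q _ hq => ?_
    simp only [Finset.mem_union, Finset.mem_map, Finset.mem_univ, true_and, not_or, not_exists,
      Function.Embedding.trans_apply, Equiv.coe_toEmbedding] at hq
    have h2 : s (τ q) = τ q := hs2 _ fun r hr => hq.2 r (by rw [hr, hτ.1])
    rw [hF]
    simp only
    rw [hs2 q hq.1, h2, sub_self]
  rw [hsub, Finset.sum_union hdisj, Finset.sum_map, Finset.sum_map, two_mul,
    ← Finset.sum_sub_distrib]
  congr 1
  · refine Finset.sum_congr rfl fun r _ => ?_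
    simp only [hF, hs1, hs3, h.lab_eq]
  · refine Finset.sum_congr rfl fun r _ => ?_
    simp only [hF, Function.Embedding.trans_apply, Equiv.coe_toEmbedding, hτ.1, hs1, hs3, h.lab_eq]
    rw [pairWeight_comm, pairWeight_comm W (lab (τ (f r)))]

/-- Write σ = κ ρ, where κ preserves rows and ρ preserves columns. Permuting the row ends by ρ has
the same effect on τ as permuting their partners by ρ⁻¹, so both factors act by label-preserving
permutations. Repeated rows and columns of a chain are antisymmetrized, so these contribute sign κ
and sign ρ, which cancel sign σ. -/
theorem sign_smul_labOp_conj (l : ℕ) (hτ : IsPairing τ) (h : IsPairingChain W lab τ f x y)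
    {σ ρ : Equiv.Perm ι} (h1 : ∀ r, x (σ r) = x (ρ r))
    (h2 : ∀ r, lab (τ (f (ρ r))) = lab (τ (f r))) :
    ((Equiv.Perm.sign σ : ℤ) : ℂ) • labOp lab (IsAnti W) l
      (pairFun l (σ.viaFintypeEmbedding f * τ * (σ.viaFintypeEmbedding f)⁻¹)) =
    labOp lab (IsAnti W) l (pairFun l τ) := by
  have hv1 : ∀ (π : Equiv.Perm ι) r, π.viaFintypeEmbedding f (f r) = f (π r) := fun π r =>
    Equiv.Perm.viaFintypeEmbedding_apply_image _ _ _
  have hv2 : ∀ (π : Equiv.Perm ι) p, p ∉ Set.range f → π.viaFintypeEmbedding f p = p := fun π p hp =>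
    Equiv.Perm.viaFintypeEmbedding_apply_notMem_range _ _ hp
  set κ := σ * ρ⁻¹ with hκ
  have hκx : ∀ r, x (κ r) = x r := fun r => by
    rw [hκ, Equiv.Perm.mul_apply, h1]; simp
  set κ' := κ.viaFintypeEmbedding f with hκ'
  set ρ' := ρ.viaFintypeEmbedding f with hρ'
  set g := τ * ρ' * τ⁻¹ with hg
  have hτi : τ⁻¹ = τ := by
    ext p; rw [Equiv.Perm.inv_eq_iff_eq, hτ.1]
  have hσ : σ.viaFintypeEmbedding f = κ' * ρ' := by
    rw [hκ', hρ', ← viaFintypeEmbedding_mul, hκ, inv_mul_cancel_right]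
  have hκP : Preserves lab κ' := by
    intro p
    by_cases hp : p ∈ Set.range f
    · obtain ⟨r, rfl⟩ := hp
      rw [hκ', hv1, h.lab_eq, h.lab_eq, hκx]
    · rw [hκ', hv2 _ _ hp]
  have hκs : labSign lab (IsAnti W) κ' = Equiv.Perm.sign κ := by
    rw [labSign_eq_sign _ hκP, hκ', Equiv.Perm.viaFintypeEmbedding_sign]
    intro p hne
    by_cases hp : p ∈ Set.range f
    · obtain ⟨r, rfl⟩ := hp
      rw [hv1] at hne
      have hr : κ r ≠ r := fun e => hne (by rw [e])
      rw [h.lab_eq, isAnti_coe]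
      rcases lt_or_gt_of_ne hr with hlt | hlt
      · rw [← hκx]; exact h.chain.row_mem _ _ hlt (hκx r)
      · exact h.chain.row_mem _ _ hlt (hκx r).symm
    · exact absurd (hv2 _ _ hp) hne
  have hgr : ∀ r, g (τ (f r)) = τ (f (ρ r)) := fun r => by
    rw [hg, hτi, Equiv.Perm.mul_apply, Equiv.Perm.mul_apply, hτ.1, hρ', hv1]
  have hgo : ∀ p, τ p ∉ Set.range f → g p = p := fun p hp => by
    rw [hg, hτi, Equiv.Perm.mul_apply, Equiv.Perm.mul_apply, hρ', hv2 _ _ hp, hτ.1]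
  have hgP : Preserves lab g := by
    intro p
    by_cases hp : τ p ∈ Set.range f
    · obtain ⟨r, hr⟩ := hp
      have : p = τ (f r) := by rw [hr, hτ.1]
      rw [this, hgr, h2]
    · rw [hgo p hp]
  have hgs : labSign lab (IsAnti W) g = Equiv.Perm.sign ρ := by
    rw [labSign_eq_sign _ hgP, hg, Equiv.Perm.sign_mul, Equiv.Perm.sign_mul, Equiv.Perm.sign_inv,
      hρ', Equiv.Perm.viaFintypeEmbedding_sign, mul_comm, ← mul_assoc, Int.units_mul_self, one_mul]
    intro p hne
    by_cases hp : τ p ∈ Set.range f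
    · obtain ⟨r, hr⟩ := hp
      have hpr : p = τ (f r) := by rw [hr, hτ.1]
      rw [hpr, hgr] at hne
      have hr' : ρ r ≠ r := fun e => hne (by rw [e])
      rw [hpr]
      rcases h.chain.col r with ⟨hc, -⟩ | ⟨hc, -, -⟩
      · rw [hc]; exact isAnti_top W
      · rcases h.chain.col (ρ r) with ⟨hc', -⟩ | ⟨hc', -, -⟩
        · rw [← h2, hc']; exact isAnti_top W
        · have hy : y (ρ r) = y r := by
            rw [← WithTop.coe_inj, ← hc, ← hc', h2]
          rw [hc, isAnti_coe]
          rcases lt_or_gt_of_ne hr' with hlt | hlt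
          · rw [← hy]; exact h.chain.col_mem _ _ hlt hy
          · exact h.chain.col_mem _ _ hlt hy.symm
    · exact absurd (hgo _ hp) hne
  have hcomm : ρ' * g = g * ρ' := by
    ext p
    change ρ' (g p) = g (ρ' p)
    by_cases hp : p ∈ Set.range f
    · obtain ⟨r, rfl⟩ := hp
      have h3 : ∀ r, τ (f r) ∉ Set.range f := fun r ⟨s, hs⟩ => h.ne s r hs
      rw [hgo _ (h3 r), hρ', hv1, hgo _ (h3 _)]
    · rw [hρ', hv2 _ _ hp]
      by_cases hp' : τ p ∈ Set.range f
      · obtain ⟨r, hr⟩ := hp'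
        have hpr : p = τ (f r) := by rw [hr, hτ.1]
        rw [hpr, hgr, hv2]
        rintro ⟨s, hs⟩
        exact h.ne _ _ hs
      · rw [hgo _ hp', hv2 _ _ hp]
  have hconj : σ.viaFintypeEmbedding f * τ * (σ.viaFintypeEmbedding f)⁻¹ =
      κ' * (g⁻¹ * τ * (g⁻¹)⁻¹) * κ'⁻¹ := by
    have h4 : τ * ρ' = g * τ := by rw [hg]; group
    have h5 : τ * g = ρ' * τ := by
      rw [hg, hτi, ← mul_assoc, ← mul_assoc]
      have : τ * τ = 1 := by ext p; simp [hτ.1]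
      rw [this, one_mul]
    have h6 : ρ' * τ * ρ'⁻¹ = g⁻¹ * τ * g := by
      have h7 : g⁻¹ * τ = τ * ρ'⁻¹ := by
        rw [inv_mul_eq_iff_eq_mul, ← mul_assoc, ← h4, mul_inv_cancel_right]
      have h8 : ρ' * g⁻¹ = g⁻¹ * ρ' := (show Commute ρ' g from hcomm).inv_right.eq
      rw [mul_assoc, ← h7, ← mul_assoc, h8, mul_assoc, ← h5, mul_assoc]
    rw [hσ, inv_inv, ← h6]
    group
  rw [hconj, labOp_pairFun_conj _ hκP, labOp_pairFun_conj _ hgP.inv, labSign_inv, hκs, hgs,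
    smul_smul, smul_smul]
  have h7 : ((Equiv.Perm.sign σ : ℤ) : ℂ) * (((Equiv.Perm.sign κ : ℤ) : ℂ) *
      ((Equiv.Perm.sign ρ : ℤ) : ℂ)) = 1 := by
    have : Equiv.Perm.sign σ * (Equiv.Perm.sign κ * Equiv.Perm.sign ρ) = 1 := by
      rw [← Equiv.Perm.sign_mul, hκ, inv_mul_cancel_right, Int.units_mul_self]
    have h8 : ((Equiv.Perm.sign σ * (Equiv.Perm.sign κ * Equiv.Perm.sign ρ) : ℤˣ) : ℤ) = 1 := by
      rw [this]; rfl
    push_cast at h8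
    exact_mod_cast h8
  rw [mul_assoc, h7, one_smul]

/-- A pairing that contains an increasing chain longer than the dimension is a combination of
pairings of smaller weight. -/
theorem labOp_mem_of_chain {l : ℕ} (hl : l < Fintype.card ι) (hτ : IsPairing τ)
    (h : IsPairingChain W lab τ f x y) (B : Submodule ℂ ((P → Fin l) → ℂ))
    (hB : ∀ τ', IsPairing τ' → pairingWeight W lab τ' < pairingWeight W lab τ →
      labOp lab (IsAnti W) l (pairFun l τ') ∈ B) :
    labOp lab (IsAnti W) l (pairFun l τ) ∈ B := by
  set T : Equiv.Perm ι → Equiv.Perm P := fun σ =>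
    σ.viaFintypeEmbedding f * τ * (σ.viaFintypeEmbedding f)⁻¹ with hT
  -- This is the antisymmetrization over the row ends of the chain, of which there are more than l.
  have hzero : ∑ σ : Equiv.Perm ι, ((Equiv.Perm.sign σ : ℤ) : ℂ) •
      labOp lab (IsAnti W) l (pairFun l (T σ)) = 0 := by
    rw [← map_zero (labOp lab (IsAnti W) l)]
    simp only [← map_smul, ← map_sum]
    congr 1
    funext w
    simp only [Finset.sum_apply, Pi.smul_apply, hT, pairFun_conj, smul_eq_mul, Pi.zero_apply]
    exact sum_sign_comp_eq_zero hl f (pairFun l τ) w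
  have hterm : ∀ σ : Equiv.Perm ι, pairingWeight W lab (T σ) < pairingWeight W lab τ ∨
      ((Equiv.Perm.sign σ : ℤ) : ℂ) • labOp lab (IsAnti W) l (pairFun l (T σ)) =
        labOp lab (IsAnti W) l (pairFun l τ) := by
    intro σ
    obtain ⟨h1, h2⟩ := h.chain.sum_le Finset.univ σ fun r hr => absurd (Finset.mem_univ r) hr
    have h3 := pairingWeight_conj hτ h σ
    rcases h1.lt_or_eq with h4 | h4
    · left
      simp only [hT]
      linarith
    · right
      obtain ⟨ρ, hρ1, hρ2⟩ := h2 h4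
      exact sign_smul_labOp_conj l hτ h hρ1 hρ2
  set A : Finset (Equiv.Perm ι) := Finset.univ.filter fun σ =>
    pairingWeight W lab (T σ) < pairingWeight W lab τ with hA
  have hsplit := Finset.sum_filter_add_sum_filter_not Finset.univ (fun σ : Equiv.Perm ι =>
    pairingWeight W lab (T σ) < pairingWeight W lab τ) (fun σ =>
      ((Equiv.Perm.sign σ : ℤ) : ℂ) • labOp lab (IsAnti W) l (pairFun l (T σ)))
  rw [hzero] at hsplit
  set n := (Finset.univ.filter fun σ : Equiv.Perm ι =>
    ¬ pairingWeight W lab (T σ) < pairingWeight W lab τ).card with hn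
  have h2 : ∑ σ ∈ Finset.univ.filter (fun σ : Equiv.Perm ι =>
      ¬ pairingWeight W lab (T σ) < pairingWeight W lab τ),
      ((Equiv.Perm.sign σ : ℤ) : ℂ) • labOp lab (IsAnti W) l (pairFun l (T σ)) =
      (n : ℂ) • labOp lab (IsAnti W) l (pairFun l τ) := by
    rw [Finset.sum_congr rfl fun σ hσ =>
      (hterm σ).resolve_left (Finset.mem_filter.mp hσ).2, Finset.sum_const, Nat.cast_smul_eq_nsmul]
  -- The identity permutation is among the terms that keep the weight.
  have hn0 : (n : ℂ) ≠ 0 := by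
    rw [Nat.cast_ne_zero, hn, Finset.card_ne_zero]
    refine ⟨1, ?_⟩
    have : T 1 = τ := by
      have : (1 : Equiv.Perm ι).viaFintypeEmbedding f = 1 := by
        rw [Equiv.Perm.viaFintypeEmbedding, Equiv.Perm.extendDomain_one]
      simp [hT, this]
    simp [this]
  rw [h2] at hsplit
  have h3 : (n : ℂ) • labOp lab (IsAnti W) l (pairFun l τ) ∈ B := by
    rw [eq_neg_of_add_eq_zero_right hsplit]
    refine B.neg_mem (B.sum_mem fun σ hσ => B.smul_mem _ (hB _ (hτ.conj _) ?_))
    exact (Finset.mem_filter.mp hσ).2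
  exact (B.smul_mem_iff hn0).mp h3

end Straighten

/-! ### Long increasing sequences as chains of pairs -/

section Chains

variable {k : ℕ} {W : Finset (Fin k)}

theorem Step.trans {p q r : Fin k × Fin k} (h1 : Step W W p q) (h2 : Step W W q r) :
    Step W W p r := by
  obtain ⟨a1, a2, a3, a4⟩ := h1
  obtain ⟨b1, b2, b3, b4⟩ := h2
  exact ⟨a1.trans b1, a2.trans b2, fun h => a3 (le_antisymm a1 (h ▸ b1)),
    fun h => a4 (le_antisymm a2 (h ▸ b2))⟩

instance : IsTrans (Fin k × Fin k) (Step W W) := ⟨fun _ _ _ => Step.trans⟩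

/-- Together with `Step.min_le` this reflects every point of a chain to one side of the diagonal;
the maxima serve as rows and the minima as columns of `IsChainData`. -/
theorem Step.max_le {p q : Fin k × Fin k} (h : Step W W p q) :
    max p.1 p.2 ≤ max q.1 q.2 ∧ (max p.1 p.2 = max q.1 q.2 → max p.1 p.2 ∈ W) := by
  obtain ⟨h1, h2, h3, h4⟩ := h
  refine ⟨max_le_max h1 h2, fun he => ?_⟩
  rcases le_total p.1 p.2 with h | h
  · rw [max_eq_right h] at he ⊢
    exact h4 (le_antisymm h2 (he ▸ le_max_right _ _))
  · rw [max_eq_left h] at he ⊢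
    exact h3 (le_antisymm h1 (he ▸ le_max_left _ _))

theorem Step.min_le {p q : Fin k × Fin k} (h : Step W W p q) :
    min p.1 p.2 ≤ min q.1 q.2 ∧ (min p.1 p.2 = min q.1 q.2 → min p.1 p.2 ∈ W) := by
  obtain ⟨h1, h2, h3, h4⟩ := h
  refine ⟨min_le_min h1 h2, fun he => ?_⟩
  rcases le_total q.1 q.2 with h | h
  · rw [min_eq_left h] at he
    have : p.1 = q.1 := le_antisymm h1 (he ▸ min_le_left _ _)
    rw [he, ← this]
    exact h3 this
  · rw [min_eq_right h] at he
    have : p.2 = q.2 := le_antisymm h2 (he ▸ min_le_right _ _)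
    rw [he, ← this]
    exact h4 this

variable {P : Type*} [Fintype P] [LinearOrder P] {lab : P → WithTop (Fin k)} {τ : Equiv.Perm P}

theorem HasType.exists_lift {M : Multiset (Fin k × Fin k)} (hM : HasType W lab τ M)
    {L : List (Fin k × Fin k)} (hL : (L : Multiset (Fin k × Fin k)) ≤ M) :
    ∃ L' : List P, L'.Nodup ∧ L'.map (fun p => (lab p, lab (fold lab τ p))) =
      L.map (fun z => ((z.1 : WithTop (Fin k)), (z.2 : WithTop (Fin k)))) := by
  obtain ⟨L', h1, -, h2⟩ := exists_nodup_lift (fun p => (lab p, lab (fold lab τ p)))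
    (L.map (fun z => ((z.1 : WithTop (Fin k)), (z.2 : WithTop (Fin k))))) Finset.univ (by
      intro z
      by_cases hz : z ∈ L.map (fun z => ((z.1 : WithTop (Fin k)), (z.2 : WithTop (Fin k))))
      · obtain ⟨⟨i, j⟩, -, rfl⟩ := List.mem_map.mp hz
        have hinj : Function.Injective
            (fun z : Fin k × Fin k => ((z.1 : WithTop (Fin k)), (z.2 : WithTop (Fin k)))) := by
          rintro ⟨i, j⟩ ⟨i', j'⟩ h
          simpa using h
        rw [← Multiset.map_coe, Multiset.count_map_eq_count' _ _ hinj (i, j)]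
        have h := Multiset.le_iff_count.mp hL (i, j)
        rw [hM.count_eq] at h
        simpa [Prod.ext_iff] using h
      · rw [Multiset.count_eq_zero.mpr (by simpa using hz)]
        exact Nat.zero_le _)
  exact ⟨L', h1, h2⟩

theorem exists_pairingChain {l : ℕ} {M : Multiset (Fin k × Fin k)} (hτ : IsPairing τ)
    (hr : IsReduced lab (IsAnti W) τ) (hM : HasType W lab τ M) (hl : ¬ incLength W W M ≤ l) :
    ∃ (f : Fin (l + 1) ↪ P) (x y : Fin (l + 1) → Fin k), IsPairingChain W lab τ f x y := by
  rw [incLength_le_iff] at hl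
  push Not at hl
  obtain ⟨L, ⟨hchain, hle⟩, hlen⟩ := hl
  rw [List.isChain_iff_pairwise] at hchain
  obtain ⟨L', hnd, hmap⟩ := hM.exists_lift hle
  have hlen' : L'.length = L.length := by simpa using congrArg List.length hmap
  have hL : ∀ r : Fin (l + 1), (r : ℕ) < L.length := fun r => by omega
  have hL' : ∀ r : Fin (l + 1), (r : ℕ) < L'.length := fun r => by omega
  set z : Fin (l + 1) → Fin k × Fin k := fun r => L[(r : ℕ)]'(hL r) with hz
  set q : Fin (l + 1) → P := fun r => L'[(r : ℕ)]'(hL' r) with hq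
  have hqz : ∀ r, lab (q r) = (z r).1 ∧ lab (fold lab τ (q r)) = (z r).2 := by
    intro r
    have h := List.getElem_of_eq hmap (i := r) (by simpa using hL' r)
    simpa only [List.getElem_map, Prod.mk.injEq] using h
  have hstep : ∀ r s, r < s → Step W W (z r) (z s) := fun r s hrs =>
    List.pairwise_iff_getElem.mp hchain _ _ (hL r) (hL s) hrs
  have hqinj : Function.Injective q := fun r s h =>
    Fin.ext ((List.Nodup.getElem_inj_iff hnd).mp h)
  -- The row end is the one with the larger label; for a fixed point it is the end outside the block
  -- of ∞.
  set p : Fin (l + 1) → P := fun r =>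
    if lab (τ (q r)) ≠ ⊤ ∧ lab (q r) < lab (τ (q r)) then τ (q r) else q r with hp
  have hpq : ∀ r, p r = q r ∨ p r = τ (q r) := by
    intro r
    simp only [hp]
    split_ifs
    · exact Or.inr rfl
    · exact Or.inl rfl
  -- If two positions of the chain were partners, their points would be transposes of each other.
  -- Being increasing, the points would coincide on the diagonal at a symbol of W, which a reduced
  -- pairing excludes.
  have hqτ : ∀ r s, q r ≠ τ (q s) := by
    have aux : ∀ r s, r < s → q r ≠ τ (q s) := by
      intro r s hrs h
      have h1 : lab (τ (q s)) ≠ ⊤ := by rw [← h, (hqz r).1]; simp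
      have h2 : lab (τ (q r)) ≠ ⊤ := by rw [h, hτ.1, (hqz s).1]; simp
      have hs1 := hqz s
      have hr1 := hqz r
      rw [fold_of_ne_top (by rw [hs1.1]; simp) h1] at hs1
      rw [fold_of_ne_top (by rw [hr1.1]; simp) h2] at hr1
      have e1 : (z r).1 = (z s).2 := WithTop.coe_injective (by rw [← hr1.1, ← hs1.2, h])
      have e2 : (z s).1 = (z r).2 := WithTop.coe_injective (by rw [← hr1.2, ← hs1.1, h, hτ.1])
      obtain ⟨a1, a2, a3, -⟩ := hstep r s hrs
      have e3 : (z r).1 = (z s).1 := le_antisymm a1 (by rw [e1, e2]; exact a2)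
      refine hr.1 (q r) ?_ ?_
      · rw [hr1.1, hr1.2, ← e2, e3]
      · rw [hr1.1, isAnti_coe]; exact a3 e3
    intro r s h
    rcases lt_trichotomy r s with hrs | rfl | hrs
    · exact aux r s hrs h
    · exact hτ.2 _ h.symm
    · exact aux s r hrs (by rw [h, hτ.1])
  have hpp : ∀ r s, p r ≠ τ (p s) := by
    intro r s h
    rcases hpq r with h1 | h1 <;> rcases hpq s with h2 | h2 <;> rw [h1, h2] at h
    · exact hqτ r s h
    · rw [hτ.1] at h
      have := hqinj h
      subst this
      rw [h1] at h2
      exact hτ.2 _ h2.symm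
    · have := hqinj (τ.injective h)
      subst this
      rw [h1] at h2
      exact hτ.2 _ h2
    · rw [hτ.1] at h
      exact hqτ s r h.symm
  have hpinj : Function.Injective p := by
    intro r s h
    rcases hpq r with h1 | h1 <;> rcases hpq s with h2 | h2 <;> rw [h1, h2] at h
    · exact hqinj h
    · exact absurd h (hqτ r s)
    · exact absurd h.symm (hqτ s r)
    · exact hqinj (τ.injective h)
  have hcases : ∀ r, lab (p r) = (max (z r).1 (z r).2 : Fin k) ∧
      ((lab (τ (p r)) = ⊤ ∧ min (z r).1 (z r).2 = max (z r).1 (z r).2) ∨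
        (lab (τ (p r)) = (min (z r).1 (z r).2 : Fin k) ∧ min (z r).1 (z r).2 ≤ max (z r).1 (z r).2 ∧
          (min (z r).1 (z r).2 = max (z r).1 (z r).2 → min (z r).1 (z r).2 ∉ W))) := by
    intro r
    obtain ⟨h1, h2⟩ := hqz r
    by_cases ht : lab (τ (q r)) = ⊤
    · rw [fold_of_top ht, h1] at h2
      have he : (z r).1 = (z r).2 := WithTop.coe_injective h2
      have hpr : p r = q r := if_neg fun h => h.1 ht
      rw [hpr, he, max_self, min_self, h1, he]
      exact ⟨rfl, Or.inl ⟨ht, rfl⟩⟩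
    · rw [fold_of_ne_top (by rw [h1]; simp) ht] at h2
      have hW : (z r).1 = (z r).2 → (z r).1 ∉ W := by
        intro he hmem
        refine hr.1 (q r) ?_ ?_
        · rw [h1, h2, he]
        · rwa [h1, isAnti_coe]
      by_cases hlt : (z r).1 < (z r).2
      · have hpr : p r = τ (q r) := if_pos ⟨ht, by rw [h1, h2]; exact WithTop.coe_lt_coe.mpr hlt⟩
        rw [hpr, hτ.1, max_eq_right hlt.le, min_eq_left hlt.le]
        exact ⟨h2, Or.inr ⟨h1, hlt.le, fun he => absurd he hlt.ne⟩⟩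
      · have hpr : p r = q r := if_neg fun h => hlt (by
          have := h.2
          rwa [h1, h2, WithTop.coe_lt_coe] at this)
        have hle' := not_lt.mp hlt
        rw [hpr, max_eq_left hle', min_eq_right hle']
        exact ⟨h1, Or.inr ⟨h2, hle', fun he => he ▸ hW he.symm⟩⟩
  exact ⟨⟨p, hpinj⟩, fun r => max (z r).1 (z r).2, fun r => min (z r).1 (z r).2,
    { ne := hpp
      lab_eq := fun r => (hcases r).1
      chain :=
        { col := fun r => (hcases r).2
          row_le := fun r s hrs => (hstep r s hrs).max_le.1
          row_mem := fun r s hrs => (hstep r s hrs).max_le.2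
          col_le := fun r s hrs => (hstep r s hrs).min_le.1
          col_mem := fun r s hrs => (hstep r s hrs).min_le.2 } }⟩

/-- The pairings whose type has no long increasing subsequence span the image of all pairings. -/
theorem labOp_pairFun_mem {ν : Fin k → ℕ} {a l : ℕ}
    (hν : ∀ i : Fin k, (Finset.univ.filter fun p => lab p = i).card = ν i)
    (ha : (Finset.univ.filter fun p => lab p = ⊤).card = a)
    (B : Submodule ℂ ((P → Fin l) → ℂ))
    (hB : ∀ τ, IsPairing τ → ∀ M ∈ symMultisets W ν a, HasType W lab τ M →
      incLength W W M ≤ l → labOp lab (IsAnti W) l (pairFun l τ) ∈ B) (n : ℕ) :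
    ∀ τ, IsPairing τ → (pairingWeight W lab τ).toNat = n →
      labOp lab (IsAnti W) l (pairFun l τ) ∈ B := by
  induction n using Nat.strong_induction_on with
  | _ n ih =>
    intro τ hτ hn
    by_cases hr : IsReduced lab (IsAnti W) τ
    · obtain ⟨M, hM, hT⟩ := hr.exists_hasType hν ha hτ
      by_cases hl : incLength W W M ≤ l
      · exact hB τ hτ M hM hT hl
      · obtain ⟨f, x, y, hc⟩ := exists_pairingChain hτ hr hT hl
        refine labOp_mem_of_chain (by simp) hτ hc B fun τ' hτ' hlt => ih _ ?_ τ' hτ' rfl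
        have := pairingWeight_nonneg (W := W) (lab := lab) (τ := τ')
        omega
    · rw [labOp_pairFun_of_not_isReduced _ l hτ hr]
      exact B.zero_mem

end Chains

/-! ### Colourings and linear independence -/

/-- The height function of a strict order, on a set with bounded chains. -/
theorem exists_height {P : Type*} (r : P → P → Prop) (S : P → Prop)
    (htrans : ∀ a b c, r a b → r b c → r a c) (l : ℕ)
    (hl : ∀ L : List P, (∀ p ∈ L, S p) → L.Pairwise r → L.length ≤ l) :
    ∃ h : P → ℕ, (∀ p q, S p → S q → r p q → h p < h q) ∧ (∀ p, S p → h p < l) ∧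
      ∀ e : Equiv.Perm P, (∀ p, S (e p) ↔ S p) → (∀ p q, r (e p) (e q) ↔ r p q) →
        ∀ p, h (e p) = h p := by
  -- The lengths of chains strictly below p, listed downwards; the height of p is their supremum.
  set A : P → Set ℕ := fun p =>
    {n | ∃ L : List P, (∀ q ∈ L, S q) ∧ (p :: L).Pairwise (fun a b => r b a) ∧ L.length = n} with hA
  have hlt : ∀ p, S p → ∀ n ∈ A p, n < l := by
    rintro p hp n ⟨L, h1, h2, rfl⟩
    have := hl (p :: L).reverse (by
      intro q hq
      rcases List.mem_cons.mp (List.mem_reverse.mp hq) with rfl | hq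
      exacts [hp, h1 q hq]) (List.pairwise_reverse.mpr h2)
    simpa using this
  have hne : ∀ p, (A p).Nonempty := fun p => ⟨0, [], by simp, by simp, rfl⟩
  have hbdd : ∀ p, S p → BddAbove (A p) := fun p hp => ⟨l, fun n hn => (hlt p hp n hn).le⟩
  refine ⟨fun p => sSup (A p), fun p q hp hq hpq => ?_, fun p hp => ?_, fun e he1 he2 p => ?_⟩
  · obtain ⟨L, h1, h2, h3⟩ := Nat.sSup_mem (hne p) (hbdd p hp)
    refine Nat.lt_of_succ_le (le_csSup (hbdd q hq) ⟨p :: L, ?_, ?_, by simp [h3]⟩)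
    · simpa using ⟨hp, h1⟩
    · refine List.pairwise_cons.mpr ⟨fun b hb => ?_, h2⟩
      rcases List.mem_cons.mp hb with rfl | hb
      · exact hpq
      · exact htrans _ _ _ ((List.pairwise_cons.mp h2).1 b hb) hpq
  · exact hlt p hp _ (Nat.sSup_mem (hne p) (hbdd p hp))
  · have aux : ∀ e : Equiv.Perm P, (∀ p, S (e p) ↔ S p) → (∀ p q, r (e p) (e q) ↔ r p q) →
        ∀ p, A p ⊆ A (e p) := by
      rintro e he1 he2 p n ⟨L, h1, h2, h3⟩
      refine ⟨L.map e, by simpa [he1] using h1, ?_, by simpa using h3⟩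
      rw [← List.map_cons, List.pairwise_map]
      simpa only [he2] using h2
    have h1 := aux e he1 he2 p
    have h2 := aux e⁻¹ (fun p => by rw [← he1]; simp) (fun p q => by rw [← he2]; simp) (e p)
    rw [show e⁻¹ (e p) = p by simp] at h2
    exact congrArg sSup (Set.Subset.antisymm h2 h1)

/-- In a relation, apply φ j for an index j of nonzero coefficient with ψ j maximal: only the j-th
term survives. -/
theorem linearIndependent_of_triangular {ι K V : Type*} [Field K] [AddCommGroup V] [Module K V]
    (v : ι → V) (φ : ι → V →ₗ[K] K) (ψ : ι → ℕ) (h1 : ∀ i, φ i (v i) ≠ 0)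
    (h2 : ∀ i j, φ i (v j) ≠ 0 → i = j ∨ ψ i < ψ j) : LinearIndependent K v := by
  classical
  rw [linearIndependent_iff']
  intro s g hg
  by_contra! h
  obtain ⟨i, his, hi⟩ := h
  obtain ⟨j, hj, hmax⟩ := Finset.exists_max_image (s.filter fun i => g i ≠ 0) ψ
    ⟨i, by simp [his, hi]⟩
  rw [Finset.mem_filter] at hj
  have h3 := congrArg (φ j) hg
  rw [map_sum, map_zero, Finset.sum_eq_single j] at h3
  · rw [map_smul, smul_eq_mul] at h3
    exact (mul_ne_zero hj.2 (h1 j)) h3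
  · intro i hi hij
    rw [map_smul, smul_eq_mul]
    by_contra hne
    have hgi := left_ne_zero_of_mul hne
    rcases h2 j i (right_ne_zero_of_mul hne) with e | hlt
    · exact hij e.symm
    · exact absurd (hmax i (by simp [hi, hgi])) (not_le.mpr hlt)
  · intro hjs
    exact absurd hj.1 hjs

/-! ### Signs of symmetries of reduced pairings -/

section Sign

variable {P L : Type*} [Fintype P] [DecidableEq P] [LinearOrder L] {lab : P → L} {anti : L → Prop}
  [DecidablePred anti] {τ : Equiv.Perm P}

/-- A label-preserving permutation that respects a reduced pairing on the antisymmetric positions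
has sign `1`. -/
theorem labSign_eq_one_of_commute (hτ : IsPairing τ) (hr : IsReduced lab anti τ)
    {g : Equiv.Perm P} (hg : Preserves lab g)
    (h1 : ∀ p, anti (lab p) → ¬ anti (lab (τ p)) → g p = p)
    (h2 : ∀ p, anti (lab p) → anti (lab (τ p)) → g (τ p) = τ (g p)) :
    labSign lab anti g = 1 := by
  -- H holds the smaller ends of the pairs between antisymmetrized blocks. On H and on its partners
  -- g acts by conjugate permutations, whose signs cancel; on the other antisymmetric positions g is
  -- the identity.
  set H : P → Prop := fun p => anti (lab p) ∧ anti (lab (τ p)) ∧ lab p < lab (τ p) with hH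
  have hτg : ∀ p, anti (lab p) → anti (lab (τ p)) → lab (τ (g p)) = lab (τ p) := fun p a b => by
    rw [← h2 p a b, hg]
  have hHg : ∀ p, H p → H (g p) := by
    rintro p ⟨a, b, c⟩
    refine ⟨?_, ?_, ?_⟩
    · rwa [hg]
    · rwa [hτg p a b]
    · rwa [hg, hτg p a b]
  have hHiff : ∀ p, H (g p) ↔ H p := by
    have himg : (Finset.univ.filter H).map g.toEmbedding = Finset.univ.filter H := by
      refine Finset.eq_of_subset_of_card_le ?_ (by rw [Finset.card_map])
      intro q hq
      simp only [Finset.mem_map, Finset.mem_filter, Finset.mem_univ, true_and] at hq ⊢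
      obtain ⟨p, hp, rfl⟩ := hq
      exact hHg p hp
    intro p
    refine ⟨fun h => ?_, hHg p⟩
    have : g p ∈ (Finset.univ.filter H).map g.toEmbedding := by rw [himg]; simpa using h
    simpa using this
  set g1 : Equiv.Perm P := Equiv.Perm.ofSubtype (g.subtypePerm (p := H) hHiff) with hg1
  have g1H : ∀ p, H p → g1 p = g p := fun p hp => Equiv.Perm.ofSubtype_subtypePerm_of_mem hHiff hp
  have g1N : ∀ p, ¬ H p → g1 p = p := fun p hp =>
    Equiv.Perm.ofSubtype_subtypePerm_of_not_mem hHiff hp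
  have hτi : τ⁻¹ = τ := by ext p; rw [Equiv.Perm.inv_eq_iff_eq, hτ.1]
  set g2 : Equiv.Perm P := τ * g1 * τ⁻¹ with hg2
  have g2a : ∀ p, g2 p = τ (g1 (τ p)) := fun p => by rw [hg2, hτi]; rfl
  have g2H : ∀ p, H (τ p) → g2 p = g p := by
    intro p hp
    rw [g2a, g1H _ hp, ← h2 _ hp.1 hp.2.1, hτ.1]
  have g2N : ∀ p, ¬ H (τ p) → g2 p = p := fun p hp => by rw [g2a, g1N _ hp, hτ.1]
  have hp1 : Preserves lab g1 := fun p => by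
    by_cases h : H p
    · rw [g1H p h, hg]
    · rw [g1N p h]
  have hp2 : Preserves lab g2 := fun p => by
    by_cases h : H (τ p)
    · rw [g2H p h, hg]
    · rw [g2N p h]
  have hexcl : ∀ p, H p → ¬ H (τ p) := by
    rintro p ⟨-, -, h⟩ ⟨-, -, h'⟩
    rw [hτ.1] at h'
    exact absurd h h'.asymm
  have hs1 : labSign lab anti g1 = Equiv.Perm.sign g1 := labSign_eq_sign anti hp1 fun p hp => by
    by_cases h : H p
    · exact h.1
    · exact absurd (g1N p h) hp
  have hs2 : labSign lab anti g2 = Equiv.Perm.sign g1 := by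
    rw [labSign_eq_sign anti hp2, hg2, Equiv.Perm.sign_mul, Equiv.Perm.sign_mul,
      Equiv.Perm.sign_inv, mul_comm, ← mul_assoc, Int.units_mul_self, one_mul]
    intro p hp
    by_cases h : H (τ p)
    · have := h.2.1
      rwa [hτ.1] at this
    · exact absurd (g2N p h) hp
  set g3 := (g1 * g2)⁻¹ * g with hg3
  have hp3 : Preserves lab g3 := (hp1.mul hp2).inv.mul hg
  have hs3 : labSign lab anti g3 = 1 := by
    refine labSign_eq_one anti hp3 fun p hp => ?_
    rw [hg3, Equiv.Perm.mul_apply, Equiv.Perm.inv_eq_iff_eq, Equiv.Perm.mul_apply]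
    by_cases ha : anti (lab (τ p))
    · rcases lt_trichotomy (lab p) (lab (τ p)) with h | h | h
      · have hpH : H p := ⟨hp, ha, h⟩
        rw [g2N p (hexcl p hpH), g1H p hpH]
      · exact absurd hp (hr.1 p h)
      · have hpH : H (τ p) := ⟨ha, by rwa [hτ.1], by rwa [hτ.1]⟩
        rw [g2H p hpH, g1N]
        rw [hHiff]
        intro h'
        exact hexcl p h' hpH
    · have h3 : ¬ H p := fun h => ha h.2.1
      have h4 : ¬ H (τ p) := fun h => ha h.1
      rw [h1 p hp ha, g2N p h4, g1N p h3]
  have hfac : g = g1 * g2 * g3 := by rw [hg3]; group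
  rw [hfac, labSign_mul anti (hp1.mul hp2) hp3, labSign_mul anti hp1 hp2, hs1, hs2, hs3, mul_one,
    ← Units.val_mul, Int.units_mul_self]
  rfl

end Sign

/-! ### Corner counts of colour classes -/

section Counts

theorem card_add_le_inter {P : Type*} [DecidableEq P] (C : Finset P) (A B : P → Prop)
    [DecidablePred A] [DecidablePred B] :
    (C.filter A).card + (C.filter B).card ≤ (C.filter fun p => A p ∧ B p).card + C.card := by
  rw [← Finset.card_union_add_card_inter, ← Finset.filter_or, ← Finset.filter_and, add_comm]
  exact Nat.add_le_add_left (Finset.card_filter_le _ _) _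

/-- Under either alternative the bound of `card_add_le_inter` is attained, truncated subtraction
supplying the 0 of the disjoint case. -/
theorem card_inter_of_nested {P : Type*} [DecidableEq P] (C : Finset P) (A B : P → Prop)
    [DecidablePred A] [DecidablePred B]
    (h : (∀ p ∈ C, A p ∨ B p) ∨ ∀ p ∈ C, ¬ (A p ∧ B p)) :
    (C.filter fun p => A p ∧ B p).card = (C.filter A).card + (C.filter B).card - C.card := by
  rcases h with h | h
  · have h1 := Finset.card_union_add_card_inter (C.filter A) (C.filter B)
    rw [← Finset.filter_or, ← Finset.filter_and, Finset.filter_true_of_mem h] at h1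
    omega
  · have h1 := Finset.card_union_add_card_inter (C.filter A) (C.filter B)
    rw [← Finset.filter_or, ← Finset.filter_and, Finset.filter_false_of_mem h,
      Finset.card_empty] at h1
    have h2 := Finset.card_filter_le C (fun p => A p ∨ B p)
    rw [Finset.filter_false_of_mem h, Finset.card_empty]
    omega

variable {k l : ℕ} {P : Type*} [Fintype P] [LinearOrder P] {lab : P → WithTop (Fin k)}

/-- The rank of a symbol, with `∞` last. -/
def symNum : WithTop (Fin k) → ℕ
  | (i : Fin k) => i
  | ⊤ => k

@[simp] theorem symNum_coe (i : Fin k) : symNum (i : WithTop (Fin k)) = i := rfl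

theorem symNum_lt {u v : WithTop (Fin k)} (h : symNum u < symNum v) : u < v := by
  induction u using WithTop.recTopCoe with
  | top =>
    induction v using WithTop.recTopCoe with
    | top => exact absurd h (lt_irrefl _)
    | coe j =>
      have := j.isLt
      change k < (j : ℕ) at h
      omega
  | coe i =>
    induction v using WithTop.recTopCoe with
    | top => exact WithTop.coe_lt_top i
    | coe j => exact WithTop.coe_lt_coe.mpr h

/-- The positions of colour `c` outside of the block of `∞`. -/
def colourClass (lab : P → WithTop (Fin k)) (w : P → Fin l) (c : Fin l) : Finset P :=
  Finset.univ.filter fun p => lab p ≠ ⊤ ∧ w p = c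

/-- The number of positions of colour `c` with prescribed bounds on the two coordinates. -/
def cumCount (lab : P → WithTop (Fin k)) (w : P → Fin l) (τ : Equiv.Perm P) (c : Fin l)
    (m n : ℕ) : ℕ :=
  ((colourClass lab w c).filter fun p =>
    symNum (lab p) < m ∧ symNum (lab (fold lab τ p)) < n).card

/-- The number of positions of colour `c` with prescribed coordinates. -/
def cellCount (lab : P → WithTop (Fin k)) (w : P → Fin l) (τ : Equiv.Perm P) (c : Fin l)
    (i j : Fin k) : ℕ :=
  ((colourClass lab w c).filter fun p => lab p = i ∧ lab (fold lab τ p) = j).card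

variable {w : P → Fin l} {τ τ' : Equiv.Perm P}

theorem fold_mem_colourClass (hw : ∀ p, w (τ p) = w p) {c : Fin l} {p : P}
    (hp : p ∈ colourClass lab w c) : fold lab τ p ∈ colourClass lab w c := by
  simp only [colourClass, Finset.mem_filter, Finset.mem_univ, true_and] at hp ⊢
  refine ⟨lab_fold_ne_top hp.1, ?_⟩
  rw [← hp.2, fold]
  split_ifs
  · rfl
  · exact hw p

/-- `fold` is an involution of each colour class, so the marginals of the arrangement depend on the
colouring alone. -/
theorem card_fold_lt (hτ : IsPairing τ) (hw : ∀ p, w (τ p) = w p) (c : Fin l) (n : ℕ) :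
    ((colourClass lab w c).filter fun p => symNum (lab (fold lab τ p)) < n).card =
      ((colourClass lab w c).filter fun p => symNum (lab p) < n).card := by
  refine Finset.card_bij' (fun p _ => fold lab τ p) (fun p _ => fold lab τ p) ?_ ?_ ?_ ?_
  · intro p hp
    rw [Finset.mem_filter] at hp ⊢
    exact ⟨fold_mem_colourClass hw hp.1, hp.2⟩
  · intro p hp
    rw [Finset.mem_filter] at hp ⊢
    exact ⟨fold_mem_colourClass hw hp.1, by rw [fold_fold hτ]; exact hp.2⟩
  · intro p _; exact fold_fold hτ p
  · intro p _; exact fold_fold hτ p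

/-- Every colour class is a decreasing arrangement. -/
def IsDecreasing (lab : P → WithTop (Fin k)) (w : P → Fin l) (τ : Equiv.Perm P) : Prop :=
  ∀ p q, lab p ≠ ⊤ → lab q ≠ ⊤ → w p = w q → lab p < lab q → lab (fold lab τ q) ≤ lab (fold lab τ p)

/-- In a decreasing arrangement no position can miss both half-planes while another lies in both, so
the corner count has the least value allowed by its marginals. These are the same for τ'. -/
theorem cumCount_le (hτ : IsPairing τ) (hτ' : IsPairing τ') (hw : ∀ p, w (τ p) = w p)
    (hw' : ∀ p, w (τ' p) = w p) (hd : IsDecreasing lab w τ) (c : Fin l) (m n : ℕ) :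
    cumCount lab w τ c m n ≤ cumCount lab w τ' c m n := by
  have h1 := card_add_le_inter (colourClass lab w c) (fun p => symNum (lab p) < m)
    (fun p => symNum (lab (fold lab τ' p)) < n)
  have h2 := card_inter_of_nested (colourClass lab w c) (fun p => symNum (lab p) < m)
    (fun p => symNum (lab (fold lab τ p)) < n) (by
      by_contra! h
      obtain ⟨⟨p, hp, hp1, hp2⟩, q, hq, hq1, hq2⟩ := h
      simp only [colourClass, Finset.mem_filter, Finset.mem_univ, true_and] at hp hq
      have h3 := hd q p hq.1 hp.1 (hq.2.trans hp.2.symm) (symNum_lt (by omega))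
      have h4 : lab (fold lab τ q) < lab (fold lab τ p) := symNum_lt (by omega)
      exact absurd h3 (not_le.mpr h4))
  rw [card_fold_lt hτ' hw'] at h1
  rw [card_fold_lt hτ hw] at h2
  rw [cumCount, cumCount, h2]
  omega

/-- Cell counts are the mixed second differences of corner counts, so corner counts determine them.
-/
theorem cellCount_add (c : Fin l) (i j : Fin k) :
    cumCount lab w τ c (i + 1) (j + 1) + cumCount lab w τ c i j =
      cumCount lab w τ c i (j + 1) + cumCount lab w τ c (i + 1) j + cellCount lab w τ c i j := by
  simp only [cumCount, cellCount, Finset.card_filter]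
  rw [← Finset.sum_add_distrib, ← Finset.sum_add_distrib, ← Finset.sum_add_distrib]
  refine Finset.sum_congr rfl fun p hp => ?_
  simp only [colourClass, Finset.mem_filter, Finset.mem_univ, true_and] at hp
  have hp' := lab_fold_ne_top (τ := τ) hp.1
  obtain ⟨x, hx⟩ := WithTop.ne_top_iff_exists.mp hp.1
  obtain ⟨y, hy⟩ := WithTop.ne_top_iff_exists.mp hp'
  rw [← hx, ← hy]
  simp only [symNum_coe, WithTop.coe_inj, Fin.ext_iff]
  have e1 : ((x : ℕ) < i + 1) ↔ (x : ℕ) < i ∨ (x : ℕ) = i := by omega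
  have e2 : ((y : ℕ) < j + 1) ↔ (y : ℕ) < j ∨ (y : ℕ) = j := by omega
  simp only [e1, e2]
  by_cases h1 : (x : ℕ) < i <;> by_cases h2 : (x : ℕ) = i <;> by_cases h3 : (y : ℕ) < j <;>
    by_cases h4 : (y : ℕ) = j <;> first | omega | simp [h1, h2, h3, h4]

/-- The total of all cumulative counts, which depends only on the type of the pairing. -/
def totalCount (lab : P → WithTop (Fin k)) (τ : Equiv.Perm P) : ℕ :=
  ∑ m ∈ Finset.range (k + 1), ∑ n ∈ Finset.range (k + 1), (Finset.univ.filter fun p =>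
    lab p ≠ ⊤ ∧ symNum (lab p) < m ∧ symNum (lab (fold lab τ p)) < n).card

theorem totalCount_eq_sum (w : P → Fin l) (τ : Equiv.Perm P) : totalCount lab τ =
    ∑ m ∈ Finset.range (k + 1), ∑ n ∈ Finset.range (k + 1), ∑ c, cumCount lab w τ c m n := by
  refine Finset.sum_congr rfl fun m _ => Finset.sum_congr rfl fun n _ => ?_
  rw [Finset.card_eq_sum_card_fiberwise (f := w) (t := Finset.univ) (by simp)]
  refine Finset.sum_congr rfl fun c _ => ?_
  rw [cumCount, colourClass, Finset.filter_filter, Finset.filter_filter]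
  exact congrArg Finset.card (Finset.filter_congr fun p _ => by tauto)

theorem totalCount_le (hτ : IsPairing τ) (hτ' : IsPairing τ') (hw : ∀ p, w (τ p) = w p)
    (hw' : ∀ p, w (τ' p) = w p) (hd : IsDecreasing lab w τ) :
    totalCount lab τ ≤ totalCount lab τ' := by
  rw [totalCount_eq_sum w, totalCount_eq_sum w]
  exact Finset.sum_le_sum fun m _ => Finset.sum_le_sum fun n _ => Finset.sum_le_sum fun c _ =>
    cumCount_le hτ hτ' hw hw' hd c m n

/-- Equal totals of termwise comparable corner counts force all of them to agree. -/
theorem cellCount_eq (hτ : IsPairing τ) (hτ' : IsPairing τ') (hw : ∀ p, w (τ p) = w p)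
    (hw' : ∀ p, w (τ' p) = w p) (hd : IsDecreasing lab w τ)
    (h : totalCount lab τ = totalCount lab τ') (c : Fin l) (i j : Fin k) :
    cellCount lab w τ c i j = cellCount lab w τ' c i j := by
  rw [totalCount_eq_sum w, totalCount_eq_sum w] at h
  have hcum : ∀ m n, m ≤ k → n ≤ k → cumCount lab w τ c m n = cumCount lab w τ' c m n := by
    intro m n hm hn
    have h1 := (Finset.sum_eq_sum_iff_of_le fun m _ => Finset.sum_le_sum fun n _ =>
      Finset.sum_le_sum fun c _ => cumCount_le hτ hτ' hw hw' hd c m n).mp h m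
      (Finset.mem_range.mpr (by omega))
    have h2 := (Finset.sum_eq_sum_iff_of_le fun n _ =>
      Finset.sum_le_sum fun c _ => cumCount_le hτ hτ' hw hw' hd c m n).mp h1 n
      (Finset.mem_range.mpr (by omega))
    exact (Finset.sum_eq_sum_iff_of_le fun c _ =>
      cumCount_le hτ hτ' hw hw' hd c m n).mp h2 c (Finset.mem_univ c)
  have h1 := cellCount_add (lab := lab) (w := w) (τ := τ) c i j
  have h2 := cellCount_add (lab := lab) (w := w) (τ := τ') c i j
  have hi := i.isLt
  have hj := j.isLt
  rw [hcum _ _ (by omega) (by omega), hcum _ _ (by omega) (by omega),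
    hcum _ _ (by omega) (by omega), hcum _ _ (by omega) (by omega)] at h1
  omega

theorem fold_conj {g : Equiv.Perm P} (hg : Preserves lab g) (p : P) :
    fold lab (g * τ * g⁻¹) (g p) = g (fold lab τ p) := by
  have h : g⁻¹ (g p) = p := by simp
  simp only [fold, Equiv.Perm.mul_apply, h, hg p, hg (τ p)]
  split_ifs <;> rfl

theorem totalCount_conj {g : Equiv.Perm P} (hg : Preserves lab g) :
    totalCount lab (g * τ * g⁻¹) = totalCount lab τ := by
  refine Finset.sum_congr rfl fun m _ => Finset.sum_congr rfl fun n _ => ?_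
  rw [Finset.card_filter, Finset.card_filter, ← Equiv.sum_comp g]
  refine Finset.sum_congr rfl fun p _ => ?_
  rw [fold_conj hg, hg, hg]

theorem sum_cellCount (w : P → Fin l) (τ : Equiv.Perm P) (i j : Fin k) :
    ∑ c, cellCount lab w τ c i j =
      (Finset.univ.filter fun p => lab p = i ∧ lab (fold lab τ p) = j).card := by
  rw [Finset.card_eq_sum_card_fiberwise (f := w) (t := Finset.univ) (by simp)]
  refine Finset.sum_congr rfl fun c _ => ?_
  rw [cellCount, colourClass, Finset.filter_filter, Finset.filter_filter]
  refine congrArg Finset.card (Finset.filter_congr fun p _ => ?_)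
  constructor
  · rintro ⟨⟨-, h1⟩, h2⟩; exact ⟨h2, h1⟩
  · rintro ⟨h1, h2⟩; exact ⟨⟨by rw [h1.1]; simp, h2⟩, h1⟩

end Counts

/-! ### Colouring by height -/

section Colouring

variable {k l : ℕ} {W : Finset (Fin k)} {P : Type*} [Fintype P] [LinearOrder P]
  {lab : P → WithTop (Fin k)} {τ : Equiv.Perm P}

/-- The strict order on positions whose chains correspond to `(W, W)`-increasing sequences. -/
def PosLt (W : Finset (Fin k)) (lab : P → WithTop (Fin k)) (τ : Equiv.Perm P) (p q : P) : Prop :=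
  (lab p ≤ lab q ∧ lab (fold lab τ p) ≤ lab (fold lab τ q)) ∧
  ((lab p = lab q → IsAnti W (lab p)) ∧
    (lab (fold lab τ p) = lab (fold lab τ q) → IsAnti W (lab (fold lab τ p)))) ∧
  -- The tie-breaker orders repeated copies of a point. It is symmetric in p and `fold lab τ p`,
  -- which keeps the order invariant under `fold`.
  (lab p = lab q → lab (fold lab τ p) = lab (fold lab τ q) →
    min p (fold lab τ p) < min q (fold lab τ q))

theorem PosLt.trans {p q s : P} (h : PosLt W lab τ p q) (h' : PosLt W lab τ q s) :
    PosLt W lab τ p s := by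
  obtain ⟨⟨a1, a2⟩, ⟨a3, a4⟩, a5⟩ := h
  obtain ⟨⟨b1, b2⟩, ⟨b3, b4⟩, b5⟩ := h'
  have e1 : lab p = lab s → lab p = lab q := fun e => le_antisymm a1 (b1.trans_eq e.symm)
  have e2 : lab (fold lab τ p) = lab (fold lab τ s) → lab (fold lab τ p) = lab (fold lab τ q) :=
    fun e => le_antisymm a2 (b2.trans_eq e.symm)
  exact ⟨⟨a1.trans b1, a2.trans b2⟩, ⟨fun e => a3 (e1 e), fun e => a4 (e2 e)⟩, fun e e' =>
    (a5 (e1 e) (e2 e')).trans (b5 ((e1 e).symm.trans e) ((e2 e').symm.trans e'))⟩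

theorem PosLt.irrefl (p : P) : ¬ PosLt W lab τ p p := fun h => lt_irrefl _ (h.2.2 rfl rfl)

theorem PosLt.fold (hτ : IsPairing τ) {p q : P} (h : PosLt W lab τ p q) :
    PosLt W lab τ (fold lab τ p) (fold lab τ q) := by
  obtain ⟨a, b, c⟩ := h
  refine ⟨?_, ?_, ?_⟩ <;> simp only [fold_fold hτ]
  · exact a.symm
  · exact b.symm
  · intro e e'
    rw [min_comm, min_comm _ q]
    exact c e' e

theorem posLt_fold_iff (hτ : IsPairing τ) (p q : P) :
    PosLt W lab τ (OrthInv.fold lab τ p) (OrthInv.fold lab τ q) ↔ PosLt W lab τ p q := by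
  refine ⟨fun h => ?_, fun h => h.fold hτ⟩
  have := h.fold hτ
  rwa [fold_fold hτ, fold_fold hτ] at this

/-- The positions of a chain are distinct, so their points respect the multiplicities of M and form
an increasing sequence. -/
theorem length_le_of_pairwise_posLt {M : Multiset (Fin k × Fin k)} (hM : HasType W lab τ M)
    (hl : incLength W W M ≤ l) (L : List P) (hS : ∀ p ∈ L, lab p ≠ ⊤)
    (hL : L.Pairwise (PosLt W lab τ)) : L.length ≤ l := by
  rcases L.eq_nil_or_concat with rfl | ⟨L', b, hb⟩
  · simp
  have hbS : lab b ≠ ⊤ := hS b (by simp [hb])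
  have : Nonempty (Fin k) := ⟨(lab b).untop hbS⟩
  have hf : ∀ p, ∃ x : Fin k × Fin k, lab p ≠ ⊤ →
      lab p = (x.1 : WithTop (Fin k)) ∧ lab (OrthInv.fold lab τ p) = (x.2 : WithTop (Fin k)) := by
    intro p
    by_cases h : lab p = ⊤
    · exact ⟨Classical.arbitrary _, fun h' => absurd h h'⟩
    · obtain ⟨x, hx⟩ := WithTop.ne_top_iff_exists.mp h
      obtain ⟨y, hy⟩ := WithTop.ne_top_iff_exists.mp (lab_fold_ne_top (τ := τ) h)
      exact ⟨(x, y), fun _ => ⟨hx.symm, hy.symm⟩⟩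
  choose f hf using hf
  have hnd : L.Nodup := hL.imp fun {p q} h => by
    rintro rfl
    exact PosLt.irrefl _ h
  have h1 : IsIncSubseq W W M (L.map f) := by
    constructor
    · refine List.Pairwise.isChain ?_
      rw [List.pairwise_map]
      refine hL.imp_of_mem fun {p q} hp hq h => ?_
      obtain ⟨⟨a1, a2⟩, ⟨a3, a4⟩, -⟩ := h
      obtain ⟨p1, p2⟩ := hf p (hS p hp)
      obtain ⟨q1, q2⟩ := hf q (hS q hq)
      rw [p1, q1] at a1 a3
      rw [p2, q2] at a2 a4
      rw [isAnti_coe, WithTop.coe_inj] at a3 a4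
      exact ⟨WithTop.coe_le_coe.mp a1, WithTop.coe_le_coe.mp a2, a3, a4⟩
    · rw [Multiset.le_iff_count]
      rintro ⟨i, j⟩
      rw [hM.count_eq, ← Multiset.map_coe, Multiset.count_map]
      have hnd' : ((L : Multiset P).filter fun p => (i, j) = f p).Nodup :=
        (Multiset.coe_nodup.mpr hnd).filter _
      rw [← Multiset.toFinset_card_of_nodup hnd']
      refine Finset.card_le_card fun p hp => ?_
      rw [Multiset.mem_toFinset, Multiset.mem_filter, Multiset.mem_coe] at hp
      have := hf p (hS p hp.1)
      rw [← hp.2] at this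
      simpa using this
  have := (incLength_le_iff W W M l).mp hl _ h1
  simpa using this

/-- Positions of a reduced pairing with the same antisymmetric point have distinct tie-breakers. -/
theorem min_fold_ne (hτ : IsPairing τ) (hr : IsReduced lab (IsAnti W) τ) {p q : P}
    (h1 : lab p = lab q) (ha : IsAnti W (lab p)) (hpq : p ≠ q) :
    min p (OrthInv.fold lab τ p) ≠ min q (OrthInv.fold lab τ q) := by
  have key : ∀ p q : P, lab p = lab q → IsAnti W (lab p) → p ≠ q → OrthInv.fold lab τ p ≠ q := by
    intro p q h ha hpq he
    unfold OrthInv.fold at he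
    split_ifs at he
    · exact hpq he
    · exact hr.1 p (by rw [he, h]) ha
  intro h
  rcases min_choice p (OrthInv.fold lab τ p) with e | e <;>
    rcases min_choice q (OrthInv.fold lab τ q) with e' | e' <;> rw [e, e'] at h
  · exact hpq h
  · exact key q p h1.symm (h1 ▸ ha) hpq.symm h.symm
  · exact key p q h1 ha hpq h
  · exact hpq (by rw [← fold_fold hτ p, h, fold_fold hτ])

/-- A pairing whose type has no long increasing sequence admits a decreasing colouring. -/
theorem exists_colouring (hτ : IsPairing τ) (hr : IsReduced lab (IsAnti W) τ)
    {M : Multiset (Fin k × Fin k)} (hM : HasType W lab τ M) (hl : incLength W W M ≤ l) :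
    ∃ w : P → Fin l, (∀ p, w (τ p) = w p) ∧ IsDecreasing lab w τ ∧
      ∀ p q, lab p = lab q → IsAnti W (lab p) → w p = w q → p = q := by
  obtain ⟨h, hlt, hhl, hinv⟩ := exists_height (PosLt W lab τ) (fun p => lab p ≠ ⊤)
    (fun _ _ _ => PosLt.trans) l (length_le_of_pairwise_posLt hM hl)
  -- `fold` is an automorphism of the order, so heights are constant on pairs.
  have hfold : ∀ p, h (OrthInv.fold lab τ p) = h p := by
    refine hinv ⟨OrthInv.fold lab τ, OrthInv.fold lab τ, fold_fold hτ, fold_fold hτ⟩ ?_ ?_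
    · intro p
      refine ⟨fun h' => ?_, lab_fold_ne_top⟩
      have := lab_fold_ne_top (τ := τ) h'
      rwa [Equiv.coe_fn_mk, fold_fold hτ] at this
    · exact posLt_fold_iff hτ
  have htop : ∀ p, lab p = ⊤ → lab (τ p) ≠ ⊤ := fun p hp h' =>
    hr.1 p (hp.trans h'.symm) (by rw [hp]; exact isAnti_top W)
  -- A position of the block of ∞ takes the height of its partner.
  set h' : P → ℕ := fun p => if lab p = ⊤ then h (τ p) else h p with hh'
  have h'top : ∀ p, lab p = ⊤ → h' p = h (τ p) := fun p hp => if_pos hp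
  have h'ne : ∀ p, lab p ≠ ⊤ → h' p = h p := fun p hp => if_neg hp
  have hB : ∀ p q, lab p ≠ ⊤ → lab q ≠ ⊤ → h p = h q → lab p < lab q →
      lab (OrthInv.fold lab τ q) ≤ lab (OrthInv.fold lab τ p) := by
    intro p q hp hq he hlab
    by_contra! hc
    exact absurd he (hlt p q hp hq ⟨⟨hlab.le, hc.le⟩, ⟨fun e => absurd e hlab.ne,
      fun e => absurd e hc.ne⟩, fun e => absurd e hlab.ne⟩).ne
  have hB' : ∀ p q, lab p ≠ ⊤ → lab q ≠ ⊤ → h p = h q → lab p = lab q → IsAnti W (lab p) →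
      lab (OrthInv.fold lab τ q) ≤ lab (OrthInv.fold lab τ p) := by
    intro p q hp hq he hlab ha
    by_contra! hc
    exact absurd he (hlt p q hp hq ⟨⟨hlab.le, hc.le⟩, ⟨fun _ => ha,
      fun e => absurd e hc.ne⟩, fun _ e => absurd e hc.ne⟩).ne
  have hA : ∀ p q, lab p ≠ ⊤ → lab q ≠ ⊤ → h p = h q → lab p = lab q → IsAnti W (lab p) →
      lab (OrthInv.fold lab τ p) = lab (OrthInv.fold lab τ q) →
      IsAnti W (lab (OrthInv.fold lab τ p)) → p = q := by
    intro p q hp hq he h1 ha h2 ha'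
    by_contra hpq
    rcases lt_or_gt_of_ne (min_fold_ne hτ hr h1 ha hpq) with hc | hc
    · exact absurd he (hlt p q hp hq ⟨⟨h1.le, h2.le⟩, ⟨fun _ => ha, fun _ => ha'⟩,
        fun _ _ => hc⟩).ne
    · exact absurd he (hlt q p hq hp ⟨⟨h1.ge, h2.ge⟩, ⟨fun _ => h1 ▸ ha, fun _ => h2 ▸ ha'⟩,
        fun _ _ => hc⟩).ne'
  refine ⟨fun p => ⟨h' p, ?_⟩, fun p => Fin.ext ?_, ?_, ?_⟩
  · by_cases hp : lab p = ⊤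
    · rw [h'top p hp]; exact hhl _ (htop p hp)
    · rw [h'ne p hp]; exact hhl _ hp
  · change h' (τ p) = h' p
    by_cases hp : lab p = ⊤
    · rw [h'top p hp, h'ne _ (htop p hp)]
    · by_cases hp' : lab (τ p) = ⊤
      · rw [h'top _ hp', h'ne p hp, hτ.1]
      · rw [h'ne _ hp', h'ne p hp, ← fold_of_ne_top hp hp', hfold]
  · intro p q hp hq he hlab
    have he : h' p = h' q := congrArg Fin.val he
    rw [h'ne p hp, h'ne q hq] at he
    exact hB p q hp hq he hlab
  · intro p q hlab ha he
    have he : h' p = h' q := congrArg Fin.val he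
    by_cases hp : lab p = ⊤
    · have hq : lab q = ⊤ := hlab ▸ hp
      rw [h'top p hp, h'top q hq] at he
      have fp : OrthInv.fold lab τ (τ p) = τ p := fold_of_top (by rwa [hτ.1])
      have fq : OrthInv.fold lab τ (τ q) = τ q := fold_of_top (by rwa [hτ.1])
      have h1 := hB _ _ (htop p hp) (htop q hq) he
      have h2 := hB _ _ (htop q hq) (htop p hp) he.symm
      rw [fp, fq] at h1 h2
      -- Partners of positions of ∞ represent diagonal points, and distinct diagonal points are
      -- comparable, so equal heights force equal labels.
      have hl' : lab (τ p) = lab (τ q) := by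
        rcases lt_trichotomy (lab (τ p)) (lab (τ q)) with h3 | h3 | h3
        · exact absurd (h1 h3) h3.not_ge
        · exact h3
        · exact absurd (h2 h3) h3.not_ge
      by_cases ha' : IsAnti W (lab (τ p))
      · exact τ.injective (hA _ _ (htop p hp) (htop q hq) he hl' ha' (by rw [fp, fq, hl'])
          (by rwa [fp]))
      · exact hr.2 p q hlab hl' ha ha'
    · have hq : lab q ≠ ⊤ := hlab ▸ hp
      rw [h'ne p hp, h'ne q hq] at he
      have hl' := le_antisymm (hB' q p hq hp he.symm hlab.symm (hlab ▸ ha)) (hB' p q hp hq he hlab ha)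
      by_cases ha' : IsAnti W (lab (OrthInv.fold lab τ p))
      · exact hA p q hp hq he hlab ha hl' ha'
      · have hne : ∀ p, lab p ≠ ⊤ → IsAnti W (lab p) → ¬ IsAnti W (lab (OrthInv.fold lab τ p)) →
            OrthInv.fold lab τ p = τ p := by
          intro p hp ha ha'
          refine fold_of_ne_top hp fun ht => ha' ?_
          rwa [fold_of_top ht]
        have e1 := hne p hp ha ha'
        have e2 := hne q hq (hlab ▸ ha) (hl' ▸ ha')
        rw [e1] at ha'
        rw [e1, e2] at hl'
        exact hr.2 p q hlab hl' ha ha'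

end Colouring

/-! ### Evaluation at a decreasing colouring -/

section Triangularity

variable {k l : ℕ} {W : Finset (Fin k)} {P : Type*} [Fintype P] [LinearOrder P]
  {lab : P → WithTop (Fin k)} {w : P → Fin l} {τ τ' : Equiv.Perm P}

theorem isReduced_conj {L : Type*} [LinearOrder L] {lab : P → L} {anti : L → Prop}
    [DecidablePred anti] {g : Equiv.Perm P} (hg : Preserves lab g)
    (h : IsReduced lab anti τ) : IsReduced lab anti (g * τ * g⁻¹) := by
  have e : ∀ p, lab ((g * τ * g⁻¹) p) = lab (τ (g⁻¹ p)) := fun p => hg _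
  refine ⟨fun p hp => ?_, fun p q h1 h2 h3 h4 => ?_⟩
  · rw [e] at hp
    rw [← hg.inv p] at hp ⊢
    exact h.1 _ hp
  · rw [e] at h2 h4
    rw [e] at h2
    rw [← hg.inv p] at h3
    rw [← hg.inv p, ← hg.inv q] at h1
    exact g⁻¹.injective (h.2 _ _ h1 h2 h3 h4)

/-- The cell count of a diagonal cell has the parity of the number of its fixed points. -/
theorem exists_cellCount_diag (hτ : IsPairing τ) (hw : ∀ p, w (τ p) = w p) (c : Fin l)
    (i : Fin k) : ∃ e, cellCount lab w τ c i i = (Finset.univ.filter fun p =>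
      lab p = i ∧ w p = c ∧ lab (τ p) = ⊤).card + (e + e) := by
  -- Labels are refined by colours, the lexicographic order serving only as a linear order. Pairs
  -- inside one refined class account for an even number of positions.
  obtain ⟨e, he⟩ := even_typeCount_self (lab := fun p => toLex (lab p, w p)) hτ
    (toLex ((i : WithTop (Fin k)), c))
  refine ⟨e, ?_⟩
  rw [← he, cellCount, colourClass, Finset.filter_filter, typeCount,
    ← Finset.card_filter_add_card_filter_not (fun p => lab (τ p) = ⊤), Finset.filter_filter,
    Finset.filter_filter]
  congr 1
  · refine congrArg Finset.card (Finset.filter_congr fun p _ => ⟨?_, ?_⟩)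
    · rintro ⟨⟨⟨-, h1⟩, h2, -⟩, h3⟩
      exact ⟨h2, h1, h3⟩
    · rintro ⟨h1, h2, h3⟩
      rw [fold_of_top h3]
      exact ⟨⟨⟨by simp [h1], h2⟩, h1, h1⟩, h3⟩
  · refine congrArg Finset.card (Finset.filter_congr fun p _ => ?_)
    simp only [EmbeddingLike.apply_eq_iff_eq, Prod.mk.injEq]
    constructor
    · rintro ⟨⟨⟨h0, h1⟩, h2, h3⟩, h4⟩
      rw [fold_of_ne_top h0 h4] at h3
      exact ⟨⟨h2, h1⟩, h3, (hw p).trans h1⟩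
    · rintro ⟨⟨h1, h2⟩, h3, -⟩
      have h0 : lab p ≠ ⊤ := by simp [h1]
      have h4 : lab (τ p) ≠ ⊤ := by simp [h3]
      rw [fold_of_ne_top h0 h4]
      exact ⟨⟨⟨h0, h2⟩, h1, h3⟩, h4⟩

/-- A position in an antisymmetrized block is determined by its label and colour. Outside ∞ the cell
counts therefore give the label of its image under `fold`, and reducedness rules out confusing a
partner in its own block with one in the block of ∞. -/
theorem lab_apply_eq_of_cellCount_eq (hτ : IsPairing τ) (hτ' : IsPairing τ')
    (hr : IsReduced lab (IsAnti W) τ) (hr' : IsReduced lab (IsAnti W) τ')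
    (hw : ∀ p, w (τ p) = w p) (hw' : ∀ p, w (τ' p) = w p)
    (hinj : ∀ p q, lab p = lab q → IsAnti W (lab p) → w p = w q → p = q)
    (hcell : ∀ c i j, cellCount lab w τ c i j = cellCount lab w τ' c i j)
    (q : P) (hq : IsAnti W (lab q)) : lab (τ' q) = lab (τ q) := by
  by_cases htop : lab q = ⊤
  · have hne : lab (τ q) ≠ ⊤ := fun h => hr.1 q (htop.trans h.symm) hq
    obtain ⟨i, hi⟩ := WithTop.ne_top_iff_exists.mp hne
    have huniq : ∀ τ : Equiv.Perm P, IsPairing τ → (∀ p, w (τ p) = w p) →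
        ∀ p, w p = w q → lab (τ p) = ⊤ → p = τ q := by
      intro τ hτ hw p hp h
      have := hinj q (τ p) (htop.trans h.symm) hq (by rw [hw, hp])
      rw [this, hτ.1]
    have h1 : (Finset.univ.filter fun p => lab p = i ∧ w p = w q ∧ lab (τ p) = ⊤) = {τ q} := by
      ext p
      simp only [Finset.mem_filter, Finset.mem_univ, true_and, Finset.mem_singleton]
      constructor
      · rintro ⟨-, h2, h3⟩
        exact huniq τ hτ hw p h2 h3
      · rintro rfl
        exact ⟨hi.symm, hw q, by rwa [hτ.1]⟩
    obtain ⟨e, he⟩ := exists_cellCount_diag (lab := lab) hτ hw (w q) i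
    obtain ⟨e', he'⟩ := exists_cellCount_diag (lab := lab) hτ' hw' (w q) i
    rw [← hcell, he, h1, Finset.card_singleton] at he'
    -- The numbers of fixed points of τ and τ' of this colour at i have equal parity, and the first
    -- is 1.
    have hpos : (Finset.univ.filter fun p => lab p = i ∧ w p = w q ∧ lab (τ' p) = ⊤).Nonempty := by
      rw [← Finset.card_pos]
      omega
    obtain ⟨p, hp⟩ := hpos
    simp only [Finset.mem_filter, Finset.mem_univ, true_and] at hp
    rw [← huniq τ' hτ' hw' p hp.2.1 hp.2.2, hp.1, hi]
  · obtain ⟨i, hi⟩ := WithTop.ne_top_iff_exists.mp htop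
    obtain ⟨j, hj⟩ := WithTop.ne_top_iff_exists.mp (lab_fold_ne_top (τ := τ) htop)
    have hpos : 0 < cellCount lab w τ (w q) i j := by
      rw [cellCount, Finset.card_pos]
      exact ⟨q, by simp [colourClass, htop, hi, hj]⟩
    rw [hcell, cellCount, Finset.card_pos] at hpos
    obtain ⟨p, hp⟩ := hpos
    simp only [colourClass, Finset.mem_filter, Finset.mem_univ, true_and] at hp
    obtain rfl := hinj q p (hi.symm.trans hp.2.1.symm) hq hp.1.2.symm
    have hfold : lab (fold lab τ' q) = lab (fold lab τ q) := hp.2.2.trans hj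
    by_cases h1 : lab (τ q) = ⊤ <;> by_cases h2 : lab (τ' q) = ⊤
    · rw [h1, h2]
    · rw [fold_of_top h1, fold_of_ne_top htop h2] at hfold
      exact absurd hq (hr'.1 q hfold.symm)
    · rw [fold_of_top h2, fold_of_ne_top htop h1] at hfold
      exact absurd hq (hr.1 q hfold)
    · rwa [fold_of_ne_top htop h1, fold_of_ne_top htop h2] at hfold

/-- The conjugate g τ g⁻¹ fits the same colouring and has the same total count, so both pairings
send antisymmetric positions to the same labels. Reducedness then makes g fix those paired with
symmetric positions, and injectivity of the colouring makes g commute with τ on the others. -/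
theorem labSign_eq_one_of_invariant (hτ : IsPairing τ) (hr : IsReduced lab (IsAnti W) τ)
    (hw : ∀ p, w (τ p) = w p) (hd : IsDecreasing lab w τ)
    (hinj : ∀ p q, lab p = lab q → IsAnti W (lab p) → w p = w q → p = q)
    {g : Equiv.Perm P} (hg : Preserves lab g) (hgw : ∀ p, w (g (τ p)) = w (g p)) :
    labSign lab (IsAnti W) g = 1 := by
  set τ' := g * τ * g⁻¹ with hτ'def
  have hτ' : IsPairing τ' := hτ.conj g
  have hτ'g : ∀ p, τ' (g p) = g (τ p) := fun p => by simp [hτ'def]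
  have hw' : ∀ p, w (τ' p) = w p := fun p => by
    have := hgw (g⁻¹ p)
    rwa [← hτ'g, show g (g⁻¹ p) = p by simp] at this
  have hcell := cellCount_eq hτ hτ' hw hw' hd (totalCount_conj hg).symm
  have hC := lab_apply_eq_of_cellCount_eq hτ hτ' hr (isReduced_conj hg hr) hw hw' hinj hcell
  have hC' : ∀ p, IsAnti W (lab p) → lab (τ (g p)) = lab (τ p) := fun p hp => by
    rw [← hC (g p) (by rwa [hg]), hτ'g, hg]
  refine labSign_eq_one_of_commute hτ hr hg (fun p h1 h2 => ?_) (fun p h1 h2 => ?_)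
  · exact hr.2 _ _ (hg p) (hC' p h1) (by rwa [hg]) (by rwa [hC' p h1])
  · exact hinj _ _ (by rw [hg, hC' p h1]) (by rwa [hg]) (by rw [hgw, hw])

/-- All nonvanishing terms are +1, and the identity provides one. -/
theorem labOp_pairFun_apply_ne_zero (hτ : IsPairing τ) (hr : IsReduced lab (IsAnti W) τ)
    (hw : ∀ p, w (τ p) = w p) (hd : IsDecreasing lab w τ)
    (hinj : ∀ p q, lab p = lab q → IsAnti W (lab p) → w p = w q → p = q) :
    labOp lab (IsAnti W) l (pairFun l τ) w ≠ 0 := by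
  have h : labOp lab (IsAnti W) l (pairFun l τ) w = ((Finset.univ.filter fun g : Equiv.Perm P =>
      Preserves lab g ∧ ∀ p, w (g (τ p)) = w (g p)).card : ℂ) := by
    rw [Finset.card_filter, Nat.cast_sum]
    refine Finset.sum_congr rfl fun g _ => ?_
    simp only [pairFun]
    by_cases hg : Preserves lab g
    · by_cases hgw : ∀ p, w (g (τ p)) = w (g p)
      · rw [labSign_eq_one_of_invariant hτ hr hw hd hinj hg hgw]
        simp [hg, hgw]
      · simp [hgw]
    · simp [labSign_eq_zero _ hg, hg]
  rw [h, Nat.cast_ne_zero, Finset.card_ne_zero]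
  exact ⟨1, Finset.mem_filter.mpr ⟨Finset.mem_univ _, fun _ => rfl, hw⟩⟩

theorem exists_of_labOp_pairFun_apply_ne_zero
    (h : labOp lab (IsAnti W) l (pairFun l τ) w ≠ 0) :
    ∃ g : Equiv.Perm P, Preserves lab g ∧ ∀ p, w ((g * τ * g⁻¹) p) = w p := by
  obtain ⟨g, -, hg⟩ := Finset.exists_ne_zero_of_sum_ne_zero h
  refine ⟨g, ?_, fun p => ?_⟩
  · by_contra hn
    exact hg (by rw [labSign_eq_zero _ hn]; simp)
  · have h1 := right_ne_zero_of_mul hg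
    rw [pairFun, ite_ne_right_iff] at h1
    have := h1.1 (g⁻¹ p)
    rwa [show g (g⁻¹ p) = p by simp] at this

/-- The functions of pairings whose types are distinct and without long increasing sequences are
linearly independent. -/
theorem linearIndependent_labOp_pairFun {ι : Type*} (τ : ι → Equiv.Perm P)
    (M : ι → Multiset (Fin k × Fin k)) (hinj : Function.Injective M) (hτ : ∀ i, IsPairing (τ i))
    (hM : ∀ i, HasType W lab (τ i) (M i)) (hc : ∀ i, IsCompatible W W (M i))
    (hl : ∀ i, incLength W W (M i) ≤ l) :
    LinearIndependent ℂ fun i => labOp lab (IsAnti W) l (pairFun l (τ i)) := by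
  have hr : ∀ i, IsReduced lab (IsAnti W) (τ i) := fun i => (hM i).isReduced (hc i)
  choose w hw hd hi using fun i => exists_colouring (l := l) (hτ i) (hr i) (hM i) (hl i)
  -- Each vector is tested by evaluation at its own colouring, and the total corner count orders the
  -- types.
  refine linearIndependent_of_triangular _ (fun i => LinearMap.proj (w i))
    (fun i => totalCount lab (τ i)) (fun i => ?_) fun i j hij => ?_
  · exact labOp_pairFun_apply_ne_zero (hτ i) (hr i) (hw i) (hd i) (hi i)
  · obtain ⟨g, hg, hgw⟩ := exists_of_labOp_pairFun_apply_ne_zero hij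
    have hle := totalCount_le (hτ i) ((hτ j).conj g) (hw i) hgw (hd i)
    rw [totalCount_conj hg] at hle
    rcases hle.lt_or_eq with h | h
    · exact Or.inr h
    · refine Or.inl (hinj ?_)
      have hcell := cellCount_eq (hτ i) ((hτ j).conj g) (hw i) hgw (hd i)
        (h.trans (totalCount_conj hg).symm)
      ext ⟨x, y⟩
      rw [(hM i).count_eq, (hM j).count_eq, ← sum_cellCount (w i),
        Finset.sum_congr rfl fun c _ => hcell c x y, sum_cellCount, Finset.card_filter,
        Finset.card_filter, ← Equiv.sum_comp g]
      refine Finset.sum_congr rfl fun p _ => ?_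
      rw [fold_conj hg, hg, hg]

end Triangularity

/-! ### Return to the tensor power -/

section Tensors

variable {k l a : ℕ} {ν : Fin k → ℕ} {W : Finset (Fin k)}

theorem corresponds_iff (τ : Equiv.Perm (Fin ((∑ i, ν i) + a))) (M : Multiset (Fin k × Fin k)) :
    Corresponds W ν a τ M ↔ HasType W (posLabel ν a) τ M := by
  have h : ∀ u v, ((block ν a u).filter fun p => τ p ∈ block ν a v).card =
      typeCount (posLabel ν a) τ u v := by
    intro u v
    rw [typeCount]
    congr 1
    ext p
    simp [mem_block_iff]
  simp only [Corresponds, HasType, h, eq_comm]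

theorem card_posLabel_coe (i : Fin k) :
    (Finset.univ.filter fun p => posLabel ν a p = i).card = ν i := by
  rw [← card_block_coe ν a i]
  congr 1
  ext p
  simp [mem_block_iff]

theorem card_posLabel_top : (Finset.univ.filter fun p => posLabel ν a p = ⊤).card = a := by
  conv_rhs => rw [← card_block_top ν a]
  congr 1
  ext p
  simp [mem_block_iff]

theorem isBasicInvariant_iff (M : Multiset (Fin k × Fin k)) (t : TensorPow l ((∑ i, ν i) + a)) :
    IsBasicInvariant l W ν a M t ↔ ∃ τ, IsPairing τ ∧ HasType W (posLabel ν a) τ M ∧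
      coords l _ t = labOp (posLabel ν a) (IsAnti W) l (pairFun l τ) := by
  refine exists_congr fun τ => and_congr Iff.rfl (and_congr (corresponds_iff τ M) ?_)
  rw [← coords_involutionInvariant, ← coords_blockOp, (coords l _).injective.eq_iff]

/-- Pairings of the same type have the same function up to sign. -/
theorem HasType.labOp_eq_or_eq_neg {P : Type*} [Fintype P] [LinearOrder P]
    {lab : P → WithTop (Fin k)} {τ τ' : Equiv.Perm P} {M : Multiset (Fin k × Fin k)}
    (hτ : IsPairing τ) (hτ' : IsPairing τ') (h : HasType W lab τ M) (h' : HasType W lab τ' M) :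
    labOp lab (IsAnti W) l (pairFun l τ') = labOp lab (IsAnti W) l (pairFun l τ) ∨
      labOp lab (IsAnti W) l (pairFun l τ') = -labOp lab (IsAnti W) l (pairFun l τ) := by
  obtain ⟨g, hg, rfl⟩ := exists_conj_of_typeCount_eq hτ hτ' fun u v => (h u v).trans (h' u v).symm
  rw [labOp_pairFun_conj _ hg]
  rcases mul_self_eq_one_iff.mp (labSign_sq (IsAnti W) hg) with e | e <;> rw [e]
  · left; simp
  · right; simp

theorem map_coords_orthInvariants (l m : ℕ) :
    (orthInvariants l m).map (coords l m).toLinearMap = orthInvariantFun l (Fin m) := by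
  ext X
  rw [Submodule.mem_map]
  constructor
  · rintro ⟨x, hx, rfl⟩
    exact mem_orthInvariants.mp hx
  · intro hX
    refine ⟨(coords l m).symm X, mem_orthInvariants.mpr ?_, by simp⟩
    rw [LinearEquiv.apply_symm_apply]
    exact hX

end Tensors

end OrthInv

end

theorem theorem8p6 (l a k : ℕ) (ν : Fin k → ℕ) (W : Finset (Fin k)) :
    (∀ M ∈ OrthInv.symMultisets W ν a,
      ∃ t, OrthInv.IsBasicInvariant l W ν a M t ∧
        ∀ t', OrthInv.IsBasicInvariant l W ν a M t' → t' = t ∨ t' = -t) ∧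
    ∀ T : {M // M ∈ OrthInv.symMultisets W ν a ∧ OrthInv.incLength W W M ≤ l} →
        OrthInv.TensorPow l ((∑ i, ν i) + a),
      (∀ M, OrthInv.IsBasicInvariant l W ν a M.1 (T M)) →
        LinearIndependent ℂ T ∧
        Submodule.span ℂ (Set.range T) =
          (OrthInv.orthInvariants l ((∑ i, ν i) + a)).map (OrthInv.blockOp l W ν a) := by
  open OrthInv in
  refine ⟨fun M hM => ?_, fun T hT => ?_⟩
  · obtain ⟨τ, hτ, h⟩ := exists_hasType card_posLabel_coe card_posLabel_top hM
    refine ⟨blockOp l W ν a (involutionInvariant l τ), ⟨τ, hτ, (corresponds_iff τ M).mpr h, rfl⟩,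
      fun t' ht' => ?_⟩
    obtain ⟨τ', hτ', h', e⟩ := (isBasicInvariant_iff M t').mp ht'
    have h1 := HasType.labOp_eq_or_eq_neg (l := l) hτ hτ' h h'
    rw [← e, ← coords_involutionInvariant, ← coords_blockOp, ← map_neg] at h1
    exact h1.imp (fun h => (coords l _).injective h) fun h => (coords l _).injective h
  · have hT' : ∀ M, ∃ τ, IsPairing τ ∧ HasType W (posLabel ν a) τ M.1 ∧
        coords l _ (T M) = labOp (posLabel ν a) (IsAnti W) l (pairFun l τ) := by
      intro M
      exact (isBasicInvariant_iff _ _).mp (hT M)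
    choose τ hτ hM e using hT'
    have hcomp : ⇑(coords l ((∑ i, ν i) + a)).toLinearMap ∘ T =
        fun M => labOp (posLabel ν a) (IsAnti W) l (pairFun l (τ M)) := funext e
    constructor
    · have h := linearIndependent_labOp_pairFun τ Subtype.val Subtype.val_injective hτ hM
        (fun M => M.2.1.2.1) fun M => M.2.2
      rw [← hcomp] at h
      exact h.of_comp _
    · apply Submodule.map_injective_of_injective
        (f := (coords l ((∑ i, ν i) + a)).toLinearMap) (coords l _).injective
      have hmap : ((orthInvariants l ((∑ i, ν i) + a)).map (blockOp l W ν a)).map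
          (coords l _).toLinearMap =
          (orthInvariantFun l (Fin _)).map (labOp (posLabel ν a) (IsAnti W) l) := by
        rw [← map_coords_orthInvariants, ← Submodule.map_comp, ← Submodule.map_comp]
        congr 1
        exact LinearMap.ext fun x => coords_blockOp ν a l W x
      rw [hmap, orthInvariantFun_eq_span, Submodule.map_span, Submodule.map_span, ← Set.range_comp,
        hcomp]
      apply le_antisymm
      · refine Submodule.span_mono ?_
        rintro _ ⟨M, rfl⟩
        exact ⟨_, ⟨τ M, hτ M, rfl⟩, rfl⟩
      · rw [Submodule.span_le]
        rintro _ ⟨_, ⟨σ, hσ, rfl⟩, rfl⟩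
        refine labOp_pairFun_mem card_posLabel_coe card_posLabel_top _ ?_ _ σ hσ rfl
        intro σ hσ M h1 h2 h3
        have hmem := Submodule.subset_span (R := ℂ) (Set.mem_range_self (f := fun M =>
          labOp (posLabel ν a) (IsAnti W) l (pairFun l (τ M))) ⟨M, h1, h3⟩)
        -- Straightening ends in some pairing of type M, which agrees with the chosen one up to
        -- sign.
        rcases HasType.labOp_eq_or_eq_neg (l := l) (hτ ⟨M, h1, h3⟩) hσ (hM ⟨M, h1, h3⟩) h2
          with h | h <;> rw [h]
        · exact hmem
        · exact Submodule.neg_mem _ hmem
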